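/- Let $K$ be an infinite field. Closed means closed in the Zariski topology on the $K$-points of a finite-dimensional $K$-vector space, and $\bigwedge^p(V^*)$ is identified with $(\bigwedge^p V)^*$ by $\langle x_1\wedge\dots\wedge x_p,\ v_1\wedge\dots\wedge v_p\rangle=\sum_{\pi\in S_p}\operatorname{sgn}(\pi)\prod_i x_i(v_{\pi(i)})$. If $\dim V=n+p$, a Hodge dual is a linear map $\star:\bigwedge^pV\to\bigwedge^nV^*$ of the form $\star(\omega)(\omega')=\psi(\omega\wedge\omega')$, where $\psi:\bigwedge^{p+n}V\to K$ is a linear isomorphism. A Plücker variety $\mathbf X$ over $K$ assigns to every $p\in\mathbb Z_{\ge0}$ and every finite-dimensional $K$-vector space $V$ a closed subset $\mathbf X_p(V)\subseteq\bigwedge^pV$ such that $\bigwedge^p\varphi$ maps $\mathbf X_p(V)$ into $\mathbf X_p(W)$ for every linear map $\varphi:V\to W$, and every Hodge dual $\star:\bigwedge^pV\to\bigwedge^nV^*$ (with $\dim V=n+p$) maps $\mathbf X_p(V)$ into $\mathbf X_n(V^*)$. It is bounded if $\mathbf X_2(V)\ne\bigwedge^2V$ for some finite-dimensional $V$. For $n,p\in\mathbb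 Z_{\ge0}$ let $V_{n,p}$ be the $K$-vector space with basis $x_{-n},\dots,x_{-1},x_1,\dots,x_p$, let $G_{n,p}=\mathrm{GL}(V_{n,p})$, which acts on $\bigwedge^pV_{n,p}^*$ through the contragredient action on $V_{n,p}^*$, and put $X_{n,p}=\mathbf X_p(V_{n,p}^*)\subseteq\bigwedge^pV_{n,p}^*$. For $n_1\le n$ and $p_1\le p$ let $\pi_{n_1,p_1}:\bigwedge^pV_{n,p}^*\to\bigwedge^{p_1}V_{n_1,p_1}^*$ be the dual of the map $\bigwedge^{p_1}V_{n_1,p_1}\to\bigwedge^pV_{n,p}$, $\omega\mapsto\omega\wedge x_{p_1+1}\wedge\dots\wedge x_p$. Let $\mathbf X$ be a bounded Plücker variety over $K$. Then there exist $n_0,p_0\in\mathbb Z_{\ge0}$ such that for all $n,p\in\mathbb Z_{\ge0}$ and all $\omega\in\bigwedge^pV_{n,p}^*$ the following are equivalent: 1. $\omega\notin X_{n,p}$; 2. there exists $g\in G_{n,p}$ with $\pi_{\min(n,n_0),\min(p,p_0)}(g\omega)\notin X_{\min(n,n_0),\min(p,p_0)}$. -/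

import Mathlib

universe u

namespace Plucker

open Module

noncomputable section

/-- A subset of a vector space `W` is Zariski-closed if it is the common zero locus of a set of
polynomials in linear coordinate functions on `W`. (A polynomial in the symbols `φ ∈ W*` is
evaluated at `w ∈ W` by substituting `φ(w)` for `φ`; for finite-dimensional `W` these are exactly
the polynomial functions on `W`.) -/
def IsZariskiClosed {K W : Type*} [Field K] [AddCommGroup W] [Module K W] (X : Set W) : Prop :=
  ∃ S : Set (MvPolynomial (Dual K W) K),
    X = {w : W | ∀ f ∈ S, MvPolynomial.eval (fun φ : Dual K W => φ w) f = 0}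

/-- The wedge product `⋀ᵃ V × ⋀ᵇ V → ⋀ᵃ⁺ᵇ V`, i.e. multiplication in the exterior algebra. -/
def wedge (K : Type*) {V : Type*} [Field K] [AddCommGroup V] [Module K V] (a b : ℕ) :
    (⋀[K]^a V) →ₗ[K] (⋀[K]^b V) →ₗ[K] (⋀[K]^(a + b) V) :=
  LinearMap.mk₂ K
    (fun ω η => ⟨(ω : ExteriorAlgebra K V) * (η : ExteriorAlgebra K V),
      SetLike.mul_mem_graded (A := fun i : ℕ => ⋀[K]^i V) ω.2 η.2⟩)
    (fun _ _ _ => Subtype.ext (add_mul _ _ _))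
    (fun _ _ _ => Subtype.ext (smul_mul_assoc _ _ _))
    (fun _ _ _ => Subtype.ext (mul_add _ _ _))
    (fun _ _ _ => Subtype.ext (mul_smul_comm _ _ _))

/-- For finite-dimensional `V`, the natural pairing
`⟨x₁ ∧ ⋯ ∧ xₚ, v₁ ∧ ⋯ ∧ vₚ⟩ = det (xᵢ(vⱼ))` is perfect. -/
theorem pairingDual_bijective (K V : Type*) [Field K] [AddCommGroup V] [Module K V]
    [FiniteDimensional K V] (p : ℕ) :
    Function.Bijective (exteriorPower.pairingDual K V p) := by
  classical
  let b := Module.finBasis K V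
  have hb : ⇑b.dualBasis = b.coord := b.coe_dualBasis
  have key : (exteriorPower.pairingDual K V p : (⋀[K]^p (Dual K V)) →ₗ[K] Dual K (⋀[K]^p V)) =
      ((b.dualBasis.exteriorPower p).equiv (b.exteriorPower p).dualBasis
        (Equiv.refl _)).toLinearMap := by
    refine (b.dualBasis.exteriorPower p).ext fun s => ?_
    rw [LinearEquiv.coe_coe, Basis.equiv_apply, Equiv.refl_apply, Basis.coe_dualBasis,
      exteriorPower.basis_coord, exteriorPower.basis_apply, hb]
    rfl
  have h := ((b.dualBasis.exteriorPower p).equiv (b.exteriorPower p).dualBasis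
        (Equiv.refl _)).bijective
  rw [← LinearEquiv.coe_coe, ← key] at h
  exact h

/-- The identification `⋀ᵖ(V*) = (⋀ᵖ V)*`, sending `x₁ ∧ ⋯ ∧ xₚ` to the linear function
`v₁ ∧ ⋯ ∧ vₚ ↦ ∑_π sgn(π) ∏ᵢ xᵢ(v_{π(i)})`. -/
def dualEquiv (K V : Type*) [Field K] [AddCommGroup V] [Module K V]
    [FiniteDimensional K V] (p : ℕ) : (⋀[K]^p (Dual K V)) ≃ₗ[K] Dual K (⋀[K]^p V) :=
  LinearEquiv.ofBijective (exteriorPower.pairingDual K V p) (pairingDual_bijective K V p)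

/-- A linear map `star : ⋀ᵖ V → ⋀ⁿ V*` is a Hodge dual if there is an isomorphism
`ψ : ⋀ᵖ⁺ⁿ V → K` such that `star(ω)(ω') = ψ(ω ∧ ω')`. Used for `dim V = p + n`. -/
def IsHodgeDual {K V : Type*} [Field K] [AddCommGroup V] [Module K V]
    [FiniteDimensional K V] {p n : ℕ} (star : (⋀[K]^p V) →ₗ[K] (⋀[K]^n (Dual K V))) : Prop :=
  ∃ ψ : (⋀[K]^(p + n) V) ≃ₗ[K] K,
    ∀ (ω : ⋀[K]^p V) (ω' : ⋀[K]^n V), dualEquiv K V n (star ω) ω' = ψ (wedge K p n ω ω')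

/-- A Plücker variety over `K`: a closed subvariety `X p V ⊆ ⋀ᵖ V` for all `p` and all
finite-dimensional `V`, preserved by `⋀ᵖ φ` for linear maps `φ` (so that each `X p` is a functor
with `X p φ` the restriction of `⋀ᵖ φ`) and by Hodge duals. -/
structure PluckerVariety (K : Type u) [Field K] where
  X : ∀ (p : ℕ) (V : Type u) [AddCommGroup V] [Module K V] [FiniteDimensional K V],
    Set (⋀[K]^p V)
  isClosed : ∀ (p : ℕ) (V : Type u) [AddCommGroup V] [Module K V] [FiniteDimensional K V],
    IsZariskiClosed (K := K) (X p V)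
  map_mem : ∀ (p : ℕ) (V W : Type u) [AddCommGroup V] [Module K V] [FiniteDimensional K V]
    [AddCommGroup W] [Module K W] [FiniteDimensional K W] (φ : V →ₗ[K] W),
    ∀ ω ∈ X p V, exteriorPower.map p φ ω ∈ X p W
  hodge_mem : ∀ (p n : ℕ) (V : Type u) [AddCommGroup V] [Module K V] [FiniteDimensional K V],
    finrank K V = n + p →
    ∀ star : (⋀[K]^p V) →ₗ[K] (⋀[K]^n (Dual K V)), IsHodgeDual star →
    ∀ ω ∈ X p V, star ω ∈ X n (Dual K V)

/-- A Plücker variety is bounded if `X 2 V ≠ ⋀² V` for some finite-dimensional `V`. -/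
def PluckerVariety.IsBounded {K : Type u} [Field K] (P : PluckerVariety K) : Prop :=
  ∃ (V : Type u) (_ : AddCommGroup V) (_ : Module K V) (_ : FiniteDimensional K V),
    P.X 2 V ≠ Set.univ

/-- The `(n + p)`-dimensional space `V_{n,p}` with basis `x₋ₙ, …, x₋₁, x₁, …, xₚ`.
The index `Sum.inl i` stands for `x_{-(i+1)}` and `Sum.inr j` for `x_{j+1}`. -/
abbrev VSpace (K : Type u) [Field K] (n p : ℕ) : Type u := (Fin n ⊕ Fin p) →₀ K

/-- The embedding `V_{n₀,p₀} → V_{n,p}`, `xᵢ ↦ xᵢ`. -/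
def incl (K : Type u) [Field K] {n₀ n p₀ p : ℕ} (hn : n₀ ≤ n) (hp : p₀ ≤ p) :
    VSpace K n₀ p₀ →ₗ[K] VSpace K n p :=
  Finsupp.lmapDomain K K (Sum.map (Fin.castLE hn) (Fin.castLE hp))

/-- The vertical map `⋀ᵖ V_{n₀,p} → ⋀ᵖ V_{n,p}`, the `p`-th exterior power of the embedding. -/
def vert (K : Type u) [Field K] {n₀ n : ℕ} (hn : n₀ ≤ n) (p : ℕ) :
    (⋀[K]^p (VSpace K n₀ p)) →ₗ[K] (⋀[K]^p (VSpace K n p)) :=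
  exteriorPower.map p (incl K hn le_rfl)

/-- One horizontal step `⋀ᵖ V_{n,p} → ⋀ᵖ⁺¹ V_{n,p+1}`, `ω ↦ ω ∧ x_{p+1}`. -/
def horizStep (K : Type u) [Field K] (n p : ℕ) :
    (⋀[K]^p (VSpace K n p)) →ₗ[K] (⋀[K]^(p + 1) (VSpace K n (p + 1))) :=
  ((wedge K p 1).flip
      (exteriorPower.ιMulti K 1 fun _ => Finsupp.single (Sum.inr (Fin.last p)) 1)).comp
    (exteriorPower.map p (incl K le_rfl (Nat.le_succ p)))

/-- The composite of horizontal steps, `⋀^{p₀} V_{n,p₀} → ⋀ᵖ V_{n,p}`,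
`ω ↦ ω ∧ x_{p₀+1} ∧ ⋯ ∧ xₚ`. -/
def horiz (K : Type u) [Field K] (n : ℕ) {p₀ p : ℕ} (hp : p₀ ≤ p) :
    (⋀[K]^p₀ (VSpace K n p₀)) →ₗ[K] (⋀[K]^p (VSpace K n p)) :=
  Nat.leRec (motive := fun q _ => (⋀[K]^p₀ (VSpace K n p₀)) →ₗ[K] (⋀[K]^q (VSpace K n q)))
    LinearMap.id (fun q _ f => (horizStep K n q).comp f) hp

/-- The projection `π_{n₀,p₀} : ⋀ᵖ V*_{n,p} → ⋀^{p₀} V*_{n₀,p₀}` for `n₀ ≤ n` and `p₀ ≤ p`: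
the dual of the embedding `⋀^{p₀} V_{n₀,p₀} → ⋀ᵖ V_{n,p}` of the directed system defining the
infinite wedge, under the identifications `⋀ᵖ(V*) = (⋀ᵖ V)*`. -/
def proj (K : Type u) [Field K] {n₀ n p₀ p : ℕ} (hn : n₀ ≤ n) (hp : p₀ ≤ p) :
    (⋀[K]^p (Dual K (VSpace K n p))) →ₗ[K] (⋀[K]^p₀ (Dual K (VSpace K n₀ p₀))) :=
  (dualEquiv K (VSpace K n₀ p₀) p₀).symm.toLinearMap ∘ₗ
    ((horiz K n hp).comp (vert K hn p₀)).dualMap ∘ₗ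
    (dualEquiv K (VSpace K n p) p).toLinearMap

/-- The (contragredient) action of `g ∈ G_{n,p} = GL(V_{n,p})` on `⋀ᵖ V*_{n,p}`: the `p`-th
exterior power of `φ ↦ φ ∘ g⁻¹`. -/
def act {K : Type u} [Field K] {n p : ℕ} (g : VSpace K n p ≃ₗ[K] VSpace K n p) :
    (⋀[K]^p (Dual K (VSpace K n p))) →ₗ[K] (⋀[K]^p (Dual K (VSpace K n p))) :=
  exteriorPower.map p g.symm.dualMap.toLinearMap

/-- The instance `X_{n,p} = X p (V*_{n,p}) ⊆ ⋀ᵖ V*_{n,p}` of a Plücker variety. -/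
def PluckerVariety.inst {K : Type u} [Field K] (P : PluckerVariety K) (n p : ℕ) :
    Set (⋀[K]^p (Dual K (VSpace K n p))) :=
  P.X p (Dual K (VSpace K n p))

end

end Plucker

/-! Elements of the p-th exterior power of V* are read as alternating forms with p arguments. A
Plücker variety is stable under pullback of forms along linear maps and under Hodge duality, hence
under contraction with vectors: contracting a form amounts to restricting its Hodge dual and
dualising back (`PluckerVariety.fixLeft_mem_forms`). A projection is a base change, a contraction
and a restriction, so it maps members to members; this gives 2 ⇒ 1.

For 1 ⇒ 2 the point is a uniform N such that every form outside the variety has a contraction to at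
most N arguments whose pullback to K^N is still outside (`HasSmallMinor`,
`PluckerVariety.IsBounded.exists_hasSmallMinor`). A small minor of a pullback or of the Hodge dual
yields one of the form itself, so a form may be replaced by a pullback or a dual at any time, as
long as it stays outside the variety.

Boundedness provides an alternating bilinear form on some K^k outside the variety. An alternating
bilinear form of rank at least 2k pulls back to every such form on K^k (`exists_compLinearMap_eq`).
Hence a form has a small minor as soon as some contraction of it, or of its Hodge dual, to two
arguments has large rank. In the remaining case both ranks are bounded. Let r and s be the largest
ranks that occur; a generic pullback makes chosen minors of sizes r and s, the pivots, nonzero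
(`IsChart`).

On such a chart few coordinates determine all others. Along a line of contractions every minor of
size r + 1 vanishes identically, and inverting the pivot solves for any coordinate with at least two
nonstandard indices in terms of coordinates with fewer of them (`coord_mem_of_pivot`). The same
argument for the Hodge dual treats coordinates missing at least two standard indices. So all
coordinates are polynomials in the inverse pivots and in the coordinates with at most one standard
index missing and at most one nonstandard index present (`coord_mem_of_near`). Those are the entries
of boundedly many matrices, vectors and scalars, and row and column operations on them come from
pullbacks of the form and of its dual (`chartMap`).

It remains to see that Zariski-closed conditions on tuples of matrices, vectors and scalars that are
stable under row and column operations are detected on minors of bounded size. This follows from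
stabilisation of descending chains of such conditions (`matData_chain`), by induction on the number
of matrices. If a nontrivial combination of the matrices has bounded rank, that combination is a
product of thin matrices and one matrix is traded for boundedly many vectors and scalars. Otherwise
a theorem on locally linearly dependent operators (`exists_combination_rank_le`) shows that every
small tuple of matrices occurs as a minor (`exists_minor_eq`), and the condition reduces to one on
the vectors and scalars alone.

Finally, a small minor is converted into one of the prescribed coordinate projections: the number of
contracted vectors is adjusted, the vectors are made independent by Zariski density, and they are
completed to a basis (`HasSmallMinor.exists_linearEquiv`). -/

namespace Plucker

open Module

noncomputable section

/-! ### Polynomial functions and Zariski-closed sets -/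

section PolyFun

variable {K : Type*} [Field K]
variable {W W' W'' : Type*} [AddCommGroup W] [Module K W] [AddCommGroup W'] [Module K W']
  [AddCommGroup W''] [Module K W'']

/-- The algebra of polynomial functions on a vector space. -/
def polyFun (K W : Type*) [Field K] [AddCommGroup W] [Module K W] : Subalgebra K (W → K) :=
  Algebra.adjoin K (Set.range fun (f : Dual K W) => (f : W → K))

theorem linear_mem_polyFun (f : Dual K W) : (f : W → K) ∈ polyFun K W :=
  Algebra.subset_adjoin ⟨f, rfl⟩

/-- A map between vector spaces given by polynomials in linear coordinates. -/
def IsPolyMap (F : W → W') : Prop := ∀ f : Dual K W', (fun w => f (F w)) ∈ polyFun K W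

theorem IsPolyMap.comp_mem {F : W → W'} (hF : IsPolyMap (K := K) F) {f : W' → K}
    (hf : f ∈ polyFun K W') : (fun w => f (F w)) ∈ polyFun K W := by
  induction hf using Algebra.adjoin_induction with
  | mem x hx => obtain ⟨g, rfl⟩ := hx; exact hF g
  | algebraMap r => exact (polyFun K W).algebraMap_mem r
  | add x y _ _ hx hy => exact (polyFun K W).add_mem hx hy
  | mul x y _ _ hx hy => exact (polyFun K W).mul_mem hx hy

theorem isPolyMap_linear (L : W →ₗ[K] W') : IsPolyMap (K := K) L :=
  fun f => linear_mem_polyFun (f ∘ₗ L)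

theorem IsPolyMap.linear_comp {F : W → W'} (hF : IsPolyMap (K := K) F) (L : W' →ₗ[K] W'') :
    IsPolyMap (K := K) (fun w => L (F w)) :=
  fun f => hF (f ∘ₗ L)

theorem isPolyMap_const (x : W') : IsPolyMap (K := K) (fun _ : W => x) :=
  fun f => (polyFun K W).algebraMap_mem (f x)

theorem IsPolyMap.prodMk {F : W → W'} {G : W → W''} (hF : IsPolyMap (K := K) F)
    (hG : IsPolyMap (K := K) G) : IsPolyMap (K := K) (fun w => (F w, G w)) := fun f => by
  have : (fun w => f (F w, G w)) = (fun w => (f ∘ₗ LinearMap.inl K W' W'') (F w)) +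
      (fun w => (f ∘ₗ LinearMap.inr K W' W'') (G w)) := by
    ext w; simp [← map_add]
  rw [this]
  exact (polyFun K W).add_mem (hF _) (hG _)

theorem isPolyMap_pi {ι : Type*} [Finite ι] {E : ι → Type*} [∀ i, AddCommGroup (E i)]
    [∀ i, Module K (E i)] {F : W → ∀ i, E i}
    (hF : ∀ i, IsPolyMap (K := K) fun w => F w i) : IsPolyMap (K := K) F := fun f => by
  classical
  cases nonempty_fintype ι
  have : (fun w => f (F w)) =
      ∑ i, (fun w => (f ∘ₗ LinearMap.single K E i) (F w i)) := by
    ext w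
    simp only [LinearMap.coe_comp, Function.comp_apply, Finset.sum_apply, ← map_sum]
    congr 1
    exact (LinearMap.sum_single_apply E (F w)).symm
  rw [this]
  exact (polyFun K W).sum_mem fun i _ => hF i _

theorem isPolyMap_scalar {f : W → K} (hf : f ∈ polyFun K W) : IsPolyMap (K := K) f := fun g => by
  have : (fun w => g (f w)) = g 1 • f := by
    ext w
    have := g.map_smul (f w) 1
    simp only [smul_eq_mul, mul_one] at this
    simp [this, mul_comm]
  rw [this]
  exact (polyFun K W).smul_mem hf _

theorem det_mem_polyFun {ι : Type*} [Fintype ι] [DecidableEq ι] {M : W → Matrix ι ι K}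
    (hM : ∀ i j, (fun w => M w i j) ∈ polyFun K W) : (fun w => (M w).det) ∈ polyFun K W := by
  have : (fun w => (M w).det) = ∑ σ : Equiv.Perm ι, (Equiv.Perm.sign σ : ℤ) •
      ∏ i, (fun w => M w (σ i) i) := by
    ext w
    simp [Matrix.det_apply, Units.smul_def]
  rw [this]
  exact (polyFun K W).sum_mem fun σ _ => (polyFun K W).zsmul_mem
    ((polyFun K W).prod_mem fun i _ => hM _ _) _

/-- Zariski-closed sets, by the existence of separating polynomial functions. -/
def ZClosed (X : Set W) : Prop :=
  ∀ w, w ∉ X → ∃ f ∈ polyFun K W, (∀ x ∈ X, f x = 0) ∧ f w ≠ 0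

theorem IsZariskiClosed.zClosed {X : Set W} (hX : IsZariskiClosed (K := K) X) :
    ZClosed (K := K) X := by
  obtain ⟨S, rfl⟩ := hX
  intro w hw
  simp only [Set.mem_ofPred_eq, not_forall] at hw
  obtain ⟨f, hf, hw⟩ := hw
  refine ⟨fun w => MvPolynomial.eval (fun φ : Dual K W => φ w) f, ?_, fun x hx => hx f hf, hw⟩
  clear hf hw
  induction f using MvPolynomial.induction_on with
  | C a =>
    simp only [MvPolynomial.eval_C]
    exact (polyFun K W).algebraMap_mem a
  | add p q hp hq =>
    simp only [map_add]
    exact (polyFun K W).add_mem hp hq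
  | mul_X p n hp =>
    simp only [map_mul, MvPolynomial.eval_X]
    exact (polyFun K W).mul_mem hp (linear_mem_polyFun n)

theorem ZClosed.preimage {X : Set W'} (hX : ZClosed (K := K) X) {F : W → W'}
    (hF : IsPolyMap (K := K) F) : ZClosed (K := K) (F ⁻¹' X) := fun w hw => by
  obtain ⟨f, hf, h0, h1⟩ := hX (F w) hw
  exact ⟨_, hF.comp_mem hf, fun x hx => h0 _ hx, h1⟩

theorem ZClosed.forall {ι : Sort*} {X : ι → W → Prop}
    (hX : ∀ i, ZClosed (K := K) {w | X i w}) :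
    ZClosed (K := K) {w | ∀ i, X i w} := fun w hw => by
  simp only [Set.mem_ofPred_eq, not_forall] at hw
  obtain ⟨i, hi⟩ := hw
  obtain ⟨f, hf, h0, h1⟩ := hX i w hi
  exact ⟨f, hf, fun x hx => h0 x (hx i), h1⟩

theorem polyFun_fg [FiniteDimensional K W] : (polyFun K W).FG := by
  let b := Module.finBasis K W
  classical
  refine ⟨Finset.univ.image fun i => ((b.coord i : Dual K W) : W → K), ?_⟩
  refine le_antisymm (Algebra.adjoin_mono ?_) (Algebra.adjoin_le ?_)
  · intro x hx
    obtain ⟨i, _, rfl⟩ := Finset.mem_image.1 (Finset.mem_coe.1 hx)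
    exact ⟨_, rfl⟩
  · rintro _ ⟨f, rfl⟩
    have : (f : W → K) = ∑ i, f (b i) • ((b.coord i : Dual K W) : W → K) := by
      ext w
      conv_lhs => rw [← b.sum_repr w]
      simp only [map_sum, map_smul, smul_eq_mul, Finset.sum_apply, Pi.smul_apply,
        Basis.coord_apply, mul_comm]
    beta_reduce
    rw [this]
    refine sum_mem fun i _ => Subalgebra.smul_mem _ (Algebra.subset_adjoin ?_) _
    exact Finset.mem_coe.2 (Finset.mem_image_of_mem _ (Finset.mem_univ i))

/-- Descending chains of Zariski-closed sets stabilise. -/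
theorem zClosed_chain [FiniteDimensional K W] (X : ℕ → Set W) (hX : ∀ i, ZClosed (K := K) (X i))
    (hanti : Antitone X) : ∃ N, ∀ i, N ≤ i → X i = X N := by
  have : IsNoetherianRing (polyFun K W) := isNoetherianRing_of_fg polyFun_fg
  let I : ℕ →o Ideal (polyFun K W) :=
    { toFun := fun i =>
        { carrier := {f | ∀ x ∈ X i, (f : W → K) x = 0}
          add_mem' := fun {a b} ha hb x hx => by simp [ha x hx, hb x hx]
          zero_mem' := fun x hx => rfl
          smul_mem' := fun c f hf x hx => by simp [hf x hx] }
      monotone' := fun i j hij f hf x hx => hf x (hanti hij hx) }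
  obtain ⟨N, hN⟩ := monotone_stabilizes_iff_noetherian.mpr
    (inferInstance : IsNoetherian (polyFun K W) (polyFun K W)) I
  refine ⟨N, fun i hi => le_antisymm (hanti hi) fun w hw => ?_⟩
  by_contra hwi
  obtain ⟨f, hf, h0, h1⟩ := hX i w hwi
  have : (⟨f, hf⟩ : polyFun K W) ∈ I N := by
    rw [hN i hi]; exact h0
  exact h1 (this w hw)

/-- The Zariski closure. -/
def zClosure (X : Set W) : Set W :=
  {w | ∀ f ∈ polyFun K W, (∀ x ∈ X, f x = 0) → f w = 0}

theorem zClosed_zClosure (X : Set W) : ZClosed (K := K) (zClosure (K := K) X) := fun w hw => by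
  simp only [zClosure, Set.mem_ofPred_eq, not_forall] at hw
  obtain ⟨f, hf, h0, h1⟩ := hw
  exact ⟨f, hf, fun x hx => hx f hf h0, h1⟩

theorem subset_zClosure (X : Set W) : X ⊆ zClosure (K := K) X := fun x hx _ _ h => h x hx

/-- The restriction of a polynomial function to a line is a polynomial. -/
theorem polyFun_line {f : W → K} (hf : f ∈ polyFun K W) (v w : W) :
    ∃ p : Polynomial K, ∀ t : K, f (v + t • w) = p.eval t := by
  induction hf using Algebra.adjoin_induction with
  | mem x hx =>
    obtain ⟨g, rfl⟩ := hx
    exact ⟨Polynomial.C (g v) + Polynomial.C (g w) * Polynomial.X, fun t => by simp; ring⟩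
  | algebraMap r => exact ⟨Polynomial.C r, fun t => by simp⟩
  | add x y _ _ hx hy =>
    obtain ⟨p, hp⟩ := hx
    obtain ⟨q, hq⟩ := hy
    exact ⟨p + q, fun t => by simp [hp, hq]⟩
  | mul x y _ _ hx hy =>
    obtain ⟨p, hp⟩ := hx
    obtain ⟨q, hq⟩ := hy
    exact ⟨p * q, fun t => by simp [hp, hq]⟩

/-- Nonempty open sets intersect: vector spaces over infinite fields are irreducible. -/
theorem polyFun_exists_ne_zero_and [Infinite K] {f g : W → K} (hf : f ∈ polyFun K W)
    (hg : g ∈ polyFun K W) (h1 : ∃ v, f v ≠ 0) (h2 : ∃ w, g w ≠ 0) :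
    ∃ w, f w ≠ 0 ∧ g w ≠ 0 := by
  obtain ⟨v, hv⟩ := h1
  obtain ⟨w, hw⟩ := h2
  obtain ⟨p, hp⟩ := polyFun_line hf v (w - v)
  obtain ⟨q, hq⟩ := polyFun_line hg v (w - v)
  have hp0 : p ≠ 0 := by
    rintro rfl
    exact hv (by simpa using hp 0)
  have hq0 : q ≠ 0 := by
    rintro rfl
    exact hw (by simpa using hq 1)
  by_contra! hcon
  have : p * q = 0 := Polynomial.funext fun t => by
    by_cases h : f (v + t • (w - v)) = 0
    · simp [← hp, h]
    · simp [← hq, hcon _ h]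
  rcases mul_eq_zero.1 this with h | h
  exacts [hp0 h, hq0 h]

theorem polyFun_eq_zero_of_dense [Infinite K] {f g : W → K} (hf : f ∈ polyFun K W)
    (hg : g ∈ polyFun K W) (h2 : ∃ w, g w ≠ 0) (h : ∀ w, g w ≠ 0 → f w = 0) (w : W) :
    f w = 0 := by
  by_contra hw
  obtain ⟨x, hx, hx'⟩ := polyFun_exists_ne_zero_and hf hg ⟨w, hw⟩ h2
  exact hx (h x hx')

end PolyFun

end

end Plucker

namespace Plucker

open Module

noncomputable section

/-! ### Locally linearly dependent operators -/

section LocalDependence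

variable {K : Type*} [Field K] [Infinite K]
variable {V W : Type*} [AddCommGroup V] [Module K V] [AddCommGroup W] [Module K W]

/-- Linear independence is an open condition along lines. -/
theorem exists_linearIndependent_add_smul {ι : Type*} [Finite ι] {p : ι → W}
    (hp : LinearIndependent K p) (q : ι → W) :
    ∃ t : K, t ≠ 0 ∧ LinearIndependent K (fun i => p i + t • q i) := by
  classical
  cases nonempty_fintype ι
  obtain ⟨g, hg⟩ := (Fintype.linearCombination K p).exists_leftInverse_of_injective
    (LinearMap.ker_eq_bot.2 (linearIndependent_iff_injective_fintypeLinearCombination.1 hp))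
  have hgp : ∀ i, g (p i) = Pi.single i 1 := fun i => by
    have := LinearMap.congr_fun hg (Pi.single i 1)
    simpa [Fintype.linearCombination_apply_single] using this
  let M : Matrix ι ι K := Matrix.of fun i j => g (q i) j
  let P : Polynomial K :=
    (1 + (Polynomial.X : Polynomial K) • M.map Polynomial.C : Matrix ι ι (Polynomial K)).det
  have hPe : ∀ t : K, P.eval t = (1 + t • M).det := fun t => by
    rw [← Polynomial.coe_evalRingHom, RingHom.map_det]
    congr 1
    ext i j
    by_cases h : i = j <;> simp [h] <;> ring
  have hP : P ≠ 0 := by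
    intro h
    have := hPe 0
    simp [h] at this
  -- The factor X excludes t = 0; the polynomial P has constant term 1, so the product has only
  -- finitely many roots.
  obtain ⟨t, ht⟩ := (((P * Polynomial.X).roots.toFinset : Set K).toFinite).exists_notMem
  have hr : (P * Polynomial.X).eval t ≠ 0 := by
    intro h
    apply ht
    simp only [Finset.mem_coe, Multiset.mem_toFinset]
    exact (Polynomial.mem_roots (mul_ne_zero hP Polynomial.X_ne_zero)).2 h
  rw [Polynomial.eval_mul, Polynomial.eval_X, hPe] at hr
  refine ⟨t, right_ne_zero_of_mul hr, ?_⟩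
  have hli : LinearIndependent K (1 + t • M : Matrix ι ι K).row :=
    Matrix.linearIndependent_rows_of_det_ne_zero (left_ne_zero_of_mul hr)
  refine LinearIndependent.of_comp g ?_
  have heq : (g ∘ fun i => p i + t • q i) = (1 + t • M : Matrix ι ι K).row := by
    ext i j
    simp [hgp, M, Matrix.row, Matrix.one_apply, Pi.single_apply, eq_comm]
  rw [heq]
  exact hli

/-- Locally linearly dependent operators have a nontrivial combination of small rank. -/
theorem exists_combination_rank_le (k : ℕ) (T : Fin k → V →ₗ[K] W)
    (h : ∀ v, ¬ LinearIndependent K (fun i => T i v)) :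
    ∃ μ : Fin k → K, μ ≠ 0 ∧ ∃ S : Submodule K W, FiniteDimensional K S ∧ finrank K S ≤ k ∧
      ∀ v, (∑ i, μ i • T i) v ∈ S := by
  induction k with
  | zero => exact absurd linearIndependent_empty_type (h 0)
  | succ k ih =>
    by_cases h' : ∀ v, ¬ LinearIndependent K (fun i : Fin k => T i.castSucc v)
    · obtain ⟨μ, hμ, S, hS, hd, hm⟩ := ih _ h'
      refine ⟨Fin.snoc μ 0, fun h0 => hμ ?_, S, hS, by omega, fun v => ?_⟩
      · ext i
        have := congr_fun h0 i.castSucc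
        simpa using this
      · simpa [Fin.sum_univ_castSucc] using hm v
    · push Not at h'
      obtain ⟨v, hv⟩ := h'
      have hlast : T (Fin.last k) v ∈ Submodule.span K (Set.range fun i : Fin k => T i.castSucc v) := by
        by_contra hn
        apply h v
        have := linearIndependent_finSnoc.2 ⟨hv, hn⟩
        convert this using 1
        ext i
        refine Fin.lastCases ?_ (fun i => ?_) i <;> simp
      obtain ⟨c, hc⟩ := (Submodule.mem_span_range_iff_exists_fun K).1 hlast
      refine ⟨Fin.snoc (fun i => - c i) 1, fun h0 => ?_,
        Submodule.span K (Set.range fun i : Fin k => T i.castSucc v),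
        FiniteDimensional.span_of_finite K (Set.finite_range _),
        (finrank_range_le_card _).trans (by simp), fun x => ?_⟩
      · simpa using congr_fun h0 (Fin.last k)
      · by_contra hn
        -- T' is the last operator minus the combination of the others that agrees with it at v, so
        -- T' v = 0. The claim is that T' takes values in the span of the vectors `T i v` with i <
        -- k.
        set T' : V →ₗ[K] W := ∑ i, (Fin.snoc (fun i => - c i) 1 : Fin (k+1) → K) i • T i with hT'
        have hT'e : ∀ y, T' y = T (Fin.last k) y - ∑ i : Fin k, c i • T i.castSucc y := fun y => by
          simp only [hT', Fin.sum_univ_castSucc, Fin.snoc_castSucc, neg_smul, Fin.snoc_last,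
            one_smul, LinearMap.add_apply, LinearMap.sum_apply, LinearMap.neg_apply,
            LinearMap.smul_apply, Finset.sum_neg_distrib]
          abel
        have hT'v : T' v = 0 := by rw [hT'e, hc, sub_self]
        have hli := linearIndependent_finSnoc.2 ⟨hv, hn⟩
        -- If T' x were outside that span, independence would survive the move from v to v + t x.
        -- Since T' (v + t x) = t T' x, all k + 1 operators would then be independent at v + t x.
        obtain ⟨t, ht, hlt⟩ := exists_linearIndependent_add_smul hli
          (Fin.snoc (fun i : Fin k => T i.castSucc x) 0)
        have hlt' : LinearIndependent K (Fin.snoc (α := fun _ => W)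
            (fun i : Fin k => T i.castSucc (v + t • x)) (T' x)) := by
          convert hlt using 1
          ext i
          refine Fin.lastCases ?_ (fun i => ?_) i <;> simp
        rw [linearIndependent_finSnoc] at hlt'
        apply h (v + t • x)
        have : (fun i => T i (v + t • x)) = Fin.snoc (α := fun _ => W)
            (fun i : Fin k => T i.castSucc (v + t • x)) (T (Fin.last k) (v + t • x)) := by
          ext i
          refine Fin.lastCases ?_ (fun i => ?_) i <;> simp
        rw [this, linearIndependent_finSnoc]
        refine ⟨hlt'.1, fun hmem => hlt'.2 ?_⟩
        have h1 : T' (v + t • x) ∈ Submodule.span K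
            (Set.range fun i : Fin k => T i.castSucc (v + t • x)) := by
          rw [hT'e]
          exact Submodule.sub_mem _ hmem (Submodule.sum_mem _ fun i _ =>
            Submodule.smul_mem _ _ (Submodule.subset_span ⟨i, rfl⟩))
        rw [map_add, hT'v, zero_add, map_smul] at h1
        exact (Submodule.smul_mem_iff _ ht).1 h1

end LocalDependence

end

end Plucker

namespace Plucker

open Module

noncomputable section

/-! ### Tuples of matrices: either all minors occur, or some combination has small rank -/

section MatrixTuples

variable {K : Type*} [Field K]

theorem finrank_range_le_add_ker {V W W' : Type*} [AddCommGroup V] [Module K V] [AddCommGroup W]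
    [Module K W] [AddCommGroup W'] [Module K W'] [FiniteDimensional K V] [FiniteDimensional K W]
    [FiniteDimensional K W'] (m : V →ₗ[K] W) (q : W →ₗ[K] W') :
    finrank K (LinearMap.range m) ≤
      finrank K (LinearMap.range (q ∘ₗ m)) + finrank K (LinearMap.ker q) := by
  have h1 := m.finrank_range_add_finrank_ker
  have h2 := (q ∘ₗ m).finrank_range_add_finrank_ker
  have h3 := (m.domRestrict (LinearMap.ker (q ∘ₗ m))).finrank_range_add_finrank_ker
  have h4 : finrank K (LinearMap.range (m.domRestrict (LinearMap.ker (q ∘ₗ m)))) ≤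
      finrank K (LinearMap.ker q) := by
    apply Submodule.finrank_mono
    rintro _ ⟨⟨x, hx⟩, rfl⟩
    exact hx
  have h5 : finrank K (LinearMap.ker (m.domRestrict (LinearMap.ker (q ∘ₗ m)))) ≤
      finrank K (LinearMap.ker m) := by
    refine LinearMap.finrank_le_finrank_of_injective (f := LinearMap.codRestrict (LinearMap.ker m)
      ((LinearMap.ker (q ∘ₗ m)).subtype ∘ₗ (Submodule.subtype _)) ?_) ?_
    · rintro ⟨x, hx⟩
      exact hx
    · rintro ⟨⟨x, hx⟩, hx'⟩ ⟨⟨y, hy⟩, hy'⟩ h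
      simpa using congr_arg Subtype.val h
  omega

theorem finrank_range_le_restrict {V W W' : Type*} [AddCommGroup V] [Module K V] [AddCommGroup W]
    [Module K W] [AddCommGroup W'] [Module K W'] [FiniteDimensional K V] [FiniteDimensional K W]
    [FiniteDimensional K W'] (m : V →ₗ[K] W) (u : V →ₗ[K] W') :
    finrank K (LinearMap.range m) ≤
      finrank K (LinearMap.range (m.domRestrict (LinearMap.ker u))) + finrank K W' := by
  have h1 := m.finrank_range_add_finrank_ker
  have h2 := u.finrank_range_add_finrank_ker
  have h3 := (m.domRestrict (LinearMap.ker u)).finrank_range_add_finrank_ker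
  have h4 : finrank K (LinearMap.range u) ≤ finrank K W' := Submodule.finrank_le _
  have h5 : finrank K (LinearMap.ker (m.domRestrict (LinearMap.ker u))) ≤
      finrank K (LinearMap.ker m) := by
    refine LinearMap.finrank_le_finrank_of_injective (f := LinearMap.codRestrict (LinearMap.ker m)
      ((LinearMap.ker u).subtype ∘ₗ (Submodule.subtype _)) ?_) ?_
    · rintro ⟨x, hx⟩
      exact hx
    · rintro ⟨⟨x, hx⟩, hx'⟩ ⟨⟨y, hy⟩, hy'⟩ h
      simpa using congr_arg Subtype.val h
  omega

/-- The rows of φ' are chosen one at a time. A new row may change only by vectors killed by u, and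
its images under all `M l` must be independent modulo Sw and the images already obtained. Failure
for every choice would make the restricted operators locally dependent, hence some combination of
the `M l` of rank at most ρ. -/
theorem exists_rows_linearIndependent [Infinite K] {a b k : ℕ} {σ : Type*} [Fintype σ]
    (Sw : Submodule K (Fin b → K)) (s ρ : ℕ) (hs : finrank K Sw ≤ s)
    (M : Fin k → Matrix (Fin a) (Fin b) K) (u : Matrix (Fin a) σ K) (a' : ℕ)
    (hρ : k + a' * k + s + Fintype.card σ ≤ ρ)
    (hM : ∀ μ : Fin k → K, μ ≠ 0 →
      ρ < finrank K (LinearMap.range (Matrix.vecMulLinear (∑ l, μ l • M l))))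
    (φ : Matrix (Fin a') (Fin a) K) :
    ∃ φ' : Matrix (Fin a') (Fin a) K, φ' * u = φ * u ∧
      LinearIndependent K (fun p : Fin a' × Fin k => Sw.mkQ ((φ' * M p.2) p.1)) := by
  induction a' with
  | zero => exact ⟨φ, rfl, linearIndependent_empty_type⟩
  | succ j ih =>
    obtain ⟨f, hfu, hf⟩ := ih (by nlinarith) (Matrix.of fun i => φ i.castSucc)
    set S := Submodule.span K (Set.range fun p : Fin j × Fin k => Sw.mkQ ((f * M p.2) p.1)) with hS
    have hSd : finrank K S ≤ j * k := (finrank_range_le_card _).trans (by simp)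
    let q : (Fin b → K) →ₗ[K] _ := S.mkQ ∘ₗ Sw.mkQ
    have hqs : Function.Surjective q :=
      (Submodule.mkQ_surjective S).comp (Submodule.mkQ_surjective Sw)
    have hker : finrank K (LinearMap.ker q) ≤ s + j * k := by
      have h1 := q.finrank_range_add_finrank_ker
      rw [LinearMap.range_eq_top.2 hqs, finrank_top] at h1
      have h2 := Submodule.finrank_quotient_add_finrank S
      have h3 := Submodule.finrank_quotient_add_finrank Sw
      omega
    let T : Fin k → LinearMap.ker (Matrix.vecMulLinear u) →ₗ[K] _ := fun l =>
      (q ∘ₗ Matrix.vecMulLinear (M l)).domRestrict (LinearMap.ker (Matrix.vecMulLinear u))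
    have hex : ∃ v, LinearIndependent K (fun l => T l v) := by
      by_contra hcon
      push Not at hcon
      obtain ⟨μ, hμ, S', hS'f, hS'd, hS'⟩ := exists_combination_rank_le k T hcon
      -- Rank count: at most k on the kernel of u after the quotient, plus the number of columns of
      -- u for leaving that kernel, plus s + j k for undoing the quotient.
      have h1 := hM μ hμ
      have h2 := finrank_range_le_add_ker (Matrix.vecMulLinear (∑ l, μ l • M l)) q
      have h3 := finrank_range_le_restrict (q ∘ₗ Matrix.vecMulLinear (∑ l, μ l • M l))
        (Matrix.vecMulLinear u)
      have h4 : finrank K (LinearMap.range ((q ∘ₗ Matrix.vecMulLinear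
          (∑ l, μ l • M l)).domRestrict (LinearMap.ker (Matrix.vecMulLinear u)))) ≤ k := by
        refine le_trans (Submodule.finrank_mono ?_) hS'd
        rintro _ ⟨v, rfl⟩
        convert hS' v using 1
        simp [T, map_sum]
      rw [Module.finrank_fintype_fun_eq_card] at h3
      nlinarith
    obtain ⟨v, hv⟩ := hex
    -- The vector v gives independence but the row must have the form φ_j + (element of the kernel
    -- of u). Perturbing v by t φ_j and dividing by t produces such a row.
    obtain ⟨t, ht, hlt⟩ := exists_linearIndependent_add_smul hv
      (fun l => q ((Matrix.vecMulLinear (M l)) (φ (Fin.last j))))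
    let g : Fin a → K := φ (Fin.last j) + t⁻¹ • (v : Fin a → K)
    have hg : LinearIndependent K (fun l => q (Matrix.vecMul g (M l))) := by
      have := hlt.units_smul (fun _ => Units.mk0 t⁻¹ (inv_ne_zero ht))
      have heq : (fun l => q (Matrix.vecMul g (M l))) =
          (fun _ : Fin k => Units.mk0 t⁻¹ (inv_ne_zero ht)) • fun l =>
            T l v + t • q (Matrix.vecMulLinear (M l) (φ (Fin.last j))) := by
        ext l
        have : Matrix.vecMul g (M l) = Matrix.vecMul (φ (Fin.last j)) (M l) +
            t⁻¹ • Matrix.vecMul (v : Fin a → K) (M l) := by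
          simp [g, Matrix.add_vecMul, Matrix.smul_vecMul]
        simp only [this, map_add, map_smul, T]
        simp [smul_smul, ht, add_comm, Units.smul_def]
      rw [heq]
      exact this
    let φ' : Matrix (Fin (j + 1)) (Fin a) K := Matrix.of (Fin.snoc (α := fun _ => Fin a → K) f g)
    have hlast : φ' (Fin.last j) = g := Fin.snoc_last (α := fun _ => Fin a → K) g f
    have hcast : ∀ i : Fin j, φ' i.castSucc = f i :=
      fun i => Fin.snoc_castSucc (α := fun _ => Fin a → K) g f i
    refine ⟨φ', ?_, ?_⟩
    · ext i c
      refine Fin.lastCases ?_ (fun i => ?_) i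
      · have hv0 : Matrix.vecMul (v : Fin a → K) u = 0 := v.2
        have : Matrix.vecMul g u = Matrix.vecMul (φ (Fin.last j)) u := by
          simp [g, Matrix.add_vecMul, Matrix.smul_vecMul, hv0]
        simpa [Matrix.mul_apply, Matrix.vecMul, dotProduct, hlast] using congr_fun this c
      · have := congr_fun (congr_fun hfu i) c
        simpa [Matrix.mul_apply, hcast] using this
    · have hsum := LinearIndependent.sumElim_of_quotient
        (LinearIndependent.of_comp S.subtype (v := fun p : Fin j × Fin k =>
          (⟨Sw.mkQ ((f * M p.2) p.1), Submodule.subset_span ⟨p, rfl⟩⟩ : S)) hf)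
        (fun l => Sw.mkQ (Matrix.vecMul g (M l))) hg
      let e : Fin (j+1) × Fin k → (Fin j × Fin k) ⊕ Fin k := fun p =>
        Fin.lastCases (motive := fun _ => (Fin j × Fin k) ⊕ Fin k) (Sum.inr p.2)
          (fun i => Sum.inl (i, p.2)) p.1
      have he : Function.Injective e := by
        rintro ⟨i, l⟩ ⟨i', l'⟩ h
        revert h
        refine Fin.lastCases ?_ (fun i => ?_) i <;> refine Fin.lastCases ?_ (fun i' => ?_) i' <;>
          simp [e]
      have heq : (fun p : Fin (j + 1) × Fin k => Sw.mkQ ((φ' * M p.2) p.1)) =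
          Sum.elim (fun p : Fin j × Fin k => Sw.mkQ ((f * M p.2) p.1))
            (fun l => Sw.mkQ (Matrix.vecMul g (M l))) ∘ e := by
        ext ⟨i, l⟩
        refine Fin.lastCases ?_ (fun i => ?_) i
        · simp only [Function.comp_apply, e, Fin.lastCases_last, Sum.elim_inr]
          congr 1
          ext c
          simp [Matrix.mul_apply, Matrix.vecMul, dotProduct, hlast]
        · simp only [Function.comp_apply, e, Fin.lastCases_castSucc, Sum.elim_inl]
          congr 1
          ext c
          simp [Matrix.mul_apply, hcast]
      rw [heq]
      exact hsum.comp e he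

/-- If no nontrivial combination of the `M l` has small rank, then every tuple of matrices of the
given size is a minor of `M`, with prescribed effect on finitely many vectors. -/
theorem exists_minor_eq [Infinite K] {a b k a' b' : ℕ} {σ τ : Type*} [Fintype σ] [Fintype τ]
    (M : Fin k → Matrix (Fin a) (Fin b) K) (u : Matrix (Fin a) σ K) (w : Matrix τ (Fin b) K)
    (ρ : ℕ) (hρ : k + a' * k + Fintype.card τ + Fintype.card σ ≤ ρ)
    (hM : ∀ μ : Fin k → K, μ ≠ 0 →
      ρ < finrank K (LinearMap.range (Matrix.vecMulLinear (∑ l, μ l • M l))))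
    (φ : Matrix (Fin a') (Fin a) K) (ψ : Matrix (Fin b) (Fin b') K)
    (M' : Fin k → Matrix (Fin a') (Fin b') K) :
    ∃ (φ' : Matrix (Fin a') (Fin a) K) (ψ' : Matrix (Fin b) (Fin b') K),
      φ' * u = φ * u ∧ w * ψ' = w * ψ ∧ ∀ l, φ' * M l * ψ' = M' l := by
  classical
  set Sw := Submodule.span K (Set.range w.row) with hSw
  obtain ⟨φ', hu, hli⟩ := exists_rows_linearIndependent Sw (Fintype.card τ) ρ
    (finrank_range_le_card _) M u a' hρ hM φ
  obtain ⟨G, hG⟩ := (Fintype.linearCombination K fun p : Fin a' × Fin k =>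
    Sw.mkQ ((φ' * M p.2) p.1)).exists_leftInverse_of_injective
    (LinearMap.ker_eq_bot.2 (linearIndependent_iff_injective_fintypeLinearCombination.1 hli))
  have hGp : ∀ p : Fin a' × Fin k, G (Sw.mkQ ((φ' * M p.2) p.1)) = Pi.single p 1 := fun i => by
    have := LinearMap.congr_fun hG (Pi.single i 1)
    simpa [Fintype.linearCombination_apply_single] using this
  -- The defect to be corrected. The rows of all φ' * M l are independent modulo Sw, so G supplies
  -- dual functionals vanishing on Sw; adding them to the columns of ψ with coefficients c fixes
  -- every entry without affecting w * ψ.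
  let c : Fin b' → Fin a' × Fin k → K := fun j p => M' p.2 p.1 j - (φ' * M p.2 * ψ) p.1 j
  let x : Matrix (Fin b) (Fin b') K := Matrix.of fun i j =>
    ∑ p, c j p * G (Sw.mkQ (Pi.single i 1)) p
  have hx : ∀ (v : Fin b → K) j, ∑ i, v i * x i j = ∑ p, c j p * G (Sw.mkQ v) p := fun v j => by
    have hv : v = ∑ i, v i • (Pi.single i 1 : Fin b → K) := by
      ext l
      simp [Finset.sum_apply, Pi.single_apply]
    conv_rhs => rw [hv]
    simp only [map_sum, map_smul, Finset.sum_apply, Pi.smul_apply, smul_eq_mul, Finset.mul_sum,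
      x, Matrix.of_apply]
    rw [Finset.sum_comm]
    refine Finset.sum_congr rfl fun p _ => Finset.sum_congr rfl fun i _ => ?_
    ring
  refine ⟨φ', ψ + x, hu, ?_, fun l => ?_⟩
  · rw [Matrix.mul_add, add_eq_left]
    ext t j
    rw [Matrix.mul_apply, hx (w t) j, Matrix.zero_apply]
    have : Sw.mkQ (w t) = 0 := (Submodule.Quotient.mk_eq_zero _).2 (Submodule.subset_span ⟨t, rfl⟩)
    simp [this]
  · ext i j
    rw [Matrix.mul_add, Matrix.add_apply, Matrix.mul_apply (N := x), hx ((φ' * M l) i) j,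
      hGp (i, l)]
    simp [Pi.single_apply, c]

theorem exists_factorization_of_finrank_range_le {a b ρ : ℕ} (A : Matrix (Fin a) (Fin b) K)
    (h : finrank K (LinearMap.range (Matrix.vecMulLinear A)) ≤ ρ) :
    ∃ (x : Matrix (Fin a) (Fin ρ) K) (y : Matrix (Fin ρ) (Fin b) K), A = x * y := by
  classical
  set R := LinearMap.range (Matrix.vecMulLinear A)
  let B := Module.finBasis K R
  let x' : Matrix (Fin a) (Fin (finrank K R)) K := Matrix.of fun i j =>
    B.repr ⟨A i, ⟨Pi.single i 1, by simp [Matrix.vecMulLinear]; rfl⟩⟩ j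
  let y' : Matrix (Fin (finrank K R)) (Fin b) K := Matrix.of fun j l => (B j : Fin b → K) l
  have hxy : A = x' * y' := by
    ext i l
    have := congr_arg (fun r : R => (r : Fin b → K) l)
      (B.sum_repr ⟨A i, ⟨Pi.single i 1, by simp [Matrix.vecMulLinear]; rfl⟩⟩)
    simp only [AddSubmonoidClass.coe_finsetSum, Finset.sum_apply] at this
    rw [Matrix.mul_apply, ← this]
    rfl
  -- Padding by zeros, so that the inner dimension is ρ exactly and does not depend on A.
  let E : Matrix (Fin (finrank K R)) (Fin ρ) K := Matrix.of fun i j => if (i : ℕ) = j then 1 else 0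
  have hE : E * E.transpose = 1 := by
    ext i j
    simp only [Matrix.mul_apply, E, Matrix.of_apply, Matrix.transpose_apply, Matrix.one_apply]
    rw [Finset.sum_eq_single (Fin.castLE h i)]
    · simp [Fin.ext_iff, eq_comm]
    · intro m _ hm
      rw [if_neg, zero_mul]
      intro h'
      exact hm (Fin.ext (by simp [← h']))
    · simp
  exact ⟨x' * E, E.transpose * y', by rw [Matrix.mul_assoc, ← Matrix.mul_assoc E, hE,
    Matrix.one_mul, hxy]⟩

end MatrixTuples

end

end Plucker

namespace Plucker

open Module

noncomputable section

/-! ### Noetherianity of tuples of matrices and vectors -/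

section MatData

variable {K : Type*} [Field K]

theorem isLinearMap_mem_polyFun {W : Type*} [AddCommGroup W] [Module K W] {f : W → K}
    (h : IsLinearMap K f) : f ∈ polyFun K W :=
  linear_mem_polyFun (IsLinearMap.mk' f h)

theorem isPolyMap_matrix {W m n : Type*} [AddCommGroup W] [Module K W] [Finite m] [Finite n]
    {F : W → Matrix m n K} (h : ∀ i j, (fun w => F w i j) ∈ polyFun K W) :
    IsPolyMap (K := K) F :=
  isPolyMap_pi (E := fun _ : m => n → K) fun i =>
    isPolyMap_pi (E := fun _ : n => K) fun j => isPolyMap_scalar (h i j)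

/-- A tuple of `a × b` matrices, together with vectors of length `a`, vectors of length `b`, and
scalars. -/
abbrev MatData (K : Type*) (k : ℕ) (σ τ γ : Type) (a b : ℕ) :=
  (Fin k → Matrix (Fin a) (Fin b) K) × Matrix (Fin a) σ K × Matrix τ (Fin b) K × (γ → K)

variable {k : ℕ} {σ τ γ : Type} {a b a' b' a'' b'' : ℕ}

/-- The simultaneous action by row and column operations. -/
def MatData.minor (φ : Matrix (Fin a') (Fin a) K) (ψ : Matrix (Fin b) (Fin b') K)
    (d : MatData K k σ τ γ a b) : MatData K k σ τ γ a' b' :=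
  (fun l => φ * d.1 l * ψ, φ * d.2.1, d.2.2.1 * ψ, d.2.2.2)

theorem MatData.minor_minor (φ : Matrix (Fin a'') (Fin a') K) (ψ : Matrix (Fin b') (Fin b'') K)
    (φ' : Matrix (Fin a') (Fin a) K) (ψ' : Matrix (Fin b) (Fin b') K)
    (d : MatData K k σ τ γ a b) :
    (d.minor φ' ψ').minor φ ψ = d.minor (φ * φ') (ψ' * ψ) := by
  simp [MatData.minor, Matrix.mul_assoc]

theorem MatData.isPolyMap_minor [Finite σ] [Finite τ] [Finite γ]
    (φ : Matrix (Fin a') (Fin a) K) (ψ : Matrix (Fin b) (Fin b') K) :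
    IsPolyMap (K := K) (MatData.minor φ ψ : MatData K k σ τ γ a b → MatData K k σ τ γ a' b') := by
  refine isPolyMap_linear (IsLinearMap.mk' (MatData.minor φ ψ) ⟨fun x y => ?_, fun c x => ?_⟩)
  · refine Prod.ext (funext fun l => ?_) (Prod.ext ?_ (Prod.ext ?_ rfl)) <;>
      simp [MatData.minor, Matrix.mul_add, Matrix.add_mul]
  · refine Prod.ext (funext fun l => ?_) (Prod.ext ?_ (Prod.ext ?_ rfl)) <;>
      simp [MatData.minor]

/-- A family of Zariski-closed sets that is stable under row and column operations. -/
structure IsClosedFamily (Z : ∀ a b, Set (MatData K k σ τ γ a b)) : Prop where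
  closed : ∀ a b, ZClosed (K := K) (Z a b)
  minor_mem : ∀ {a b a' b'} (φ : Matrix (Fin a') (Fin a) K) (ψ : Matrix (Fin b) (Fin b') K),
    ∀ d ∈ Z a b, MatData.minor φ ψ d ∈ Z a' b'

theorem exists_generalizedInverse {m n : Type*} [Fintype m] [Fintype n] [DecidableEq m]
    [DecidableEq n] (A : Matrix m n K) : ∃ G : Matrix n m K, A * (G * A) = A := by
  obtain ⟨g, hg⟩ := (Matrix.toLin' A).rangeRestrict.exists_rightInverse_of_surjective
    (LinearMap.range_rangeRestrict _)
  obtain ⟨p, hp⟩ := (LinearMap.range (Matrix.toLin' A)).subtype.exists_leftInverse_of_injective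
    (Submodule.ker_subtype _)
  refine ⟨LinearMap.toMatrix' (g ∘ₗ p), ?_⟩
  apply Matrix.toLin'.injective
  rw [Matrix.toLin'_mul, Matrix.toLin'_mul, Matrix.toLin'_toMatrix']
  ext1 i
  ext1
  simp only [LinearMap.comp_apply]
  set v : n → K := LinearMap.single K (fun _ => K) i 1
  have h1 : p (Matrix.toLin' A v) = (Matrix.toLin' A).rangeRestrict v :=
    LinearMap.congr_fun hp ((Matrix.toLin' A).rangeRestrict v)
  rw [h1]
  exact congr_arg Subtype.val (LinearMap.congr_fun hg ((Matrix.toLin' A).rangeRestrict v))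

/-- Without matrices only boundedly many vectors remain, and a generalized inverse recovers the
datum from a minor whose size is the number of vectors: u = u (g u), with u itself as the row
operation. The chain is thus controlled by one finite-dimensional space. -/
theorem matData_zero_chain [Fintype σ] [Fintype τ] [Finite γ]
    (Z : ℕ → ∀ a b, Set (MatData K 0 σ τ γ a b)) (hZ : ∀ i, IsClosedFamily (Z i))
    (hanti : ∀ i j, i ≤ j → ∀ a b, Z j a b ⊆ Z i a b) :
    ∃ N, ∀ i, N ≤ i → ∀ a b, Z i a b = Z N a b := by
  classical
  cases nonempty_fintype γ
  set s := Fintype.card σ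
  set t := Fintype.card τ
  obtain ⟨N, hN⟩ := zClosed_chain (fun i => Z i s t) (fun i => (hZ i).closed s t)
    (fun i j hij => hanti i j hij s t)
  refine ⟨N, fun i hi a b => (hanti N i hi a b).antisymm fun d hd => ?_⟩
  let e := Fintype.equivFin σ
  let f := Fintype.equivFin τ
  obtain ⟨g, hg⟩ := exists_generalizedInverse (d.2.1.submatrix id e.symm)
  obtain ⟨h, hh⟩ := exists_generalizedInverse (d.2.2.1.submatrix f.symm id).transpose
  have hd' : d = ((d.minor g h.transpose).minor (d.2.1.submatrix id e.symm)
      (d.2.2.1.submatrix f.symm id)) := by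
    rw [MatData.minor_minor]
    refine Prod.ext (Subsingleton.elim _ _) (Prod.ext ?_ (Prod.ext ?_ rfl))
    · ext x y
      have := congr_fun (congr_fun hg x) (e y)
      simp only [Matrix.submatrix_apply, id, Equiv.symm_apply_apply] at this
      rw [← this]
      simp only [MatData.minor, ← Matrix.mul_assoc]
      rw [Matrix.mul_apply, Matrix.mul_apply]
      simp
    · ext x y
      have := congr_fun (congr_fun hh y) (f x)
      simp only [Matrix.transpose_apply, Matrix.submatrix_apply, id, Equiv.symm_apply_apply]
        at this
      rw [← this, ← Matrix.transpose_apply (M := _ * _), Matrix.transpose_mul, Matrix.transpose_mul]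
      simp only [MatData.minor, Matrix.transpose_transpose, ← Matrix.mul_assoc]
      rw [Matrix.mul_apply, Matrix.mul_apply]
      refine Finset.sum_congr rfl fun m _ => ?_
      congr 1
      rw [Matrix.mul_apply, Matrix.mul_apply]
      simp
  have h1 := (hZ N).minor_mem g h.transpose d hd
  rw [hd']
  exact (hZ i).minor_mem _ _ _ ((hN i hi).symm ▸ h1)

/-- The vectors all of whose completions by arbitrary matrices of allowed sizes lie in `Z`. -/
def coreFamily (S : ℕ → Prop) (Z : ∀ a b, Set (MatData K k σ τ γ a b)) (a b : ℕ) :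
    Set (MatData K 0 σ τ γ a b) :=
  {d | ∀ a' b', S a' → S b' → ∀ (φ : Matrix (Fin a') (Fin a) K) (ψ : Matrix (Fin b) (Fin b') K)
    (M' : Fin k → Matrix (Fin a') (Fin b') K), (M', (d.minor φ ψ).2) ∈ Z a' b'}

theorem IsClosedFamily.coreFamily [Finite σ] [Finite τ] [Finite γ] (S : ℕ → Prop)
    {Z : ∀ a b, Set (MatData K k σ τ γ a b)} (hZ : IsClosedFamily Z) :
    IsClosedFamily (coreFamily S Z) where
  closed a b := by
    refine ZClosed.forall fun a' => ZClosed.forall fun b' => ZClosed.forall fun _ =>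
      ZClosed.forall fun _ => ZClosed.forall fun φ => ZClosed.forall fun ψ =>
      ZClosed.forall fun M' => ?_
    exact (hZ.closed a' b').preimage ((isPolyMap_const M').prodMk
      ((MatData.isPolyMap_minor φ ψ).linear_comp (LinearMap.snd K _ _)))
  minor_mem φ ψ d hd a' b' ha hb φ' ψ' M' := by
    rw [MatData.minor_minor]
    exact hd a' b' ha hb _ _ M'

/-- Reconstruct `k + 1` matrices, one combination of which is a product of thin matrices. -/
def MatData.expand {ρ : ℕ} (l : Fin (k + 1))
    (d : MatData K k (σ ⊕ Fin ρ) (τ ⊕ Fin ρ) (γ ⊕ Fin (k + 1)) a b) :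
    MatData K (k + 1) σ τ γ a b :=
  (Fin.insertNth (α := fun _ => Matrix (Fin a) (Fin b) K) l
    (d.2.1.submatrix id Sum.inr * d.2.2.1.submatrix Sum.inr id -
      ∑ j, d.2.2.2 (Sum.inr (l.succAbove j)) • d.1 j) d.1,
    d.2.1.submatrix id Sum.inl, d.2.2.1.submatrix Sum.inl id, fun i => d.2.2.2 (Sum.inl i))

theorem MatData.minor_expand {ρ : ℕ} (l : Fin (k + 1))
    (d : MatData K k (σ ⊕ Fin ρ) (τ ⊕ Fin ρ) (γ ⊕ Fin (k + 1)) a b)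
    (φ : Matrix (Fin a') (Fin a) K) (ψ : Matrix (Fin b) (Fin b') K) :
    (d.expand l).minor φ ψ = (d.minor φ ψ).expand l := by
  refine Prod.ext (funext fun j => ?_) (Prod.ext ?_ (Prod.ext ?_ rfl))
  · refine Fin.succAboveCases l ?_ (fun j => ?_) j
    · simp only [MatData.minor, MatData.expand, Fin.insertNth_apply_same, Matrix.mul_sub,
        Matrix.sub_mul, Matrix.mul_sum, Matrix.sum_mul, Matrix.mul_smul, Matrix.smul_mul]
      congr 1
      have h1 : (φ * d.2.1).submatrix id (Sum.inr : Fin ρ → σ ⊕ Fin ρ) =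
        φ * d.2.1.submatrix id Sum.inr := rfl
      have h2 : (d.2.2.1 * ψ).submatrix (Sum.inr : Fin ρ → τ ⊕ Fin ρ) id =
        d.2.2.1.submatrix Sum.inr id * ψ := rfl
      rw [h1, h2]
      simp only [Matrix.mul_assoc]
    · simp [MatData.minor, MatData.expand]
  · rfl
  · rfl

theorem MatData.isPolyMap_expand [Finite σ] [Finite τ] [Finite γ] {ρ : ℕ} (l : Fin (k + 1)) :
    IsPolyMap (K := K) (MatData.expand l :
      MatData K k (σ ⊕ Fin ρ) (τ ⊕ Fin ρ) (γ ⊕ Fin (k + 1)) a b → MatData K (k + 1) σ τ γ a b) := by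
  have lin : ∀ {f : MatData K k (σ ⊕ Fin ρ) (τ ⊕ Fin ρ) (γ ⊕ Fin (k + 1)) a b → K},
    IsLinearMap K f → f ∈ polyFun K _ := isLinearMap_mem_polyFun
  refine IsPolyMap.prodMk (isPolyMap_pi fun j => isPolyMap_matrix fun x y => ?_)
    (IsPolyMap.prodMk (isPolyMap_matrix fun x y => lin ⟨fun _ _ => rfl, fun _ _ => rfl⟩)
      (IsPolyMap.prodMk (isPolyMap_matrix fun x y => lin ⟨fun _ _ => rfl, fun _ _ => rfl⟩)
        (isPolyMap_pi fun i => isPolyMap_scalar (lin ⟨fun _ _ => rfl, fun _ _ => rfl⟩))))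
  refine Fin.succAboveCases l ?_ (fun j => ?_) j
  · simp only [Fin.insertNth_apply_same]
    have : (fun d : MatData K k (σ ⊕ Fin ρ) (τ ⊕ Fin ρ) (γ ⊕ Fin (k + 1)) a b =>
        (d.2.1.submatrix id Sum.inr * d.2.2.1.submatrix Sum.inr id -
          ∑ j, d.2.2.2 (Sum.inr (l.succAbove j)) • d.1 j) x y) =
        ∑ r : Fin ρ, (fun d => d.2.1 x (Sum.inr r)) * (fun d => d.2.2.1 (Sum.inr r) y) -
          ∑ j, (fun d => d.2.2.2 (Sum.inr (l.succAbove j))) * (fun d => d.1 j x y) := by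
      ext d
      simp [Matrix.mul_apply, Matrix.sum_apply]
    rw [this]
    exact Subalgebra.sub_mem _
      (Subalgebra.sum_mem _ fun r _ => Subalgebra.mul_mem _
        (lin ⟨fun _ _ => rfl, fun _ _ => rfl⟩) (lin ⟨fun _ _ => rfl, fun _ _ => rfl⟩))
      (Subalgebra.sum_mem _ fun r _ => Subalgebra.mul_mem _
        (lin ⟨fun _ _ => rfl, fun _ _ => rfl⟩) (lin ⟨fun _ _ => rfl, fun _ _ => rfl⟩))
  · simp only [Fin.insertNth_apply_succAbove]
    exact lin ⟨fun _ _ => rfl, fun _ _ => rfl⟩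

/-- Solve the low-rank combination for the matrix whose coefficient is nonzero; the thin factors
become new vectors and the quotients of the coefficients new scalars. -/
theorem MatData.exists_expand_eq {ρ : ℕ} (d : MatData K (k + 1) σ τ γ a b) (μ : Fin (k + 1) → K)
    (hμ : μ ≠ 0)
    (h : finrank K (LinearMap.range (Matrix.vecMulLinear (∑ l, μ l • d.1 l))) ≤ ρ) :
    ∃ (l : Fin (k + 1)) (d' : MatData K k (σ ⊕ Fin ρ) (τ ⊕ Fin ρ) (γ ⊕ Fin (k + 1)) a b),
      d'.expand l = d := by
  obtain ⟨l, hl⟩ := Function.ne_iff.1 hμ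
  obtain ⟨x, y, hxy⟩ := exists_factorization_of_finrank_range_le _ h
  refine ⟨l, (fun j => d.1 (l.succAbove j),
    Matrix.of fun i => Sum.elim (d.2.1 i) fun r => (μ l)⁻¹ * x i r,
    Matrix.of (Sum.elim d.2.2.1 y), Sum.elim d.2.2.2 fun j => (μ l)⁻¹ * μ j), ?_⟩
  refine Prod.ext (funext fun j => ?_) (Prod.ext ?_ (Prod.ext ?_ rfl))
  · refine Fin.succAboveCases l ?_ (fun j => ?_) j
    · simp only [MatData.expand, Fin.insertNth_apply_same]
      rw [Fin.sum_univ_succAbove _ l] at hxy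
      have h1 : (Matrix.of fun i => Sum.elim (d.2.1 i) fun r => (μ l)⁻¹ * x i r).submatrix id
          (Sum.inr : Fin ρ → σ ⊕ Fin ρ) = (μ l)⁻¹ • x := rfl
      have h2 : (Matrix.of (Sum.elim d.2.2.1 y)).submatrix (Sum.inr : Fin ρ → τ ⊕ Fin ρ) id = y :=
        rfl
      simp only [Sum.elim_inr]
      rw [h1, h2, Matrix.smul_mul, ← hxy, smul_add, smul_smul, inv_mul_cancel₀ hl, one_smul,
        Finset.smul_sum]
      simp [smul_smul]
    · simp [MatData.expand]
  · rfl
  · rfl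

/-- Descending chains of closed families stabilise: tuples of matrices, vectors and scalars are
topologically Noetherian up to row and column operations. -/
theorem matData_chain [Infinite K] (k : ℕ) : ∀ (σ τ γ : Type) [Fintype σ] [Fintype τ] [Finite γ]
    (Z : ℕ → ∀ a b, Set (MatData K k σ τ γ a b)) (_ : ∀ i, IsClosedFamily (Z i))
    (_ : ∀ i j, i ≤ j → ∀ a b, Z j a b ⊆ Z i a b),
    ∃ N, ∀ i, N ≤ i → ∀ a b, Z i a b = Z N a b := by
  induction k with
  | zero => intro σ τ γ _ _ _ Z hZ hanti; exact matData_zero_chain Z hZ hanti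
  | succ k ih =>
    intro σ τ γ _ _ _ Z hZ hanti
    -- The cores involve no matrices, so the base case applies to them: first along the chain, then,
    -- with `Z N₀` fixed, along the bound m on the sizes of the completions.
    obtain ⟨N₀, hN₀⟩ := matData_zero_chain (fun i => coreFamily (fun _ => True) (Z i))
      (fun i => (hZ i).coreFamily _)
      (fun i j hij a b d hd a' b' ha hb φ ψ M' => hanti i j hij _ _ (hd a' b' ha hb φ ψ M'))
    obtain ⟨m₀, hm₀⟩ := matData_zero_chain (fun m => coreFamily (fun n => n ≤ m) (Z N₀))
      (fun i => (hZ N₀).coreFamily _)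
      (fun i j hij a b d hd a' b' ha hb φ ψ M' =>
        hd a' b' (ha.trans hij) (hb.trans hij) φ ψ M')
    -- The threshold required by `exists_minor_eq` for prescribing minors with at most m₀ rows.
    set ρ := (k + 1) + m₀ * (k + 1) + Fintype.card τ + Fintype.card σ
    have hstab : ∀ l : Fin (k + 1), ∃ N, ∀ i, N ≤ i → ∀ a b,
        (MatData.expand l : MatData K k (σ ⊕ Fin ρ) (τ ⊕ Fin ρ) (γ ⊕ Fin (k + 1)) a b → _) ⁻¹'
          Z i a b = MatData.expand l ⁻¹' Z N a b := fun l => by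
      refine ih _ _ _ (fun i a b => MatData.expand l ⁻¹' Z i a b) (fun i => ⟨fun a b =>
        ((hZ i).closed a b).preimage (MatData.isPolyMap_expand l), fun φ ψ d hd => ?_⟩)
        (fun i j hij a b d hd => hanti i j hij _ _ hd)
      change MatData.expand l (MatData.minor φ ψ d) ∈ Z i _ _
      rw [← MatData.minor_expand]
      exact (hZ i).minor_mem _ _ _ hd
    choose N₁ hN₁ using hstab
    refine ⟨N₀ + ∑ l, N₁ l, fun i hi a b => (hanti _ i hi a b).antisymm fun d hd => ?_⟩
    by_contra hdi
    by_cases hlow : ∃ μ : Fin (k + 1) → K, μ ≠ 0 ∧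
        finrank K (LinearMap.range (Matrix.vecMulLinear (∑ l, μ l • d.1 l))) ≤ ρ
    · obtain ⟨μ, hμ, hr⟩ := hlow
      obtain ⟨l, d', rfl⟩ := d.exists_expand_eq μ hμ hr
      have hl : N₁ l ≤ N₀ + ∑ l, N₁ l := (Finset.single_le_sum
        (fun j _ => Nat.zero_le (N₁ j)) (Finset.mem_univ l)).trans (Nat.le_add_left _ _)
      have h1 : d' ∈ MatData.expand l ⁻¹' Z (N₀ + ∑ l, N₁ l) a b := hd
      rw [hN₁ l _ hl, ← hN₁ l i (hl.trans hi)] at h1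
      exact hdi h1
    · push Not at hlow
      have hcore : (Fin.elim0, d.2) ∉ coreFamily (fun _ => True) (Z i) a b := fun h => by
        have := h a b trivial trivial 1 1 d.1
        apply hdi
        simpa [MatData.minor] using this
      have h2 := hN₀ i ((Nat.le_add_right _ _).trans hi) a b
      beta_reduce at h2
      rw [h2] at hcore
      have hcore' : (Fin.elim0, d.2) ∉ coreFamily (fun n => n ≤ m₀) (Z N₀) a b := fun h => by
        refine hcore fun a' b' _ _ φ ψ M' => ?_
        have h3 := hm₀ (m₀ + a' + b') (by omega) a b
        beta_reduce at h3
        rw [← h3] at h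
        exact h a' b' (by omega) (by omega) φ ψ M'
      apply hcore'
      intro a' b' ha' hb' φ ψ M'
      obtain ⟨φ', ψ', h3, h4, h5⟩ := exists_minor_eq d.1 d.2.1 d.2.2.1 ρ (by
        have := Nat.mul_le_mul_right (k + 1) ha'
        omega) (fun μ hμ => hlow μ hμ) φ ψ M'
      have h6 := (hZ N₀).minor_mem φ' ψ' d (hanti _ _ (Nat.le_add_right _ _) a b hd)
      convert h6 using 1
      refine Prod.ext (funext fun l => (h5 l).symm) (Prod.ext h3.symm (Prod.ext h4.symm rfl))

/-- A closed family is detected on minors of bounded size. -/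
theorem IsClosedFamily.exists_bound [Infinite K] [Fintype σ] [Fintype τ] [Finite γ]
    {Z : ∀ a b, Set (MatData K k σ τ γ a b)} (hZ : IsClosedFamily Z) :
    ∃ m, ∀ a b, ∀ d : MatData K k σ τ γ a b, d ∉ Z a b →
      ∃ a' b', a' ≤ m ∧ b' ≤ m ∧ ∃ (φ : Matrix (Fin a') (Fin a) K) (ψ : Matrix (Fin b) (Fin b') K),
        d.minor φ ψ ∉ Z a' b' := by
  -- Stage m of the chain imposes membership in Z on the minors of size at most m. At stage N + a +
  -- b the datum d is one of its own minors, by identity matrices.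
  obtain ⟨N, hN⟩ := matData_chain k σ τ γ
    (fun m a b => {d | ∀ a' b', a' ≤ m → b' ≤ m → ∀ (φ : Matrix (Fin a') (Fin a) K)
      (ψ : Matrix (Fin b) (Fin b') K), d.minor φ ψ ∈ Z a' b'})
    (fun m => ⟨fun a b => ZClosed.forall fun a' => ZClosed.forall fun b' => ZClosed.forall fun _ =>
      ZClosed.forall fun _ => ZClosed.forall fun φ => ZClosed.forall fun ψ =>
        (hZ.closed a' b').preimage (MatData.isPolyMap_minor φ ψ),
      fun φ ψ d hd a' b' ha hb φ' ψ' => by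
        rw [MatData.minor_minor]
        exact hd a' b' ha hb _ _⟩)
    (fun i j hij a b d hd a' b' ha hb => hd a' b' (ha.trans hij) (hb.trans hij))
  refine ⟨N, fun a b d hd => ?_⟩
  by_contra! hcon
  apply hd
  have h1 : d ∈ {d : MatData K k σ τ γ a b | ∀ a' b', a' ≤ N → b' ≤ N →
      ∀ (φ : Matrix (Fin a') (Fin a) K)
      (ψ : Matrix (Fin b) (Fin b') K), d.minor φ ψ ∈ Z a' b'} := hcon
  have h2 := hN (N + a + b) (by omega) a b
  beta_reduce at h2
  rw [← h2] at h1
  have h3 := h1 a b (by omega) (by omega) 1 1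
  simpa [MatData.minor] using h3

end MatData

end

end Plucker

namespace Plucker

open Module

noncomputable section

/-! ### Alternating forms and the Hodge relation -/

section Forms

/-- Alternating forms on the coordinate space `I → K`, with arguments indexed by `ι`. -/
abbrev Alt (K : Type u) [Field K] (ι I : Type) := (I → K) [⋀^ι]→ₗ[K] K

variable {K : Type u} [Field K]

/-- Two injections of a finite type differ by a permutation. -/
theorem exists_perm_comp_eq {ι I : Type*} [Finite I] {f g : ι → I}
    (hf : Function.Injective f) (hg : Function.Injective g) :
    ∃ σ : Equiv.Perm I, ∀ i, σ (f i) = g i := by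
  classical
  cases nonempty_fintype I
  let e : {x // x ∈ Set.range f} ≃ {x // x ∈ Set.range g} :=
    (Equiv.ofInjective f hf).symm.trans (Equiv.ofInjective g hg)
  refine ⟨e.extendSubtype, fun i => ?_⟩
  rw [Equiv.extendSubtype_apply_of_mem e (f i) ⟨i, rfl⟩]
  have : (Equiv.ofInjective f hf).symm ⟨f i, ⟨i, rfl⟩⟩ = i :=
    (Equiv.ofInjective f hf).symm_apply_apply i
  simp [e, this]

/-- The coordinates of an alternating form. -/
def coord {ι I : Type} [DecidableEq I] (g : ι → I) (α : Alt K ι I) : K :=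
  α fun i => Pi.single (g i) 1

/-- The Hodge relation between forms of complementary degrees, tested on pairs of dual bases: the
bases are the rows of `G` and of `H`. -/
def HodgeRel {ι κ I : Type} [Fintype I] [DecidableEq I] (c : K) (ε : ι ⊕ κ ≃ I) (α : Alt K ι I)
    (β : Alt K κ I) : Prop :=
  ∀ G H : Matrix I I K, G * H.transpose = 1 →
    (α fun i => G (ε (Sum.inl i))) = c * G.det * β fun j => H (ε (Sum.inr j))

variable {ι κ I : Type} [Fintype I] [DecidableEq I] {c : K} {ε : ι ⊕ κ ≃ I} {α α' : Alt K ι I}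
  {β β' : Alt K κ I}

theorem HodgeRel.symm (h : HodgeRel c ε α β) (hc : c ≠ 0) :
    HodgeRel c⁻¹ ((Equiv.sumComm κ ι).trans ε) β α := fun G H hGH => by
  have h1 : H * G.transpose = 1 := by
    have := congr_arg Matrix.transpose hGH
    simpa [Matrix.transpose_mul] using this
  have h2 := h H G h1
  have h3 : G.det * H.det = 1 := by
    rw [← Matrix.det_transpose H, ← Matrix.det_mul, hGH, Matrix.det_one]
  simp only [Equiv.trans_apply, Equiv.sumComm_apply, Sum.swap_inl, Sum.swap_inr]
  rw [h2]
  field_simp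
  linear_combination (- (β fun j => G (ε (Sum.inr j)))) * h3

/-- A permutation matrix is its own inverse transpose, so it is an admissible pair of dual bases. -/
theorem HodgeRel.coord_eq (h : HodgeRel c ε α β) (σ : Equiv.Perm I) :
    coord (fun i => σ (ε (Sum.inl i))) α =
      c * (Equiv.Perm.sign σ : ℤ) * coord (fun j => σ (ε (Sum.inr j))) β := by
  let G : Matrix I I K := Matrix.of fun i => Pi.single (σ i) 1
  have hG : G = (1 : Matrix I I K).submatrix σ id := by
    ext i j
    simp [G, Pi.single_apply, Matrix.one_apply, eq_comm]
  have hGG : G * G.transpose = 1 := by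
    ext i j
    simp [G, Matrix.mul_apply, Matrix.one_apply, Pi.single_apply, eq_comm]
  have hd : G.det = (Equiv.Perm.sign σ : ℤ) := by
    rw [hG, Matrix.det_permute, Matrix.det_one, mul_one]
  have := h G G hGG
  rw [hd] at this
  exact this

theorem HodgeRel.unique [Finite ι] [Finite κ] (hc : c ≠ 0) (h : HodgeRel c ε α β) (h' : HodgeRel c ε α β') :
    β = β' := by
  refine Basis.ext_alternating (Pi.basisFun K I) fun f hf => ?_
  obtain ⟨σ, hσ⟩ := exists_perm_comp_eq (f := fun j => ε (Sum.inr j))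
    (ε.injective.comp Sum.inr_injective) hf
  have h1 := (h.coord_eq σ).symm.trans (h'.coord_eq σ)
  have hs : ((Equiv.Perm.sign σ : ℤ) : K) ≠ 0 := by
    rcases Int.units_eq_one_or (Equiv.Perm.sign σ) with h | h <;> simp [h]
  have h2 := mul_left_cancel₀ (mul_ne_zero hc hs) h1
  simpa [coord, hσ] using h2

theorem HodgeRel.zero : HodgeRel c ε (0 : Alt K ι I) (0 : Alt K κ I) := fun G H _ => by simp

theorem HodgeRel.smul_right {s : K} (h : HodgeRel (c * s) ε α β) : HodgeRel c ε α (s • β) :=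
  fun G H hGH => by
    rw [h G H hGH, AlternatingMap.smul_apply, smul_eq_mul]
    ring

end Forms

/-! ### Elements of exterior powers as alternating forms -/

section ToForm

variable (K : Type u) [Field K] (V : Type u) [AddCommGroup V] [Module K V]
  [FiniteDimensional K V] {V' : Type u} [AddCommGroup V'] [Module K V']
  [FiniteDimensional K V']

/-- An element of `⋀ᵖ V*` as an alternating form on `V`. -/
def toForm (p : ℕ) : (⋀[K]^p (Dual K V)) ≃ₗ[K] (V [⋀^Fin p]→ₗ[K] K) :=
  (dualEquiv K V p).trans exteriorPower.alternatingMapLinearEquiv.symm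

variable {K V}

theorem toForm_apply {p : ℕ} (ω : ⋀[K]^p (Dual K V)) (v : Fin p → V) :
    toForm K V p ω v = dualEquiv K V p ω (exteriorPower.ιMulti K p v) := by
  simp [toForm]

theorem dualEquiv_ιMulti {p : ℕ} (f : Fin p → Dual K V) (v : Fin p → V) :
    dualEquiv K V p (exteriorPower.ιMulti K p f) (exteriorPower.ιMulti K p v) =
      Matrix.det (n := Fin p) (.of (fun i j ↦ f j (v i))) :=
  exteriorPower.pairingDual_ιMulti_ιMulti f v

theorem toForm_map_dualMap {p : ℕ} (L : V →ₗ[K] V') (ω : ⋀[K]^p (Dual K V')) :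
    toForm K V p (exteriorPower.map p L.dualMap ω) =
      (toForm K V' p ω).compLinearMap L := by
  suffices h : (toForm K V p).toLinearMap ∘ₗ exteriorPower.map p L.dualMap =
      ({ toFun := fun f => f.compLinearMap L, map_add' := fun _ _ => rfl,
         map_smul' := fun _ _ => rfl } : (V' [⋀^Fin p]→ₗ[K] K) →ₗ[K] (V [⋀^Fin p]→ₗ[K] K)) ∘ₗ
        (toForm K V' p).toLinearMap from
    LinearMap.congr_fun h ω
  apply exteriorPower.linearMap_ext
  ext f v
  simp only [LinearMap.compAlternatingMap_apply, LinearMap.comp_apply, LinearEquiv.coe_coe,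
    exteriorPower.map_apply_ιMulti]
  rw [toForm_apply, dualEquiv_ιMulti]
  change _ = toForm K V' p _ fun i => L (v i)
  rw [toForm_apply, dualEquiv_ιMulti]
  rfl

theorem wedge_ιMulti_ιMulti {p n : ℕ} (f : Fin p → V) (g : Fin n → V) :
    wedge K p n (exteriorPower.ιMulti K p f) (exteriorPower.ιMulti K n g) =
      exteriorPower.ιMulti K (p + n) (Fin.append f g) := by
  apply Subtype.ext
  change ExteriorAlgebra.ιMulti K p f * ExteriorAlgebra.ιMulti K n g =
    ExteriorAlgebra.ιMulti K (p + n) (Fin.append f g)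
  simp only [ExteriorAlgebra.ιMulti_apply]
  change _ = (List.ofFn ((ExteriorAlgebra.ι K) ∘ Fin.append f g)).prod
  rw [← List.map_ofFn, List.ofFn_fin_append, List.map_append, List.prod_append]
  simp only [List.map_ofFn]
  rfl

/-- Wedging with half of a basis of `V*` reads off one coordinate. -/
theorem apply_wedge_dualBasis {p n : ℕ} (b : Basis (Fin p ⊕ Fin n) K V)
    (D : Dual K V [⋀^Fin (p + n)]→ₗ[K] K) (ω : ⋀[K]^p (Dual K V)) :
    exteriorPower.alternatingMapLinearEquiv D
      (wedge K p n ω (exteriorPower.ιMulti K n fun j => b.dualBasis (Sum.inr j))) =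
    toForm K V p ω (fun i => b (Sum.inl i)) *
      D (Fin.append (fun i => b.dualBasis (Sum.inl i)) fun j => b.dualBasis (Sum.inr j)) := by
  set g : Fin n → Dual K V := fun j => b.dualBasis (Sum.inr j)
  set r := D (Fin.append (fun i => b.dualBasis (Sum.inl i)) g)
  suffices h : exteriorPower.alternatingMapLinearEquiv D ∘ₗ
      (wedge K p n).flip (exteriorPower.ιMulti K n g) =
      r • ((LinearMap.applyₗ (exteriorPower.ιMulti K p fun i => b (Sum.inl i))) ∘ₗ
        (dualEquiv K V p).toLinearMap) by
    have := LinearMap.congr_fun h ω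
    rw [toForm_apply, mul_comm]
    exact this
  apply exteriorPower.linearMap_ext
  refine Basis.ext_alternating b.dualBasis fun h hh => ?_
  simp only [LinearMap.compAlternatingMap_apply, LinearMap.comp_apply, LinearMap.flip_apply,
    wedge_ιMulti_ιMulti, exteriorPower.alternatingMapLinearEquiv_apply_ιMulti,
    LinearMap.smul_apply, LinearMap.applyₗ_apply_apply, LinearEquiv.coe_coe, dualEquiv_ιMulti,
    smul_eq_mul]
  -- On basis multivectors: either the indices permute the first half and both sides are the same
  -- sign times r, or an index of the second half is repeated in the wedge and both sides vanish.
  by_cases hl : ∀ i, ∃ k, h i = Sum.inl k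
  · choose s hs using hl
    have hsi : Function.Injective s := fun i j hij => hh (by rw [hs, hs, hij])
    let σ : Equiv.Perm (Fin p) := Equiv.ofBijective s (Finite.injective_iff_bijective.1 hsi)
    have h1 : (Fin.append (fun i => b.dualBasis (h i)) g) =
        Fin.append (fun i => b.dualBasis (Sum.inl i)) g ∘
          (finSumFinEquiv.permCongr (Equiv.Perm.sumCongr σ 1)) := by
      ext1 x
      obtain ⟨x, rfl⟩ := finSumFinEquiv.surjective x
      rcases x with x | x <;> simp [Equiv.permCongr_apply, σ, hs]
    have h2 : (Matrix.of fun i j => b.dualBasis (h j) (b (Sum.inl i)) :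
        Matrix (Fin p) (Fin p) K).transpose = (1 : Matrix (Fin p) (Fin p) K).submatrix σ id := by
      ext i j
      simp [hs, Matrix.one_apply, σ, Finsupp.single_apply, eq_comm]
    rw [h1, AlternatingMap.map_perm, ← Matrix.det_transpose, h2, Matrix.det_permute,
      Equiv.Perm.sign_permCongr, Equiv.Perm.sign_sumCongr]
    simp [r, Units.smul_def, mul_comm]
  · push Not at hl
    obtain ⟨i, hi⟩ := hl
    obtain ⟨j, hj⟩ : ∃ j, h i = Sum.inr j := by
      rcases hx : h i with x | x
      · exact absurd hx (hi x)
      · exact ⟨x, rfl⟩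
    have h1 : D (Fin.append (fun i => b.dualBasis (h i)) g) = 0 := by
      refine D.map_eq_zero_of_eq _ (i := Fin.castAdd n i) (j := Fin.natAdd p j) ?_ ?_
      · simp [g, hj]
      · intro h0
        have := congr_arg Fin.val h0
        simp at this
        omega
    have h2 : (Matrix.of fun i j => b.dualBasis (h j) (b (Sum.inl i)) :
        Matrix (Fin p) (Fin p) K).det = 0 := by
      apply Matrix.det_eq_zero_of_column_eq_zero i
      intro k
      simp [hj]
    rw [h1, h2, mul_zero]

end ToForm

end

end Plucker

namespace Plucker

open Module

noncomputable section

/-! ### The instances of a Plücker variety as sets of alternating forms -/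

section Interface

variable {K : Type u} [Field K]

/-- Every element of `⋀ᵖ (Kᴵ)*` has a Hodge dual inside `⋀ⁿ (Kᴵ)*`, in terms of forms. -/
theorem PluckerVariety.exists_hodgeRel_toForm (P : PluckerVariety K) {p n : ℕ} {I : Type}
    [Fintype I] [DecidableEq I] (ε : Fin p ⊕ Fin n ≃ I) {c : K} (hc : c ≠ 0)
    (ω : ⋀[K]^p (Dual K (I → K))) :
    ∃ η : ⋀[K]^n (Dual K (I → K)), (ω ∈ P.X p _ → η ∈ P.X n _) ∧
      HodgeRel c ε (toForm K (I → K) p ω) (toForm K (I → K) n η) := by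
  let t : (I → K) ≃ₗ[K] Dual K (I → K) := dotProductEquiv K I
  let D : Dual K (I → K) [⋀^Fin (p + n)]→ₗ[K] K := c⁻¹ •
    (((Matrix.detRowAlternating (n := I) (R := K)).compLinearMap t.symm.toLinearMap).domDomCongr
      (ε.symm.trans finSumFinEquiv))
  have hD : ∀ H : Matrix I I K,
      D (Fin.append (fun i => t (H (ε (Sum.inl i)))) fun j => t (H (ε (Sum.inr j)))) =
        c⁻¹ * H.det := fun H => by
    have : (fun i => t.symm ((Fin.append (fun i => t (H (ε (Sum.inl i))))
        fun j => t (H (ε (Sum.inr j)))) ((ε.symm.trans finSumFinEquiv) i))) = H := by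
      ext1 i
      obtain ⟨x, rfl⟩ := ε.surjective i
      rcases x with x | x <;> simp
    change c⁻¹ * Matrix.det (fun i => t.symm ((Fin.append (fun i => t (H (ε (Sum.inl i))))
        fun j => t (H (ε (Sum.inr j)))) ((ε.symm.trans finSumFinEquiv) i))) = _
    rw [this]
  have hcard : Fintype.card I = p + n := by
    rw [← Fintype.card_congr ε]; simp
  let φ := exteriorPower.alternatingMapLinearEquiv D
  have hφ : φ ≠ 0 := fun h0 => by
    have h1 := hD 1
    have h2 : D = 0 := by
      rwa [← map_zero (exteriorPower.alternatingMapLinearEquiv),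
        EquivLike.apply_eq_iff_eq] at h0
    rw [h2] at h1
    simp at h1
    exact hc h1.symm
  have hfr : finrank K (⋀[K]^(p + n) (Dual K (I → K))) = finrank K K := by
    rw [exteriorPower.finrank_eq, Subspace.dual_finrank_eq, finrank_fintype_fun_eq_card, hcard]
    simp
  have hsurj : Function.Surjective φ := LinearMap.surjective hφ
  let ψ : (⋀[K]^(p + n) (Dual K (I → K))) ≃ₗ[K] K := LinearEquiv.ofBijective φ
    ⟨(LinearMap.injective_iff_surjective_of_finrank_eq_finrank hfr).2 hsurj, hsurj⟩
  let star : (⋀[K]^p (Dual K (I → K))) →ₗ[K] ⋀[K]^n (Dual K (Dual K (I → K))) :=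
    (dualEquiv K (Dual K (I → K)) n).symm.toLinearMap ∘ₗ (wedge K p n).compr₂ ψ.toLinearMap
  have hstar : ∀ ω ω', dualEquiv K (Dual K (I → K)) n (star ω) ω' = ψ (wedge K p n ω ω') :=
    fun ω ω' => by simp [star]
  -- The star takes values in the exterior power of the double dual; the transpose of the dot
  -- product isomorphism t brings it back to the dual, and functoriality keeps it in the variety.
  refine ⟨exteriorPower.map n t.toLinearMap.dualMap (star ω), fun h => P.map_mem _ _ _ _ _
    (P.hodge_mem p n _ ?_ star ⟨ψ, hstar⟩ ω h), fun G H hGH => ?_⟩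
  · rw [Subspace.dual_finrank_eq, finrank_fintype_fun_eq_card, hcard, add_comm]
  have hHG : IsUnit G.det := by
    have := congr_arg Matrix.det hGH
    rw [Matrix.det_mul, Matrix.det_one] at this
    exact IsUnit.of_mul_eq_one _ this
  have hdet : G.det * H.det = 1 := by
    rw [← Matrix.det_transpose H, ← Matrix.det_mul, hGH, Matrix.det_one]
  have hli : LinearIndependent K fun i => G i :=
    Matrix.linearIndependent_rows_iff_isUnit.2 ((Matrix.isUnit_iff_isUnit_det G).2 hHG)
  let b : Basis (Fin p ⊕ Fin n) K (I → K) :=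
    haveI := Classical.dec (Nonempty I)
    (basisOfPiSpaceOfLinearIndependent hli).reindex ε.symm
  have hb : ∀ x, b x = G (ε x) := fun x => by
    simp [b]
  have hbd : ∀ x, b.dualBasis x = t (H (ε x)) := fun x => by
    refine b.ext fun y => ?_
    rw [Basis.dualBasis_apply_self, hb]
    have := congr_fun (congr_fun hGH (ε y)) (ε x)
    rw [Matrix.mul_apply] at this
    simp only [Matrix.transpose_apply, Matrix.one_apply, EmbeddingLike.apply_eq_iff_eq] at this
    rw [← this, dotProductEquiv_apply_apply, dotProduct]
    exact Finset.sum_congr rfl fun i _ => mul_comm _ _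
  rw [toForm_map_dualMap, AlternatingMap.compLinearMap_apply, toForm_apply (V := Dual K (I → K)),
    hstar]
  have key := apply_wedge_dualBasis b D ω
  simp only [hb, hbd, hD] at key
  change _ = _ * _ * exteriorPower.alternatingMapLinearEquiv D (wedge K p n ω
    (exteriorPower.ιMulti K n fun j => t (H (ε (Sum.inr j)))))
  rw [key]
  field_simp
  linear_combination (-(toForm K (I → K) p ω fun i => G (ε (Sum.inl i)))) * hdet

theorem HodgeRel.congr {ι κ ι' κ' I : Type} [Fintype I] [DecidableEq I] {c : K} {ε : ι ⊕ κ ≃ I}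
    {α : Alt K ι I} {β : Alt K κ I} (h : HodgeRel c ε α β) (e : ι' ≃ ι) (f : κ' ≃ κ) :
    HodgeRel c ((Equiv.sumCongr e f).trans ε) (α.domDomCongr e.symm) (β.domDomCongr f.symm) :=
  fun G H hGH => by
    have := h G H hGH
    simpa [Function.comp_def] using this

/-- The alternating forms on `Kᴵ` belonging to a Plücker variety. -/
def PluckerVariety.forms (P : PluckerVariety K) (ι I : Type) [Fintype ι] [Finite I] :
    Set (Alt K ι I) :=
  {α | (toForm K (I → K) (Fintype.card ι)).symm (α.domDomCongr (Fintype.equivFin ι)) ∈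
    P.X (Fintype.card ι) (Dual K (I → K))}

variable {P : PluckerVariety K} {ι κ I J : Type} [Fintype ι] [Fintype κ] [Fintype I]

theorem Alt.eq_zero_of_card_lt {α : Alt K ι I} (h : Fintype.card I < Fintype.card ι) : α = 0 :=
  Basis.ext_alternating (Pi.basisFun K I) fun f hf =>
    absurd (Fintype.card_le_of_injective f hf) (not_le.2 h)

/-- Reordering the arguments changes a form at most by a sign, which is absorbed by Hodge duality:
dualise, and dualise back with a reordered identification of the index sets. With more arguments
than dimensions the form is zero and there is nothing to reorder. -/
theorem PluckerVariety.mem_X_of_equiv {p : ℕ} {α : Alt K ι I} (e e' : ι ≃ Fin p)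
    (h : (toForm K (I → K) p).symm (α.domDomCongr e) ∈ P.X p (Dual K (I → K))) :
    (toForm K (I → K) p).symm (α.domDomCongr e') ∈ P.X p (Dual K (I → K)) := by
  classical
  have hp : Fintype.card ι = p := by simpa using Fintype.card_congr e
  rcases lt_or_ge (Fintype.card I) (Fintype.card ι) with hlt | hle
  · obtain rfl := Alt.eq_zero_of_card_lt (α := α) hlt
    exact h
  let ε : Fin p ⊕ Fin (Fintype.card I - p) ≃ I := Fintype.equivOfCardEq (by simp; omega)
  obtain ⟨η, h1, h2⟩ := P.exists_hodgeRel_toForm ε one_ne_zero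
    ((toForm K (I → K) p).symm (α.domDomCongr e))
  let τ : Fin p ≃ Fin p := e.symm.trans e'
  obtain ⟨ζ, h3, h4⟩ := P.exists_hodgeRel_toForm ((Equiv.sumCongr (Equiv.refl _) τ.symm).trans
    ((Equiv.sumComm _ _).trans ε)) one_ne_zero η
  have h5 := (h2.symm one_ne_zero).congr (Equiv.refl _) τ.symm
  rw [inv_one] at h5
  have h6 := HodgeRel.unique one_ne_zero h4 h5
  have h7 : α.domDomCongr e' = toForm K (I → K) p ζ := by
    rw [h6, LinearEquiv.apply_symm_apply]
    ext v
    simp [τ, Function.comp_def]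
  rw [h7, LinearEquiv.symm_apply_apply]
  exact h3 (h1 h)

theorem PluckerVariety.mem_forms_iff {p : ℕ} {α : Alt K ι I} (e : ι ≃ Fin p) :
    α ∈ P.forms ι I ↔ (toForm K (I → K) p).symm (α.domDomCongr e) ∈ P.X p (Dual K (I → K)) := by
  obtain rfl : Fintype.card ι = p := by simpa using Fintype.card_congr e
  exact ⟨mem_X_of_equiv _ _, mem_X_of_equiv _ _⟩

theorem PluckerVariety.toForm_mem_forms {p : ℕ} {ω : ⋀[K]^p (Dual K (I → K))} :
    toForm K (I → K) p ω ∈ P.forms (Fin p) I ↔ ω ∈ P.X p (Dual K (I → K)) := by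
  rw [mem_forms_iff (Equiv.refl _)]
  have : (toForm K (I → K) p ω).domDomCongr (Equiv.refl _) = toForm K (I → K) p ω := by
    ext v; simp
  rw [this, LinearEquiv.symm_apply_apply]

theorem PluckerVariety.domDomCongr_mem_forms {α : Alt K ι I} (e : ι ≃ κ) :
    α.domDomCongr e ∈ P.forms κ I ↔ α ∈ P.forms ι I := by
  rw [mem_forms_iff (Fintype.equivFin κ), mem_forms_iff (e.trans (Fintype.equivFin κ))]
  rfl

theorem PluckerVariety.zClosed_forms : ZClosed (K := K) (P.forms ι I) := by
  refine (P.isClosed _ _).zClosed.preimage (F := fun α : Alt K ι I =>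
    (toForm K (I → K) (Fintype.card ι)).symm (α.domDomCongr (Fintype.equivFin ι))) ?_
  exact isPolyMap_linear ((toForm K (I → K) (Fintype.card ι)).symm.toLinearMap ∘ₗ
    (AlternatingMap.domDomCongrₗ K (Fintype.equivFin ι)).toLinearMap)

theorem PluckerVariety.compLinearMap_mem_forms [Fintype J] {α : Alt K ι I}
    (h : α ∈ P.forms ι I) (L : (J → K) →ₗ[K] (I → K)) : α.compLinearMap L ∈ P.forms ι J := by
  have h1 := P.map_mem _ _ _ L.dualMap _ h
  have h2 := toForm_map_dualMap L
    ((toForm K (I → K) (Fintype.card ι)).symm (α.domDomCongr (Fintype.equivFin ι)))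
  rw [LinearEquiv.apply_symm_apply, ← LinearEquiv.eq_symm_apply] at h2
  rw [h2] at h1
  exact h1

variable [DecidableEq I] {c : K} {ε : ι ⊕ κ ≃ I} {α : Alt K ι I} {β : Alt K κ I}

theorem PluckerVariety.exists_hodgeRel (P : PluckerVariety K) (ε : ι ⊕ κ ≃ I) (hc : c ≠ 0)
    (α : Alt K ι I) :
    ∃ β : Alt K κ I, HodgeRel c ε α β ∧ (α ∈ P.forms ι I → β ∈ P.forms κ I) := by
  let e := Fintype.equivFin ι
  let f := Fintype.equivFin κ
  obtain ⟨η, h1, h2⟩ := P.exists_hodgeRel_toForm ((Equiv.sumCongr e.symm f.symm).trans ε) hc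
    ((toForm K (I → K) _).symm (α.domDomCongr e))
  rw [LinearEquiv.apply_symm_apply] at h2
  have h3 := h2.congr e f
  refine ⟨(toForm K (I → K) _ η).domDomCongr f.symm, fun G H hGH => ?_, fun h => ?_⟩
  · simpa [Function.comp_def] using h3 G H hGH
  · rw [domDomCongr_mem_forms, toForm_mem_forms]
    exact h1 h

theorem HodgeRel.mem_forms (h : HodgeRel c ε α β) (hc : c ≠ 0) (hα : α ∈ P.forms ι I) :
    β ∈ P.forms κ I := by
  obtain ⟨β', h1, h2⟩ := P.exists_hodgeRel ε hc α
  rw [h.unique hc h1]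
  exact h2 hα

theorem HodgeRel.mem_forms_iff (h : HodgeRel c ε α β) (hc : c ≠ 0) :
    α ∈ P.forms ι I ↔ β ∈ P.forms κ I :=
  ⟨h.mem_forms hc, (h.symm hc).mem_forms (inv_ne_zero hc)⟩

end Interface

end

end Plucker

namespace Plucker

open Module

noncomputable section

/-! ### Contraction of forms and its Hodge dual, restriction to subspaces -/

section Contraction

variable {K : Type u} [Field K] {γ ι κ κ' I J J' : Type}

/-- Contraction of an alternating form with vectors in its first arguments. -/
def fixLeft (α : Alt K (γ ⊕ ι) I) (z : γ → I → K) : Alt K ι I :=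
  { α.toMultilinearMap.currySum z with
    map_eq_zero_of_eq' := fun v i j hij hne =>
      α.map_eq_zero_of_eq (Sum.elim z v) (i := Sum.inr i) (j := Sum.inr j) (by simpa using hij)
        (by simpa using hne) }

@[simp]
theorem fixLeft_apply (α : Alt K (γ ⊕ ι) I) (z : γ → I → K) (v : ι → I → K) :
    fixLeft α z v = α (Sum.elim z v) := rfl

theorem fixLeft_compLinearMap (α : Alt K (γ ⊕ ι) I) (L : (J → K) →ₗ[K] (I → K)) (z : γ → J → K) :
    fixLeft (α.compLinearMap L) z = (fixLeft α fun g => L (z g)).compLinearMap L := by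
  ext v
  simp only [fixLeft_apply, AlternatingMap.compLinearMap_apply]
  congr 1
  ext1 x
  cases x <;> rfl

theorem fixLeft_eq_zero {α : Alt K (γ ⊕ ι) I} {z : γ → I → K} (hz : ¬ LinearIndependent K z) :
    fixLeft α z = 0 := by
  ext v
  exact α.map_linearDependent _ fun h => hz (h.comp Sum.inl Sum.inl_injective)

theorem compLinearMap_compLinearMap (α : Alt K ι I) (L : (J → K) →ₗ[K] (I → K))
    (L' : (J' → K) →ₗ[K] (J → K)) :
    (α.compLinearMap L).compLinearMap L' = α.compLinearMap (L ∘ₗ L') := rfl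

variable [Fintype I] [DecidableEq I]

/-- An independent family extends to an invertible matrix with prescribed positions of rows. -/
theorem exists_matrix_extending {z : γ → I → K} (hz : LinearIndependent K z) {e : γ → I}
    (he : Function.Injective e) : ∃ G H : Matrix I I K, (∀ g, G (e g) = z g) ∧
      G * H.transpose = 1 := by
  classical
  let b := Basis.sumExtend hz
  have : Finite (γ ⊕ Basis.sumExtendIndex hz) := Module.Finite.finite_basis b
  let s : I ≃ γ ⊕ Basis.sumExtendIndex hz := (Pi.basisFun K I).indexEquiv b
  obtain ⟨σ, hσ⟩ := exists_perm_comp_eq (g := fun g => s.symm (Sum.inl g)) he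
    (s.symm.injective.comp Sum.inl_injective)
  let b' := b.reindex (σ.trans s).symm
  let G : Matrix I I K := fun i => b' i
  have hG : IsUnit G := Matrix.linearIndependent_rows_iff_isUnit.1 b'.linearIndependent
  refine ⟨G, (G⁻¹).transpose, fun g => ?_, ?_⟩
  · have h1 : b' (e g) = b (s (σ (e g))) := by simp [b']
    have h2 : b (Sum.inl g) = z g := by
      simp [b, Basis.sumExtend, Basis.reindex_apply]
      rfl
    rw [show G (e g) = b' (e g) from rfl, h1, hσ, Equiv.apply_symm_apply, h2]
  · rw [Matrix.transpose_transpose, Matrix.mul_nonsing_inv _ ((Matrix.isUnit_iff_isUnit_det _).1 hG)]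

variable [Fintype ι] [Fintype κ'] [DecidableEq ι] [DecidableEq κ'] [Fintype γ] [DecidableEq γ]

/-- Restricting a form to the span of some members of a basis corresponds, on the side of the Hodge
dual, to contracting with the remaining members of the dual basis. -/
theorem HodgeRel.restrict {c : K} {ε : ι ⊕ (γ ⊕ κ') ≃ I} {α : Alt K ι I} {β : Alt K (γ ⊕ κ') I}
    (h : HodgeRel c ε α β) {G H : Matrix I I K} (hGH : G * H.transpose = 1) :
    HodgeRel (c * G.det) (Equiv.refl (ι ⊕ κ'))
      (α.compLinearMap (Fintype.linearCombination K fun x => G (ε (Sum.map id Sum.inr x))))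
      ((fixLeft β fun g => H (ε (Sum.inr (Sum.inl g)))).compLinearMap
        (Fintype.linearCombination K fun x => H (ε (Sum.map id Sum.inr x)))) := fun G' H' hGH' => by
  let ρ : (ι ⊕ κ') ⊕ γ ≃ I := (Equiv.sumAssoc ι κ' γ).trans
    ((Equiv.sumCongr (Equiv.refl ι) (Equiv.sumComm κ' γ)).trans ε)
  have hρ : ∀ x, ρ (Sum.inl x) = ε (Sum.map id Sum.inr x) := fun x => by
    cases x <;> simp [ρ]
  have hρ' : ∀ x, ρ (Sum.inr x) = ε (Sum.inr (Sum.inl x)) := fun x => by simp [ρ]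
  -- A pair of dual bases of the subspace is completed by the identity on γ to a pair of dual bases
  -- of the whole space, where the given relation can be used.
  let B (A : Matrix (ι ⊕ κ') (ι ⊕ κ') K) : Matrix I I K :=
    (Matrix.fromBlocks A 0 0 (1 : Matrix γ γ K)).submatrix ρ.symm ρ.symm
  have hB : B G' * (B H').transpose = 1 := by
    simp only [B, Matrix.transpose_submatrix, Matrix.submatrix_mul_equiv,
      Matrix.fromBlocks_transpose, Matrix.fromBlocks_multiply]
    simp [hGH']
  have hBρ : ∀ (A : Matrix (ι ⊕ κ') (ι ⊕ κ') K) x y,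
      B A (ρ x) (ρ y) = Matrix.fromBlocks A 0 0 (1 : Matrix γ γ K) x y := fun A x y => by simp [B]
  have hrow : ∀ (A : Matrix (ι ⊕ κ') (ι ⊕ κ') K) (M : Matrix I I K) x, (B A * M) (ρ (Sum.inl x)) =
      Fintype.linearCombination K (fun x => M (ε (Sum.map id Sum.inr x))) (A x) := fun A M x => by
    ext i
    rw [Matrix.mul_apply, ← ρ.sum_comp]
    simp only [hBρ, Fintype.sum_sum_type (α₁ := ι ⊕ κ')]
    simp [Fintype.linearCombination_apply, hρ]
  have hrow' : ∀ (A : Matrix (ι ⊕ κ') (ι ⊕ κ') K) (M : Matrix I I K) x,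
      (B A * M) (ρ (Sum.inr x)) = M (ε (Sum.inr (Sum.inl x))) := fun A M x => by
    ext i
    rw [Matrix.mul_apply, ← ρ.sum_comp, ← hρ']
    simp only [hBρ, Fintype.sum_sum_type (α₁ := ι ⊕ κ')]
    simp [Matrix.one_apply]
  have key := h (B G' * G) (B H' * H) (by
    rw [Matrix.transpose_mul, Matrix.mul_assoc, ← Matrix.mul_assoc G, hGH, Matrix.one_mul, hB])
  have hd : (B G' * G).det = G'.det * G.det := by
    rw [Matrix.det_mul, Matrix.det_submatrix_equiv_self, Matrix.det_fromBlocks_zero₂₁,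
      Matrix.det_one, mul_one]
  have e1 : (fun i => (B G' * G) (ε (Sum.inl i))) = fun i => Fintype.linearCombination K
      (fun x => G (ε (Sum.map id Sum.inr x))) (G' (Sum.inl i)) :=
    funext fun i => hrow G' G (Sum.inl i)
  have e2 : (fun j => (B H' * H) (ε (Sum.inr j))) = Sum.elim
      (fun g => H (ε (Sum.inr (Sum.inl g)))) fun i => Fintype.linearCombination K
      (fun x => H (ε (Sum.map id Sum.inr x))) (H' (Sum.inr i)) := by
    funext j
    cases j with
    | inl x => exact hrow' H' H x
    | inr x => exact hrow H' H (Sum.inr x)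
  rw [hd, e1, e2] at key
  rw [mul_comm G'.det, ← mul_assoc] at key
  exact key

theorem det_ne_zero_of_mul_transpose {G H : Matrix I I K} (h : G * H.transpose = 1) :
    G.det ≠ 0 := by
  have := congr_arg Matrix.det h
  rw [Matrix.det_mul, Matrix.det_one] at this
  exact left_ne_zero_of_mul_eq_one this

/-- A contraction of the Hodge dual is pulled back from the Hodge dual of a restriction. -/
theorem HodgeRel.exists_fixLeft_eq {c : K} (hc : c ≠ 0) {ε : ι ⊕ (γ ⊕ κ') ≃ I} {α : Alt K ι I}
    {β : Alt K (γ ⊕ κ') I} (h : HodgeRel c ε α β) {z : γ → I → K} (hz : LinearIndependent K z) :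
    ∃ (L : (ι ⊕ κ' → K) →ₗ[K] (I → K)) (β' : Alt K κ' (ι ⊕ κ')) (Q : (I → K) →ₗ[K] (ι ⊕ κ' → K))
      (c' : K), c' ≠ 0 ∧ HodgeRel c' (Equiv.refl _) (α.compLinearMap L) β' ∧
        fixLeft β z = β'.compLinearMap Q := by
  obtain ⟨H, G, hH, hHG⟩ := exists_matrix_extending hz
    (e := fun g => ε (Sum.inr (Sum.inl g))) (fun x y hxy => by simpa using hxy)
  have hGH : G * H.transpose = 1 := by
    have := congr_arg Matrix.transpose hHG
    simpa [Matrix.transpose_mul] using this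
  have key := h.restrict hGH
  simp only [hH] at key
  let LH := Fintype.linearCombination K fun x : ι ⊕ κ' => H (ε (Sum.map id Sum.inr x))
  let Q : (I → K) →ₗ[K] (ι ⊕ κ' → K) :=
    Matrix.mulVecLin (Matrix.of fun x => G (ε (Sum.map id Sum.inr x)))
  have hQ : ∀ i x, Q (H i) x = if ε (Sum.map id Sum.inr x) = i then 1 else 0 := fun i x => by
    have := congr_fun (congr_fun hGH (ε (Sum.map id Sum.inr x))) i
    rw [Matrix.one_apply] at this
    exact this
  refine ⟨_, _, Q, _, mul_ne_zero hc (det_ne_zero_of_mul_transpose hGH), key, ?_⟩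
  obtain ⟨r, hr⟩ : ∃ r : I → I → K, ∀ i, r i = H i := ⟨H, fun _ => rfl⟩
  have hli : LinearIndependent K r := (funext hr : r = H) ▸ Matrix.linearIndependent_rows_iff_isUnit.2
    ((Matrix.isUnit_iff_isUnit_det H).2 (isUnit_iff_ne_zero.2 (det_ne_zero_of_mul_transpose hHG)))
  obtain ⟨b, hb⟩ : ∃ b : Basis I K (I → K), ∀ i, b i = H i :=
    ⟨@basisOfPiSpaceOfLinearIndependent K _ I _ (Classical.propDecidable _) r hli, fun i => by
      rw [coe_basisOfPiSpaceOfLinearIndependent hli, hr]⟩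
  refine Basis.ext_alternating b fun f _ => ?_
  simp only [hb, AlternatingMap.compLinearMap_apply, fixLeft_apply]
  -- If a basis vector inserted in β already occurs in z, the contraction has a repeated argument,
  -- while Q sends that vector to zero.
  by_cases hf : ∃ k g, f k = ε (Sum.inr (Sum.inl g))
  · obtain ⟨k, g, hk⟩ := hf
    rw [β.map_eq_zero_of_eq _ (i := Sum.inl g) (j := Sum.inr k)]
    · have hzero : Q (H (f k)) = 0 := by
        ext x
        rw [hQ, if_neg]
        · rfl
        · rw [hk]
          cases x <;> simp
      rw [β.map_coord_zero (Sum.inr k)]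
      rw [Sum.elim_inr, hzero, map_zero]
    · simp [hk, hH]
    · simp
  · have hfk : ∀ k, ∃ x : ι ⊕ κ', f k = ε (Sum.map id Sum.inr x) := fun k => by
      obtain ⟨y, hy⟩ := ε.surjective (f k)
      rcases y with y | y | y
      · exact ⟨Sum.inl y, hy.symm⟩
      · exact absurd ⟨k, y, hy.symm⟩ hf
      · exact ⟨Sum.inr y, hy.symm⟩
    congr 1
    ext1 x
    cases x with
    | inl x => rfl
    | inr k =>
      obtain ⟨y, hy⟩ := hfk k
      have hinj : Function.Injective (Sum.map id Sum.inr : ι ⊕ κ' → ι ⊕ (γ ⊕ κ')) :=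
        Function.injective_id.sumMap Sum.inr_injective
      have hQk : Q (H (f k)) = Pi.single y 1 := by
        ext x
        rw [hQ, hy, Pi.single_apply]
        simp [hinj.eq_iff]
      rw [Sum.elim_inr, Sum.elim_inr, hQk, hy]
      simp [Fintype.linearCombination_apply_single]

/-- The Hodge dual of the restriction to a subspace is a restriction of a contraction of the Hodge
dual. -/
theorem HodgeRel.exists_compLinearMap {c : K} (hc : c ≠ 0) {ε : ι ⊕ (γ ⊕ κ') ≃ I} {α : Alt K ι I}
    {β : Alt K (γ ⊕ κ') I} (h : HodgeRel c ε α β) (L : (ι ⊕ κ' → K) →ₗ[K] (I → K))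
    (hL : Function.Injective L) :
    ∃ (z : γ → I → K) (L' : (ι ⊕ κ' → K) →ₗ[K] (I → K)) (c' : K), c' ≠ 0 ∧
      HodgeRel c' (Equiv.refl _) (α.compLinearMap L) ((fixLeft β z).compLinearMap L') := by
  have hli : LinearIndependent K fun x : ι ⊕ κ' => L (Pi.single x 1) := by
    have := (Pi.basisFun K (ι ⊕ κ')).linearIndependent.map' L (LinearMap.ker_eq_bot.2 hL)
    simpa [Function.comp_def] using this
  obtain ⟨G, H, hG, hGH⟩ := exists_matrix_extending hli
    (e := fun x : ι ⊕ κ' => ε (Sum.map id Sum.inr x))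
    (ε.injective.comp (Function.injective_id.sumMap Sum.inr_injective))
  have key := h.restrict hGH
  have hLG : Fintype.linearCombination K (fun x => G (ε (Sum.map id Sum.inr x))) = L := by
    refine (Pi.basisFun K (ι ⊕ κ')).ext fun x => ?_
    simp [Fintype.linearCombination_apply_single, hG]
  rw [hLG] at key
  exact ⟨_, _, _, mul_ne_zero hc (det_ne_zero_of_mul_transpose hGH), key⟩

end Contraction

/-! ### Plücker varieties are closed under contraction -/

section FixLeftMem

variable {K : Type u} [Field K] {P : PluckerVariety K} {γ ι κ κ' I J : Type} [Fintype γ]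
  [Fintype ι] [Fintype κ] [Fintype κ'] [Fintype I] [Fintype J]

/-- If some instance is nonempty, then all instances contain zero. -/
theorem PluckerVariety.zero_mem_forms {α : Alt K ι I} (h : α ∈ P.forms ι I) :
    (0 : Alt K κ J) ∈ P.forms κ J := by
  classical
  have mem_self : ∀ {ι0 I0 : Type} [Fintype ι0] [Fintype I0] [Nonempty ι0] (α : Alt K ι0 I0)
      {J : Type} [Fintype J], α ∈ P.forms ι0 I0 → (0 : Alt K ι0 J) ∈ P.forms ι0 J := by
    intro ι0 I0 _ _ ⟨i⟩ α J _ hα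
    have h1 := compLinearMap_mem_forms hα (0 : (J → K) →ₗ[K] (I0 → K))
    have h2 : α.compLinearMap (0 : (J → K) →ₗ[K] (I0 → K)) = 0 := by
      ext v
      rw [AlternatingMap.compLinearMap_apply]
      exact α.map_coord_zero i (by simp)
    rwa [h2] at h1
  have mem_all : ∀ {ι0 I0 : Type} [Fintype ι0] [Fintype I0] [Nonempty ι0] (α : Alt K ι0 I0),
      α ∈ P.forms ι0 I0 → (0 : Alt K κ J) ∈ P.forms κ J := by
    intro ι0 I0 _ _ _ α hα
    have h1 := mem_self α (J := ι0 ⊕ κ) hα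
    have h2 := (HodgeRel.zero (K := K) (c := 1) (ε := Equiv.refl (ι0 ⊕ κ))).mem_forms
      one_ne_zero h1
    have h3 := compLinearMap_mem_forms h2 (0 : (J → K) →ₗ[K] (ι0 ⊕ κ → K))
    have h4 : (0 : Alt K κ (ι0 ⊕ κ)).compLinearMap (0 : (J → K) →ₗ[K] (ι0 ⊕ κ → K)) = 0 := by
      ext v; simp
    rwa [h4] at h3
  rcases isEmpty_or_nonempty ι with hι | hι
  · have h1 := compLinearMap_mem_forms h (0 : (Unit → K) →ₗ[K] (I → K))
    obtain ⟨β, _, hβ⟩ := P.exists_hodgeRel (Equiv.emptySum ι Unit) one_ne_zero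
      (α.compLinearMap (0 : (Unit → K) →ₗ[K] (I → K)))
    exact mem_all β (hβ h1)
  · exact mem_all α h

/-- For independent z the contraction is a pullback of the Hodge dual of a restriction of the Hodge
dual, each step staying in the variety. For dependent z it is zero. -/
theorem PluckerVariety.fixLeft_mem_forms {α : Alt K (γ ⊕ ι) I} (h : α ∈ P.forms (γ ⊕ ι) I)
    (z : γ → I → K) : fixLeft α z ∈ P.forms ι I := by
  classical
  by_cases hz : LinearIndependent K z
  · rcases lt_or_ge (Fintype.card I) (Fintype.card (γ ⊕ ι)) with hlt | hle
    · rw [Alt.eq_zero_of_card_lt (α := α) hlt] at h ⊢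
      have : fixLeft (0 : Alt K (γ ⊕ ι) I) z = 0 := rfl
      rw [this]
      exact zero_mem_forms h
    · let ε : Fin (Fintype.card I - Fintype.card (γ ⊕ ι)) ⊕ (γ ⊕ ι) ≃ I :=
        Fintype.equivOfCardEq (by rw [Fintype.card_sum, Fintype.card_fin]; omega)
      obtain ⟨β, h1, h2⟩ := P.exists_hodgeRel ((Equiv.sumComm _ _).trans ε) one_ne_zero α
      have h3 := h1.symm one_ne_zero
      have h4' : HodgeRel 1⁻¹ ε β α := by
        convert h3 using 1
        ext x
        simp
      obtain ⟨L, β', Q, c', hc', h4, h5⟩ := HodgeRel.exists_fixLeft_eq (inv_ne_zero one_ne_zero)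
        (ε := ε) h4' hz
      rw [h5]
      exact compLinearMap_mem_forms (h4.mem_forms hc' (compLinearMap_mem_forms (h2 h) L)) Q
  · rw [fixLeft_eq_zero hz]
    exact zero_mem_forms h

end FixLeftMem

end

end Plucker

namespace Plucker

open Module

noncomputable section

/-! ### Polynomial families of alternating forms -/

section Poly

variable {K : Type u} [Field K] {W : Type*} [AddCommGroup W] [Module K W] {ι κ I J : Type}
  [Fintype ι] [Fintype I] [Fintype J]

theorem apply_mem_polyFun {α : W → Alt K ι I} {v : W → ι → I → K} [DecidableEq I]
    (hα : ∀ g, (fun w => coord g (α w)) ∈ polyFun K W)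
    (hv : ∀ i x, (fun w => v w i x) ∈ polyFun K W) : (fun w => α w (v w)) ∈ polyFun K W := by
  classical
  have : (fun w => α w (v w)) = ∑ g : ι → I, (∏ i, fun w => v w i (g i)) *
      fun w => coord g (α w) := by
    ext w
    have h1 : v w = fun i => ∑ x, v w i x • (Pi.single x 1 : I → K) := by
      ext i x
      simp [Finset.sum_apply, Pi.single_apply]
    conv_lhs => rw [h1]
    rw [← AlternatingMap.coe_multilinearMap, MultilinearMap.map_sum]
    simp [MultilinearMap.map_smul_univ, coord]
  rw [this]
  exact Subalgebra.sum_mem _ fun g _ => Subalgebra.mul_mem _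
    (Subalgebra.prod_mem _ fun i _ => hv i _) (hα g)

theorem const_mem_polyFun (c : K) : (fun _ : W => c) ∈ polyFun K W :=
  (polyFun K W).algebraMap_mem c

theorem isPolyMap_alt [DecidableEq I] {α : W → Alt K ι I}
    (h : ∀ g, (fun w => coord g (α w)) ∈ polyFun K W) : IsPolyMap (K := K) α := by
  let T : Alt K ι I →ₗ[K] ((ι → I) → K) :=
    { toFun := fun α g => coord g α, map_add' := fun _ _ => rfl, map_smul' := fun _ _ => rfl }
  have hT : LinearMap.ker T = ⊥ := by
    refine LinearMap.ker_eq_bot'.2 fun α hα => Basis.ext_alternating (Pi.basisFun K I)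
      fun g _ => ?_
    have h1 : coord g α = 0 := congr_fun hα g
    simpa [coord] using h1
  obtain ⟨S, hS⟩ := T.exists_leftInverse_of_injective hT
  have h1 : IsPolyMap (K := K) fun w => T (α w) :=
    isPolyMap_pi (E := fun _ => K) fun g => isPolyMap_scalar (h g)
  have h2 := h1.linear_comp S
  have h3 : (fun w => S (T (α w))) = α := funext fun w => LinearMap.congr_fun hS (α w)
  rwa [h3] at h2

theorem linearCombination_mem_polyFun {y : W → J → I → K}
    (hy : ∀ j x, (fun w => y w j x) ∈ polyFun K W) (v : J → K) (x : I) :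
    (fun w => Fintype.linearCombination K (y w) v x) ∈ polyFun K W := by
  have : (fun w => Fintype.linearCombination K (y w) v x) = ∑ j, v j • fun w => y w j x := by
    ext w
    simp [Fintype.linearCombination_apply]
  rw [this]
  exact Subalgebra.sum_mem _ fun j _ => Subalgebra.smul_mem _ (hy j x) _

/-- Pulling back a form along a varying linear map is polynomial in the linear map. -/
theorem isPolyMap_compLinearMap (α : Alt K ι I) :
    IsPolyMap (K := K) fun y : J → I → K => α.compLinearMap (Fintype.linearCombination K y) := by
  classical
  refine isPolyMap_alt fun g => ?_
  exact apply_mem_polyFun (α := fun _ => α) (fun g => const_mem_polyFun _) fun i x =>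
    linearCombination_mem_polyFun (fun j x => isLinearMap_mem_polyFun ⟨fun _ _ => rfl, fun _ _ => rfl⟩)
      _ x

/-- There is a polynomial on families of vectors, not identically zero, whose nonvanishing implies
linear independence. -/
theorem exists_polyFun_injective [DecidableEq J] (h : Fintype.card J ≤ Fintype.card I) :
    ∃ f ∈ polyFun K (J → I → K), (∃ y, f y ≠ 0) ∧
      ∀ y, f y ≠ 0 → Function.Injective (Fintype.linearCombination K y) := by
  classical
  obtain ⟨e⟩ := Function.Embedding.nonempty_of_card_le h
  refine ⟨fun y => Matrix.det (Matrix.of fun i j => y i (e j)),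
    det_mem_polyFun fun i j => isLinearMap_mem_polyFun ⟨fun _ _ => rfl, fun _ _ => rfl⟩,
    ⟨fun j => Pi.single (e j) 1, ?_⟩, fun y hy => ?_⟩
  · have : (Matrix.of fun i j => (Pi.single (e i) 1 : I → K) (e j)) = (1 : Matrix J J K) := by
      ext i j
      simp [Pi.single_apply, Matrix.one_apply, eq_comm]
    change (Matrix.of fun i j => (Pi.single (e i) 1 : I → K) (e j)).det ≠ 0
    rw [this]
    simp
  · rw [← linearIndependent_iff_injective_fintypeLinearCombination]
    have h1 : LinearIndependent K fun i => (Matrix.of fun i j => y i (e j)) i :=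
      Matrix.linearIndependent_rows_iff_isUnit.2
        ((Matrix.isUnit_iff_isUnit_det _).2 (isUnit_iff_ne_zero.2 hy))
    exact h1.of_comp (LinearMap.funLeft K K e)

theorem eq_linearCombination [DecidableEq J] (L : (J → K) →ₗ[K] (I → K)) :
    Fintype.linearCombination K (fun j => L (Pi.single j 1)) = L := by
  refine (Pi.basisFun K J).ext fun x => ?_
  simp [Fintype.linearCombination_apply_single]

/-- If the pullback of a form along some linear map lies outside a closed set, then so does the
pullback along some injective linear map. -/
theorem ZClosed.exists_injective_notMem [Infinite K] {X : Set (Alt K ι J)} (hX : ZClosed (K := K) X)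
    (hIJ : Fintype.card J ≤ Fintype.card I) {α : Alt K ι I} {L : (J → K) →ₗ[K] (I → K)}
    (h : α.compLinearMap L ∉ X) :
    ∃ L' : (J → K) →ₗ[K] (I → K), Function.Injective L' ∧ α.compLinearMap L' ∉ X := by
  classical
  obtain ⟨f, hf, hf1, hf2⟩ := exists_polyFun_injective (K := K) hIJ
  obtain ⟨g, hg, hg1, hg2⟩ := (hX.preimage (isPolyMap_compLinearMap (J := J) α))
    (fun j => L (Pi.single j 1)) (by
      change α.compLinearMap (Fintype.linearCombination K _) ∉ X
      rwa [eq_linearCombination])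
  obtain ⟨y, hy1, hy2⟩ := polyFun_exists_ne_zero_and hf hg hf1 ⟨_, hg2⟩
  exact ⟨_, hf2 y hy1, fun hmem => hy2 (hg1 y hmem)⟩

end Poly

/-! ### Small minors -/

section SmallMinor

variable {K : Type u} [Field K] {P : PluckerVariety K} {N : ℕ} {γ ι κ κ' I J : Type}
  [Fintype γ] [Fintype ι] [Fintype κ] [Fintype κ'] [Fintype I] [Fintype J]

/-- Some minor of bounded size of the form is not in the Plücker variety. -/
def HasSmallMinor (P : PluckerVariety K) (N : ℕ) (α : Alt K ι I) : Prop :=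
  ∃ c p : ℕ, p ≤ N ∧ ∃ (e : ι ≃ Fin c ⊕ Fin p) (z : Fin c → I → K) (L : (Fin N → K) →ₗ[K] (I → K)),
    (fixLeft (α.domDomCongr e) z).compLinearMap L ∉ P.forms (Fin p) (Fin N)

theorem exists_linearMap_leftInverse (h : Fintype.card J ≤ Fintype.card I) :
    ∃ (i : (J → K) →ₗ[K] (I → K)) (q : (I → K) →ₗ[K] (J → K)), q ∘ₗ i = LinearMap.id := by
  classical
  obtain ⟨e⟩ := Function.Embedding.nonempty_of_card_le h
  have hinj : Function.Injective (Fintype.linearCombination K fun j => (Pi.single (e j) 1 : I → K)) := by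
    rw [← linearIndependent_iff_injective_fintypeLinearCombination]
    simpa [Function.comp_def] using (Pi.basisFun K I).linearIndependent.comp e e.injective
  obtain ⟨q, hq⟩ := LinearMap.exists_leftInverse_of_injective _ (LinearMap.ker_eq_bot.2 hinj)
  exact ⟨_, q, hq⟩

/-- Any index sets of size at most N may be used: the coordinate space on J is a retract of K^N, so
nonmembership persists after composing with the retraction. -/
theorem HasSmallMinor.intro {α : Alt K ι I} (e : ι ≃ γ ⊕ κ) (hκ : Fintype.card κ ≤ N)
    (hJ : Fintype.card J ≤ N) (z : γ → I → K) (L : (J → K) →ₗ[K] (I → K))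
    (h : (fixLeft (α.domDomCongr e) z).compLinearMap L ∉ P.forms κ J) : HasSmallMinor P N α := by
  obtain ⟨i, q, hq⟩ := exists_linearMap_leftInverse (K := K) (J := J) (I := Fin N) (by simpa)
  let f := Fintype.equivFin γ
  let g := Fintype.equivFin κ
  refine ⟨_, _, hκ, e.trans (Equiv.sumCongr f g), fun x => z (f.symm x), L ∘ₗ q, fun hmem => h ?_⟩
  have h1 := PluckerVariety.compLinearMap_mem_forms hmem i
  rw [compLinearMap_compLinearMap, LinearMap.comp_assoc, hq, LinearMap.comp_id] at h1
  rw [← PluckerVariety.domDomCongr_mem_forms g]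
  convert h1 using 1
  ext v
  simp only [AlternatingMap.domDomCongr_apply, AlternatingMap.compLinearMap_apply, fixLeft_apply]
  congr 1
  ext1 x
  rcases hx : e x with y | y <;> simp [hx]

theorem HasSmallMinor.of_compLinearMap {α : Alt K ι I} {L : (J → K) →ₗ[K] (I → K)}
    (h : HasSmallMinor P N (α.compLinearMap L)) : HasSmallMinor P N α := by
  obtain ⟨c, p, hp, e, z, L', h⟩ := h
  refine ⟨c, p, hp, e, fun x => L (z x), L ∘ₗ L', fun hmem => h ?_⟩
  have h1 : (α.compLinearMap L).domDomCongr e = (α.domDomCongr e).compLinearMap L := rfl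
  rw [h1, fixLeft_compLinearMap]
  exact hmem

/-- If zero is missing somewhere then the variety is empty, and contracting all the arguments
already gives a small minor. -/
theorem HasSmallMinor.of_forms_eq_empty {α : Alt K ι I} (h : (0 : Alt K κ J) ∉ P.forms κ J) :
    HasSmallMinor P N α := by
  refine .intro (γ := ι) (κ := Empty) (J := Empty) (Equiv.sumEmpty ι Empty).symm (by simp) (by simp)
    0 0 fun hmem => h (PluckerVariety.zero_mem_forms hmem)

variable [Infinite K] [DecidableEq I] {c : K} {ε : ι ⊕ κ ≃ I} {α : Alt K ι I} {β : Alt K κ I}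

/-- If the whole space has dimension at most N, then α is its own small minor. Otherwise L may be
taken injective, and the Hodge dual of the restriction of β to an N-dimensional subspace is a
restricted contraction of α with N - p arguments left. -/
theorem HasSmallMinor.of_hodgeRel_of_notMem [DecidableEq ι] {p : ℕ} (hp : p ≤ N)
    (hc : c ≠ 0) {α : Alt K ι (ι ⊕ Fin p)}
    {β : Alt K (Fin p) (ι ⊕ Fin p)} (h : HodgeRel c (Equiv.refl _) α β)
    (L : (Fin N → K) →ₗ[K] (ι ⊕ Fin p → K)) (hL : β.compLinearMap L ∉ P.forms (Fin p) (Fin N)) :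
    HasSmallMinor P N α := by
  rcases le_or_gt (Fintype.card (ι ⊕ Fin p)) N with hle | hlt
  · refine .intro (Equiv.emptySum Empty ι).symm ?_ hle (fun x => x.elim) LinearMap.id fun hmem =>
      hL (PluckerVariety.compLinearMap_mem_forms (h.mem_forms hc ?_) L)
    · simp only [Fintype.card_sum, Fintype.card_fin] at hle
      omega
    · convert hmem
      ext v
      simp only [AlternatingMap.compLinearMap_apply, fixLeft_apply, AlternatingMap.domDomCongr_apply]
      rfl
  · let J := Fin p ⊕ Fin (N - p)
    let f : J ≃ Fin N := finSumFinEquiv.trans (finCongr (by omega))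
    let LJ : (J → K) →ₗ[K] (Fin N → K) := LinearMap.funLeft K K f.symm
    have hLJ : LJ ∘ₗ LinearMap.funLeft K K f = LinearMap.id := by
      ext; simp [LJ]
    obtain ⟨L', hL', hL''⟩ := (P.zClosed_forms (ι := Fin p) (I := J)).exists_injective_notMem
      (by simp only [Fintype.card_sum, Fintype.card_fin, J] at hlt ⊢; omega)
      (α := β) (L := L ∘ₗ LJ) (fun hmem => hL (by
        have := PluckerVariety.compLinearMap_mem_forms hmem (LinearMap.funLeft K K f)
        rwa [compLinearMap_compLinearMap, LinearMap.comp_assoc, hLJ, LinearMap.comp_id] at this))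
    simp only [Fintype.card_sum, Fintype.card_fin] at hlt
    let g : ι ≃ Fin (Fintype.card ι + p - N) ⊕ Fin (N - p) :=
      Fintype.equivOfCardEq (by simp only [Fintype.card_sum, Fintype.card_fin]; omega)
    have h2 := (h.symm hc).congr (Equiv.refl _) g.symm
    have h3 : β.domDomCongr (Equiv.refl (Fin p)).symm = β := by ext v; rfl
    rw [h3] at h2
    obtain ⟨z, L2, c', hc', h4⟩ := h2.exists_compLinearMap (inv_ne_zero hc) L' hL'
    refine .intro g (by simp) (by simp; omega) z L2 fun hmem =>
      hL'' ((h4.mem_forms_iff hc').2 hmem)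

/-- Small minors outside a Plücker variety are inherited along Hodge duality. -/
theorem HasSmallMinor.of_hodgeRel (hc : c ≠ 0) (h : HodgeRel c ε α β) (hβ : HasSmallMinor P N β) :
    HasSmallMinor P N α := by
  classical
  obtain ⟨m, p, hp, e, z, L, hL⟩ := hβ
  by_cases hz : LinearIndependent K z
  · have h1 := h.congr (Equiv.refl ι) e.symm
    have h3 : α.domDomCongr (Equiv.refl ι).symm = α := by ext v; rfl
    rw [h3] at h1
    obtain ⟨L0, β', Q, c', hc', h4, h5⟩ := h1.exists_fixLeft_eq hc hz
    rw [Equiv.symm_symm] at h5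
    rw [h5, compLinearMap_compLinearMap] at hL
    exact (HasSmallMinor.of_hodgeRel_of_notMem hp hc' h4 _ hL).of_compLinearMap
  · rw [fixLeft_eq_zero hz] at hL
    exact .of_forms_eq_empty hL

end SmallMinor

end

end Plucker

namespace Plucker

open Module

noncomputable section

/-! ### The Hodge dual as a linear map -/

section Hodge

variable {K : Type u} [Field K]

/-- The Plücker variety consisting of everything. -/
def PluckerVariety.univ (K : Type u) [Field K] : PluckerVariety K where
  X _ _ := Set.univ
  isClosed _ _ := ⟨∅, by simp⟩
  map_mem := by intros; trivial
  hodge_mem := by intros; trivial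

variable {ι κ I : Type} [Fintype ι] [Fintype κ] [Fintype I] [DecidableEq I]

variable (K) in
/-- The Hodge dual normalized on dual bases of determinant one. -/
def hodge (ε : ι ⊕ κ ≃ I) : Alt K ι I →ₗ[K] Alt K κ I :=
  have h := fun α => ((PluckerVariety.univ K).exists_hodgeRel ε one_ne_zero α).choose_spec.1
  { toFun := fun α => ((PluckerVariety.univ K).exists_hodgeRel ε one_ne_zero α).choose
    map_add' := fun α α' => (h (α + α')).unique one_ne_zero fun G H hGH => by
      rw [AlternatingMap.add_apply, h α G H hGH, h α' G H hGH, AlternatingMap.add_apply, mul_add]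
    map_smul' := fun a α => (h (a • α)).unique one_ne_zero fun G H hGH => by
      rw [AlternatingMap.smul_apply, h α G H hGH, RingHom.id_apply, AlternatingMap.smul_apply]
      simp only [smul_eq_mul]
      ring }

variable {ε : ι ⊕ κ ≃ I} {c : K} {α : Alt K ι I} {β : Alt K κ I} {P : PluckerVariety K}

theorem hodgeRel_hodge (ε : ι ⊕ κ ≃ I) (α : Alt K ι I) : HodgeRel 1 ε α (hodge K ε α) :=
  ((PluckerVariety.univ K).exists_hodgeRel ε one_ne_zero α).choose_spec.1

theorem HodgeRel.hodge_eq (h : HodgeRel c ε α β) : hodge K ε α = c • β :=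
  (hodgeRel_hodge ε α).unique one_ne_zero (HodgeRel.smul_right (by rwa [one_mul]))

theorem hodge_mem_forms_iff : hodge K ε α ∈ P.forms κ I ↔ α ∈ P.forms ι I :=
  ((hodgeRel_hodge ε α).mem_forms_iff one_ne_zero).symm

theorem hodge_hodge (ε : ι ⊕ κ ≃ I) (α : Alt K ι I) :
    hodge K ((Equiv.sumComm κ ι).trans ε) (hodge K ε α) = α := by
  rw [((hodgeRel_hodge ε α).symm one_ne_zero).hodge_eq, inv_one, one_smul]

theorem hodge_hodge' (ε : ι ⊕ κ ≃ I) (β : Alt K κ I) :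
    hodge K ε (hodge K ((Equiv.sumComm κ ι).trans ε) β) = β := by
  have := hodge_hodge ((Equiv.sumComm κ ι).trans ε) β
  convert this using 3
  ext x
  simp

end Hodge

/-! ### Rank conditions -/

section Rank

variable {K : Type u} [Field K] {γ ι κ I J : Type}

/-- The alternating bilinear form `θ` has rank less than `m`. -/
def PairLT (m : ℕ) (θ : Alt K (Fin 2) I) : Prop :=
  ∀ X Y : Fin m → I → K, (Matrix.of fun i j => θ ![X i, Y j]).det = 0

theorem PairLT.compLinearMap {m : ℕ} {θ : Alt K (Fin 2) I} (h : PairLT m θ)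
    (L : (J → K) →ₗ[K] (I → K)) : PairLT m (θ.compLinearMap L) := fun X Y => by
  have h1 := h (fun i => L (X i)) fun i => L (Y i)
  have h2 : ∀ i j, θ.compLinearMap L ![X i, Y j] = θ ![L (X i), L (Y j)] := fun i j => by
    rw [AlternatingMap.compLinearMap_apply]
    congr 1
    ext1 k
    fin_cases k <;> rfl
  simpa only [h2] using h1

theorem PairLT.smul {m : ℕ} {θ : Alt K (Fin 2) I} (h : PairLT m θ) (c : K) :
    PairLT m (c • θ) := fun X Y => by
  have : (Matrix.of fun i j => (c • θ) ![X i, Y j]) = c • Matrix.of fun i j => θ ![X i, Y j] := by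
    ext i j; simp
  rw [this, Matrix.det_smul, h, mul_zero]

theorem pairLT_zero {m : ℕ} : PairLT (m + 1) (0 : Alt K (Fin 2) I) := fun X Y => by
  have : (Matrix.of fun i j => (0 : Alt K (Fin 2) I) ![X i, Y j]) = 0 := by ext i j; simp
  rw [this, Matrix.det_zero]

/-- All contractions of `α` to alternating bilinear forms have rank less than `m`. -/
def RankLT (m : ℕ) (α : Alt K (γ ⊕ Fin 2) I) : Prop :=
  ∀ z, PairLT m (fixLeft α z)

theorem RankLT.compLinearMap {m : ℕ} {α : Alt K (γ ⊕ Fin 2) I} (h : RankLT m α)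
    (L : (J → K) →ₗ[K] (I → K)) : RankLT m (α.compLinearMap L) := fun z => by
  rw [fixLeft_compLinearMap]
  exact (h _).compLinearMap L

variable [Fintype ι] [DecidableEq ι] [Fintype γ] [DecidableEq γ] [Fintype I] [DecidableEq I]

/-- The Hodge duals of all restrictions of `α` to subspaces of codegree two have rank less than
`m`. -/
def DualRankLT (m : ℕ) (α : Alt K ι I) : Prop :=
  ∀ L : (ι ⊕ Fin 2 → K) →ₗ[K] (I → K), PairLT m (hodge K (Equiv.refl _) (α.compLinearMap L))

theorem DualRankLT.compLinearMap {m : ℕ} {α : Alt K ι I} (h : DualRankLT m α) [Fintype J]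
    [DecidableEq J] (L : (J → K) →ₗ[K] (I → K)) : DualRankLT m (α.compLinearMap L) :=
  fun L' => h (L ∘ₗ L')

/-- Together with the converse below, this expresses the rank of the Hodge dual through α alone, by
a condition that visibly passes to pullbacks. Contractions of β are pulled back from Hodge duals of
restrictions of α. -/
theorem DualRankLT.rankLT {m : ℕ} {c : K} (hc : c ≠ 0) {ε : ι ⊕ (γ ⊕ Fin 2) ≃ I} {α : Alt K ι I}
    {β : Alt K (γ ⊕ Fin 2) I} (h : HodgeRel c ε α β) (hα : DualRankLT (m + 1) α) :
    RankLT (m + 1) β := fun z => by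
  by_cases hz : LinearIndependent K z
  · obtain ⟨L, β', Q, c', hc', h1, h2⟩ := h.exists_fixLeft_eq hc hz
    rw [h2]
    refine PairLT.compLinearMap ?_ Q
    have h3 := (hα L).smul c'⁻¹
    rwa [h1.hodge_eq, smul_smul, inv_mul_cancel₀ hc', one_smul] at h3
  · rw [fixLeft_eq_zero hz]
    exact pairLT_zero

theorem RankLT.dualRankLT [Infinite K] {m : ℕ} {c : K} (hc : c ≠ 0) {ε : ι ⊕ (γ ⊕ Fin 2) ≃ I}
    {α : Alt K ι I} {β : Alt K (γ ⊕ Fin 2) I} (h : HodgeRel c ε α β) (hβ : RankLT m β) :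
    DualRankLT m α := fun L X Y => by
  have hcard : Fintype.card (ι ⊕ Fin 2) ≤ Fintype.card I := by
    rw [← Fintype.card_congr ε]
    simp only [Fintype.card_sum]
    omega
  obtain ⟨f, hf, hf1, hf2⟩ := exists_polyFun_injective (K := K) hcard
  rw [← eq_linearCombination L]
  -- The minor is polynomial in the vectors defining L, so injective L suffice. For these, the Hodge
  -- dual of the restriction of α is a restricted contraction of β.
  refine polyFun_eq_zero_of_dense (f := fun y : ι ⊕ Fin 2 → I → K => (Matrix.of fun i j =>
    hodge K (Equiv.refl _) (α.compLinearMap (Fintype.linearCombination K y)) ![X i, Y j]).det)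
    (det_mem_polyFun fun i j => ?_) hf hf1 (fun y hy => ?_) _
  · exact (isPolyMap_compLinearMap (J := ι ⊕ Fin 2) α).linear_comp
      (hodge K (Equiv.refl (ι ⊕ Fin 2)))
      { toFun := fun θ => θ ![X i, Y j], map_add' := fun _ _ => rfl,
        map_smul' := fun _ _ => rfl }
  · obtain ⟨z, L', c', hc', h1⟩ := h.exists_compLinearMap hc _ (hf2 y hy)
    rw [h1.hodge_eq]
    exact ((hβ z).compLinearMap L').smul c' X Y

end Rank

/-! ### Forms of large rank -/

section LargeRank

variable {K : Type u} [Field K] {P : PluckerVariety K} {γ I : Type}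

/-- An alternating form of large rank pulls back to any alternating form. -/
theorem exists_compLinearMap_eq [Finite I] {m k : ℕ} {θ : Alt K (Fin 2) I} (h : ¬ PairLT m θ)
    (hm : 2 * k ≤ m) (η : Alt K (Fin 2) (Fin k)) :
    ∃ L : (Fin k → K) →ₗ[K] (I → K), θ.compLinearMap L = η := by
  classical
  have hu0 : ∀ a b c : I → K, Function.update ![a, b] 0 c = ![c, b] := fun a b c => by
    ext1 i
    fin_cases i <;> rfl
  have hu1 : ∀ a b c : I → K, Function.update ![a, b] 1 c = ![a, c] := fun a b c => by
    ext1 i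
    fin_cases i <;> rfl
  let B : (I → K) →ₗ[K] Dual K (I → K) := LinearMap.mk₂ K (fun x y => θ ![x, y])
    (fun x x' y => by simpa only [hu0] using θ.map_update_add ![0, y] 0 x x')
    (fun c x y => by simpa only [hu0] using θ.map_update_smul ![0, y] 0 c x)
    (fun x y y' => by simpa only [hu1] using θ.map_update_add ![x, 0] 1 y y')
    (fun c x y => by simpa only [hu1] using θ.map_update_smul ![x, 0] 1 c y)
  have hB : ∀ x y, B x y = θ ![x, y] := fun x y => rfl
  have hskew : ∀ (J : Type) (ξ : Alt K (Fin 2) J) x y, ξ ![x, y] = - ξ ![y, x] := fun J ξ x y => by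
    have := ξ.map_swap ![y, x] (i := 0) (j := 1) (by decide)
    rw [← this]
    congr 1
    ext1 i
    fin_cases i <;> rfl
  have hrank : m ≤ finrank K (LinearMap.range B) := by
    simp only [PairLT, not_forall] at h
    obtain ⟨X, Y, hXY⟩ := h
    have hli : LinearIndependent K fun i => B (X i) := by
      have h1 := Matrix.linearIndependent_rows_iff_isUnit.2
        ((Matrix.isUnit_iff_isUnit_det _).2 (isUnit_iff_ne_zero.2 hXY))
      let T : Dual K (I → K) →ₗ[K] (Fin m → K) := LinearMap.pi fun j => LinearMap.applyₗ (Y j)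
      exact LinearIndependent.of_comp T h1
    have h2 := finrank_span_eq_card hli
    rw [Fintype.card_fin] at h2
    rw [← h2]
    refine Submodule.finrank_mono (Submodule.span_le.2 ?_)
    rintro _ ⟨i, rfl⟩
    exact ⟨X i, rfl⟩
  -- The vectors are found one by one. Independence of the functionals `B (v i)` is carried along
  -- because it allows the values against the next vector to be prescribed freely.
  have key : ∀ s, s ≤ k → ∃ v : ℕ → I → K, (LinearIndependent K fun i : Fin s => B (v i)) ∧
      ∀ i j : Fin k, (i : ℕ) < s → (j : ℕ) < s →
        θ ![v i, v j] = η ![Pi.single i 1, Pi.single j 1] := by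
    intro s
    induction s with
    | zero => exact fun _ => ⟨0, linearIndependent_empty_type, by simp⟩
    | succ s ih =>
      intro hs
      obtain ⟨v, hv1, hv2⟩ := ih (by omega)
      let U : (I → K) →ₗ[K] (Fin s → K) := LinearMap.pi fun i => B (v i)
      have hU : Function.Surjective U := by
        rw [← LinearMap.range_eq_top]
        by_contra hne
        obtain ⟨f, hf, hle⟩ := Submodule.exists_le_ker_of_lt_top _ (lt_top_iff_ne_top.2 hne)
        refine hf (LinearMap.pi_ext' fun i => LinearMap.ext_ring ?_)
        refine Fintype.linearIndependent_iff.1 hv1 (fun i => f (Pi.single i 1))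
          (LinearMap.ext fun x => ?_) i
        have h1 : f (U x) = 0 := hle ⟨x, rfl⟩
        rw [← Finset.univ_sum_single (U x), map_sum] at h1
        rw [LinearMap.zero_apply, ← h1, LinearMap.sum_apply]
        refine Finset.sum_congr rfl fun i _ => ?_
        rw [LinearMap.smul_apply, smul_eq_mul, mul_comm, ← smul_eq_mul, ← map_smul, ← Pi.single_smul,
          smul_eq_mul, mul_one]
        rfl
      obtain ⟨x, hx⟩ := hU fun i =>
        η ![Pi.single (⟨i, by omega⟩ : Fin k) 1, Pi.single (⟨s, by omega⟩ : Fin k) 1]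
      -- If no choice kept the functionals independent, B would map the kernel of U into a space of
      -- dimension at most s. Its rank would then be at most 2 s < 2 k ≤ m.
      obtain ⟨x', hx', hx''⟩ : ∃ x', U x' = U x ∧
          B x' ∉ Submodule.span K (Set.range fun i : Fin s => B (v i)) := by
        by_contra! hcon
        have h1 := finrank_range_le_restrict B U
        have h2 : LinearMap.range (B.domRestrict (LinearMap.ker U)) ≤
            Submodule.span K (Set.range fun i : Fin s => B (v i)) := by
          rintro _ ⟨⟨w, hw⟩, rfl⟩
          have h3 := hcon (x + w) (by rw [map_add, LinearMap.mem_ker.1 hw, add_zero])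
          have h4 := hcon x rfl
          rw [map_add] at h3
          exact (Submodule.add_mem_iff_right _ h4).1 h3
        have h5 := Submodule.finrank_mono h2
        have h6 := finrank_range_le_card (R := K) fun i : Fin s => B (v i)
        simp only [Set.finrank, Fintype.card_fin, finrank_fin_fun] at h6 h1
        omega
      have hxe : ∀ i (hi : i < s), θ ![v i, x'] =
          η ![Pi.single (⟨i, by omega⟩ : Fin k) 1, Pi.single (⟨s, by omega⟩ : Fin k) 1] :=
        fun i hi => congr_fun (hx'.trans hx) ⟨i, hi⟩
      have hself : ∀ (J : Type) (ξ : Alt K (Fin 2) J) x, ξ ![x, x] = 0 := fun J ξ x =>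
        ξ.map_eq_zero_of_eq _ (i := 0) (j := 1) rfl (by decide)
      refine ⟨Function.update v s x', ?_, fun i j hi hj => ?_⟩
      · have h7 : LinearIndependent K (Fin.snoc (α := fun _ => Dual K (I → K))
            (fun i : Fin s => B (v i)) (B x')) :=
          hv1.finSnoc hx''
        convert h7 using 1
        ext1 i
        refine Fin.lastCases ?_ (fun i => ?_) i
        · simp
        · simp [Function.update_of_ne i.2.ne]
      · rcases Nat.lt_succ_iff_lt_or_eq.1 hi with hi | hi <;>
          rcases Nat.lt_succ_iff_lt_or_eq.1 hj with hj | hj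
        · rw [Function.update_of_ne hi.ne, Function.update_of_ne hj.ne]
          exact hv2 i j hi hj
        · rw [Function.update_of_ne hi.ne, hj, Function.update_self, hxe i hi]
          congr 4
          exact Fin.ext hj.symm
        · rw [Function.update_of_ne hj.ne, hi, Function.update_self, hskew, hxe j hj, ← hskew]
          congr 3
          exact Fin.ext hi.symm
        · obtain rfl : i = j := Fin.ext (hi.trans hj.symm)
          rw [hself, hself]
  obtain ⟨v, -, hv⟩ := key k le_rfl
  refine ⟨Fintype.linearCombination K fun i : Fin k => v i, Basis.ext_alternating
    (Pi.basisFun K (Fin k)) fun f _ => ?_⟩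
  have h1 := hv (f 0) (f 1) (f 0).2 (f 1).2
  convert h1 using 1
  · rw [AlternatingMap.compLinearMap_apply]
    congr 1
    ext1 i
    fin_cases i <;> simp [Fintype.linearCombination_apply_single]
  · congr 1
    ext1 i
    fin_cases i <;> simp

theorem PluckerVariety.IsBounded.exists_notMem_forms (hP : P.IsBounded) :
    ∃ (k : ℕ) (η : Alt K (Fin 2) (Fin k)), η ∉ P.forms (Fin 2) (Fin k) := by
  obtain ⟨V, _, _, _, hV⟩ := hP
  obtain ⟨ω, hω⟩ := (Set.ne_univ_iff_exists_notMem _).1 hV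
  have hfr : finrank K V = finrank K (Dual K (Fin (finrank K V) → K)) := by
    rw [Subspace.dual_finrank_eq]; simp
  let e := LinearEquiv.ofFinrankEq V (Dual K (Fin (finrank K V) → K)) hfr
  refine ⟨finrank K V, toForm K _ 2 (exteriorPower.map 2 e.toLinearMap ω), fun hmem => hω ?_⟩
  rw [PluckerVariety.toForm_mem_forms] at hmem
  have h1 := P.map_mem _ _ _ e.symm.toLinearMap _ hmem
  have h2 : exteriorPower.map 2 e.symm.toLinearMap (exteriorPower.map 2 e.toLinearMap ω) = ω := by
    rw [← LinearMap.comp_apply, ← exteriorPower.map_comp, e.symm_comp, exteriorPower.map_id]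
    rfl
  rwa [h2] at h1

/-- A contraction of rank at least 2 k pulls back to the form η outside the variety; that minor has
two arguments and lives on K^k, whence the bound max 2 k. -/
theorem PluckerVariety.IsBounded.exists_rankLT (hP : P.IsBounded) :
    ∃ m N : ℕ, ∀ (γ I : Type) [Fintype γ] [Fintype I] (α : Alt K (γ ⊕ Fin 2) I),
      ¬ RankLT m α → HasSmallMinor P N α := by
  obtain ⟨k, η, hη⟩ := hP.exists_notMem_forms
  refine ⟨2 * k, max 2 k, fun γ I _ _ α hα => ?_⟩
  simp only [RankLT, not_forall] at hα
  obtain ⟨z, hz⟩ := hα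
  obtain ⟨L, hL⟩ := exists_compLinearMap_eq hz le_rfl η
  refine .intro (Equiv.refl _) (by simp) (by simp) z L ?_
  have h1 : α.domDomCongr (Equiv.refl _) = α := by ext v; rfl
  rwa [h1, hL]

end LargeRank

end

end Plucker

namespace Plucker

open Module

noncomputable section

/-! ### Expressing coordinates through fewer coordinates when the rank is bounded -/

section Pivot

variable {K : Type u} [Field K] {Ω : Type*}

/-- Families of polynomials whose coefficients lie in a given algebra of functions. -/
def coeffSubalgebra (C : Subalgebra K (Ω → K)) : Subalgebra K (Ω → Polynomial K) where
  carrier := {f | ∀ n, (fun ω => (f ω).coeff n) ∈ C}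
  mul_mem' {f g} hf hg n := by
    have : (fun ω => ((f * g) ω).coeff n) = ∑ x ∈ Finset.HasAntidiagonal.antidiagonal n,
        (fun ω => (f ω).coeff x.1) * fun ω => (g ω).coeff x.2 := by
      ext ω
      simp [Polynomial.coeff_mul]
    rw [this]
    exact C.sum_mem fun x _ => C.mul_mem (hf _) (hg _)
  add_mem' {f g} hf hg n := by
    have := C.add_mem (hf n) (hg n)
    convert this using 1
    ext ω
    simp
  algebraMap_mem' r n := by
    have : (fun ω => ((algebraMap K (Ω → Polynomial K) r) ω).coeff n) =
        algebraMap K (Ω → K) (if n = 0 then r else 0) := by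
      ext ω
      simp [Polynomial.coeff_C]
    rw [this]
    exact C.algebraMap_mem _

theorem monomial_mem_coeffSubalgebra {C : Subalgebra K (Ω → K)} {c : Ω → K} (hc : c ∈ C) (k : ℕ) :
    (fun ω => Polynomial.monomial k (c ω)) ∈ coeffSubalgebra C := fun n => by
  by_cases h : k = n
  · convert hc using 2
    simp [h]
  · convert C.zero_mem using 1
    ext ω
    simp [Polynomial.coeff_monomial, h]

/-- Division as for power series: the inverse of the constant term of p lies in C, so the
coefficients of f are found recursively. -/
theorem mem_coeffSubalgebra_of_mul {C : Subalgebra K (Ω → K)} {f p : Ω → Polynomial K}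
    (hp : p ∈ coeffSubalgebra C) (hfp : f * p ∈ coeffSubalgebra C)
    (h0 : ∀ ω, (p ω).coeff 0 ≠ 0) (hinv : (fun ω => ((p ω).coeff 0)⁻¹) ∈ C) :
    f ∈ coeffSubalgebra C := fun n => by
  induction n using Nat.strong_induction_on with
  | _ n ih =>
  have : (fun ω => (f ω).coeff n) = ((fun ω => ((f * p) ω).coeff n) -
      ∑ k ∈ Finset.range n, (fun ω => (f ω).coeff k) * fun ω => (p ω).coeff (n - k)) *
      fun ω => ((p ω).coeff 0)⁻¹ := by
    ext ω
    simp only [Pi.mul_apply, Pi.sub_apply, Finset.sum_apply, Polynomial.coeff_mul]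
    rw [Finset.Nat.sum_antidiagonal_eq_sum_range_succ_mk, Finset.sum_range_succ, Nat.sub_self,
      add_sub_cancel_left, mul_assoc, mul_inv_cancel₀ (h0 ω), mul_one]
  rw [this]
  exact C.mul_mem (C.sub_mem (hfp n) (C.sum_mem fun k hk =>
    C.mul_mem (ih k (Finset.mem_range.1 hk)) (hp _))) hinv

theorem det_mem_coeffSubalgebra {ι : Type*} [Fintype ι] [DecidableEq ι] {C : Subalgebra K (Ω → K)}
    {M : Ω → Matrix ι ι (Polynomial K)}
    (hM : ∀ i j, (fun ω => M ω i j) ∈ coeffSubalgebra C) :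
    (fun ω => (M ω).det) ∈ coeffSubalgebra C := by
  have : (fun ω => (M ω).det) = ∑ σ : Equiv.Perm ι, (Equiv.Perm.sign σ : ℤ) •
      ∏ i, fun ω => M ω (σ i) i := by
    ext1 ω
    simp [Matrix.det_apply, Units.smul_def]
  rw [this]
  exact Subalgebra.sum_mem _ fun σ _ => zsmul_mem (Subalgebra.prod_mem _ fun i _ => hM _ _) _

theorem det_fromBlocks_corner {R : Type*} [CommRing R] {ι : Type*} [Fintype ι] [DecidableEq ι]
    (P : Matrix ι ι R) (q : Matrix ι (Fin 1) R) (r : Matrix (Fin 1) ι R) (b : R) :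
    (Matrix.fromBlocks P q r (Matrix.of fun _ _ => b)).det =
      (Matrix.fromBlocks P q r 0).det + b * P.det := by
  have h1 : (Matrix.fromBlocks P q r (Matrix.of fun _ _ => b)) =
      (Matrix.fromBlocks P q r 0).updateRow (Sum.inr 0)
        ((Matrix.fromBlocks P q r 0) (Sum.inr 0) + Sum.elim (fun _ => 0) fun _ => b) := by
    ext i j
    rcases i with i | i
    · simp [Matrix.updateRow_apply]
      rcases j with j | j <;> simp
    · obtain rfl := Subsingleton.elim i 0
      rcases j with j | j <;> simp [Matrix.updateRow_apply]
  have h2 : (Matrix.fromBlocks P q r 0).updateRow (Sum.inr 0) (Sum.elim (fun _ => 0) fun _ => b) =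
      Matrix.fromBlocks P q 0 (Matrix.of fun _ _ => b) := by
    ext i j
    rcases i with i | i
    · simp [Matrix.updateRow_apply]
      rcases j with j | j <;> simp
    · obtain rfl := Subsingleton.elim i 0
      rcases j with j | j <;> simp [Matrix.updateRow_apply]
  rw [h1, Matrix.det_updateRow_add, Matrix.updateRow_eq_self, h2, Matrix.det_fromBlocks_zero₂₁]
  simp [mul_comm]

variable {γ I : Type} [Fintype γ] [DecidableEq γ] [DecidableEq I]

/-- The values of a form along a line of families of basis vectors, as a polynomial. -/
def linePoly (α : Alt K (γ ⊕ Fin 2) I) (u v : γ → I) (p q : I) : Polynomial K :=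
  ∑ S : Finset γ, Polynomial.monomial S.card (coord (Sum.elim (S.piecewise v u) ![p, q]) α)

theorem eval_linePoly (α : Alt K (γ ⊕ Fin 2) I) (u v : γ → I) (p q : I) (t : K) :
    (linePoly α u v p q).eval t =
      fixLeft α (fun k => Pi.single (u k) 1 + t • Pi.single (v k) 1)
        ![Pi.single p 1, Pi.single q 1] := by
  let F : Alt K γ I := fixLeft (α.domDomCongr (Equiv.sumComm γ (Fin 2)))
    ![Pi.single p 1, Pi.single q 1]
  have hF : ∀ w, F w = fixLeft α w ![Pi.single p 1, Pi.single q 1] := fun w => by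
    simp only [F, fixLeft_apply, AlternatingMap.domDomCongr_apply]
    congr 1
    ext1 x
    rcases x with x | x <;> rfl
  rw [← hF]
  have h1 : (fun k => (Pi.single (u k) 1 : I → K) + t • Pi.single (v k) 1) =
      (fun k => t • Pi.single (v k) 1) + fun k => Pi.single (u k) 1 := by
    ext1 k
    simp [add_comm]
  rw [h1, ← AlternatingMap.coe_multilinearMap, MultilinearMap.map_add_univ, linePoly,
    Polynomial.eval_finsetSum]
  refine Finset.sum_congr rfl fun S _ => ?_
  rw [Polynomial.eval_monomial]
  have h2 : S.piecewise (fun k => t • (Pi.single (v k) 1 : I → K)) (fun k => Pi.single (u k) 1) =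
      S.piecewise (fun k => t • (Pi.single (S.piecewise v u k) 1 : I → K))
        (fun k => Pi.single (S.piecewise v u k) 1) := by
    ext1 k
    by_cases hk : k ∈ S <;> simp [hk]
  rw [h2, MultilinearMap.map_piecewise_smul, Finset.prod_const, AlternatingMap.coe_multilinearMap,
    hF, smul_eq_mul, mul_comm, fixLeft_apply, coord]
  congr 2
  ext1 x
  rcases x with x | x
  · rfl
  · fin_cases x <;> rfl

theorem linePoly_mem_coeffSubalgebra {C : Subalgebra K (Ω → K)} {a : Ω → Alt K (γ ⊕ Fin 2) I}
    {u v : γ → I} {p q : I}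
    (h : ∀ w : γ → I, (∀ k, w k = u k ∨ w k = v k) →
      (fun ω => coord (Sum.elim w ![p, q]) (a ω)) ∈ C) :
    (fun ω => linePoly (a ω) u v p q) ∈ coeffSubalgebra C := by
  have : (fun ω => linePoly (a ω) u v p q) = ∑ S : Finset γ, fun ω =>
      Polynomial.monomial S.card (coord (Sum.elim (S.piecewise v u) ![p, q]) (a ω)) := by
    ext1 ω
    simp [linePoly]
  rw [this]
  refine Subalgebra.sum_mem _ fun S _ => monomial_mem_coeffSubalgebra (h _ fun k => ?_) _
  by_cases hk : k ∈ S <;> simp [hk]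

theorem coeff_linePoly_card (α : Alt K (γ ⊕ Fin 2) I) (u v : γ → I) (p q : I) :
    (linePoly α u v p q).coeff (Fintype.card γ) = coord (Sum.elim v ![p, q]) α := by
  rw [linePoly, Polynomial.finsetSum_coeff, Finset.sum_eq_single Finset.univ]
  · simp
  · intro S _ hS
    rw [Polynomial.coeff_monomial, if_neg]
    rwa [Ne, ← Finset.card_eq_iff_eq_univ] at hS
  · simp

theorem coeff_linePoly_zero (α : Alt K (γ ⊕ Fin 2) I) (u v : γ → I) (p q : I) :
    (linePoly α u v p q).coeff 0 = coord (Sum.elim u ![p, q]) α := by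
  rw [linePoly, Polynomial.finsetSum_coeff, Finset.sum_eq_single ∅]
  · simp
  · intro S _ hS
    rw [Polynomial.coeff_monomial, if_neg]
    rwa [Finset.card_eq_zero]
  · simp

/-- The pivot minor of a form of bounded rank. -/
def pivot {r : ℕ} (u : γ → I) (x y : Fin r → I) (α : Alt K (γ ⊕ Fin 2) I) : K :=
  (Matrix.of fun i j => coord (Sum.elim u ![x i, y j]) α).det

/-- Contract with e_u + t e_v, where v is the first part of g. The rank bound makes the pivot block
bordered by one more row and column singular for every t, a linear equation over K[t] for the corner
entry. Its coefficient det M(t) has the pivot as constant term, so the equation can be solved; the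
coordinate at g is the top coefficient of the corner entry. -/
theorem coord_mem_of_pivot [Infinite K] {r : ℕ} {a : Ω → Alt K (γ ⊕ Fin 2) I}
    (ha : ∀ ω, RankLT (r + 1) (a ω)) {C : Subalgebra K (Ω → K)} {u : γ → I} {x y : Fin r → I}
    (hinv : (fun ω => (pivot u x y (a ω))⁻¹) ∈ C) (h0 : ∀ ω, pivot u x y (a ω) ≠ 0)
    {g : γ ⊕ Fin 2 → I}
    (h : ∀ w : γ → I, (∀ k, w k = u k ∨ w k = g (Sum.inl k)) →
      (∀ i j, (fun ω => coord (Sum.elim w ![x i, y j]) (a ω)) ∈ C) ∧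
      (∀ i, (fun ω => coord (Sum.elim w ![x i, g (Sum.inr 1)]) (a ω)) ∈ C) ∧
      ∀ j, (fun ω => coord (Sum.elim w ![g (Sum.inr 0), y j]) (a ω)) ∈ C) :
    (fun ω => coord g (a ω)) ∈ C := by
  let v : γ → I := fun k => g (Sum.inl k)
  let p := g (Sum.inr 0)
  let q := g (Sum.inr 1)
  let M (ω : Ω) : Matrix (Fin r) (Fin r) (Polynomial K) :=
    Matrix.of fun i j => linePoly (a ω) u v (x i) (y j)
  let s (ω : Ω) : Matrix (Fin r) (Fin 1) (Polynomial K) :=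
    Matrix.of fun i _ => linePoly (a ω) u v (x i) q
  let t (ω : Ω) : Matrix (Fin 1) (Fin r) (Polynomial K) :=
    Matrix.of fun _ j => linePoly (a ω) u v p (y j)
  have hM : ∀ i j, (fun ω => M ω i j) ∈ coeffSubalgebra C := fun i j =>
    linePoly_mem_coeffSubalgebra fun w hw => (h w hw).1 i j
  have hMdet := det_mem_coeffSubalgebra hM
  have hM0 : ∀ ω, (M ω).det.coeff 0 = pivot u x y (a ω) := fun ω => by
    rw [← Polynomial.constantCoeff_apply, RingHom.map_det, pivot]
    congr 1
    ext i j
    simp [M, coeff_linePoly_zero]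
  have hN : (fun ω => (Matrix.fromBlocks (M ω) (s ω) (t ω) 0).det) ∈ coeffSubalgebra C := by
    refine det_mem_coeffSubalgebra fun i j => ?_
    rcases i with i | i <;> rcases j with j | j
    · exact hM i j
    · exact linePoly_mem_coeffSubalgebra fun w hw => (h w hw).2.1 i
    · exact linePoly_mem_coeffSubalgebra fun w hw => (h w hw).2.2 j
    · exact Subalgebra.zero_mem _
  have key : ∀ ω, (Matrix.fromBlocks (M ω) (s ω) (t ω)
      (Matrix.of fun _ _ => linePoly (a ω) u v p q)).det = 0 := fun ω => by
    refine Polynomial.funext fun τ => ?_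
    rw [← Polynomial.coe_evalRingHom, RingHom.map_det, map_zero]
    have h1 := ha ω (fun k => Pi.single (u k) 1 + τ • Pi.single (v k) 1)
      (fun i => Pi.single (Sum.elim x (fun _ => p) (finSumFinEquiv.symm i)) 1)
      (fun i => Pi.single (Sum.elim y (fun _ => q) (finSumFinEquiv.symm i)) 1)
    rw [← Matrix.det_submatrix_equiv_self finSumFinEquiv] at h1
    rw [← h1]
    congr 1
    ext i j
    rcases i with i | i <;> rcases j with j | j <;>
      simp only [M, s, t, RingHom.mapMatrix_apply, Matrix.map_apply, Matrix.fromBlocks_apply₁₁,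
        Matrix.fromBlocks_apply₁₂, Matrix.fromBlocks_apply₂₁, Matrix.fromBlocks_apply₂₂,
        Matrix.of_apply, Matrix.submatrix_apply, Equiv.symm_apply_apply, Sum.elim_inl,
        Sum.elim_inr, Polynomial.coe_evalRingHom, eval_linePoly]
  have hb : (fun ω => linePoly (a ω) u v p q) ∈ coeffSubalgebra C := by
    refine mem_coeffSubalgebra_of_mul hMdet ?_ (fun ω => by rw [hM0]; exact h0 ω)
      (by simpa only [hM0] using hinv)
    -- Expanding the vanishing bordered determinant in its corner isolates the corner entry; the
    -- rest involves only entries whose coefficients are in C by hypothesis.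
    have : ((fun ω => linePoly (a ω) u v p q) * fun ω => (M ω).det) =
        -fun ω => (Matrix.fromBlocks (M ω) (s ω) (t ω) 0).det := by
      ext1 ω
      have := key ω
      rw [det_fromBlocks_corner] at this
      exact eq_neg_of_add_eq_zero_right this
    rw [this]
    exact neg_mem hN
  have h2 := hb (Fintype.card γ)
  simp only [coeff_linePoly_card] at h2
  have h3 : Sum.elim v ![p, q] = g := by
    ext1 x
    rcases x with x | x
    · rfl
    · fin_cases x <;> rfl
  rwa [h3] at h2

end Pivot

end

end Plucker

namespace Plucker

open Module

noncomputable section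

/-! ### Reserved positions, and coordinates with at least two nonstandard indices -/

section Padded

variable {K : Type u} [Field K] {A B I : Type} {R : ℕ}

/-- The positions reserved for the pivots. -/
abbrev Pad (R : ℕ) : Type := (Fin R ⊕ Fin R) ⊕ Fin 2

/-- Singling out the last two arguments of a form. -/
def splitPair (α : Alt K (A ⊕ Pad R) I) : Alt K ((A ⊕ (Fin R ⊕ Fin R)) ⊕ Fin 2) I :=
  α.domDomCongr (Equiv.sumAssoc A (Fin R ⊕ Fin R) (Fin 2)).symm

variable [DecidableEq I]

theorem coord_comp_perm {ι : Type} [Fintype ι] [DecidableEq ι] (α : Alt K ι I) (g : ι → I)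
    (σ : Equiv.Perm ι) : coord (fun i => g (σ i)) α = (Equiv.Perm.sign σ : ℤ) * coord g α := by
  have := α.map_perm (fun i => Pi.single (g i) 1) σ
  rw [coord, coord]
  rw [Units.smul_def, zsmul_eq_mul] at this
  exact this

theorem coord_eq_zero {ι : Type} {α : Alt K ι I} {g : ι → I} (h : ¬ Function.Injective g) :
    coord g α = 0 := by
  simp only [Function.Injective, not_forall] at h
  obtain ⟨i, j, hij, hne⟩ := h
  exact α.map_eq_zero_of_eq _ (by simp [hij]) hne

theorem sign_cast_ne_zero {ι : Type} [Fintype ι] [DecidableEq ι] (σ : Equiv.Perm ι) :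
    ((Equiv.Perm.sign σ : ℤ) : K) ≠ 0 := by
  rcases Int.units_eq_one_or (Equiv.Perm.sign σ) with h | h <;> simp [h]

variable [Fintype A] [Fintype B] [DecidableEq A]

/-- The pivot minor at the standard position. -/
def padPivot {r : ℕ} (hr : r ≤ R) (ε : (A ⊕ Pad R) ⊕ (B ⊕ Pad R) ≃ I)
    (α : Alt K (A ⊕ Pad R) I) : K :=
  pivot (fun k => ε (Sum.inl (Sum.map id Sum.inl k)))
    (fun i : Fin r => ε (Sum.inr (Sum.inr (Sum.inl (Sum.inl (Fin.castLE hr i))))))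
    (fun j : Fin r => ε (Sum.inr (Sum.inr (Sum.inl (Sum.inr (Fin.castLE hr j)))))) (splitPair α)

/-- The number of standard positions missing from `g`. -/
def miss (ε : (A ⊕ Pad R) ⊕ (B ⊕ Pad R) ≃ I) (g : A ⊕ Pad R → I) : ℕ :=
  {a : A | ε (Sum.inl (Sum.inl a)) ∉ Set.range g}.ncard

/-- The number of nonstandard positions in `g`. -/
def extra (ε : (A ⊕ Pad R) ⊕ (B ⊕ Pad R) ≃ I) (g : A ⊕ Pad R → I) : ℕ :=
  {b : B | ε (Sum.inr (Sum.inl b)) ∈ Set.range g}.ncard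

/-- Reorder the arguments so that two nonstandard indices come last and each standard index
occurring in g sits in its own slot. In every coordinate used by the pivot lemma those slots keep
their standard indices, so no new index is missing. At least one of the two nonstandard indices
gives way to a reserved position, so their number drops. -/
theorem coord_mem_of_two_le_extra [Infinite K] {Ω : Type*} {a : Ω → Alt K (A ⊕ Pad R) I}
    {C : Subalgebra K (Ω → K)} {r : ℕ} (hr : r ≤ R) {ε : (A ⊕ Pad R) ⊕ (B ⊕ Pad R) ≃ I}
    (ha : ∀ ω, RankLT (r + 1) (splitPair (a ω))) (h0 : ∀ ω, padPivot hr ε (a ω) ≠ 0)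
    (hinv : (fun ω => (padPivot hr ε (a ω))⁻¹) ∈ C) {g : A ⊕ Pad R → I}
    (hg : Function.Injective g) (hg2 : 2 ≤ extra ε g)
    (ih : ∀ g' : A ⊕ Pad R → I, miss ε g' ≤ miss ε g → extra ε g' < extra ε g →
      (fun ω => coord g' (a ω)) ∈ C) :
    (fun ω => coord g (a ω)) ∈ C := by
  classical
  obtain ⟨b₀, ⟨k₀, hk₀⟩, b₁, ⟨k₁, hk₁⟩, hb⟩ := (Set.one_lt_ncard (Set.toFinite _)).1 hg2
  let X := {a : A // ε (Sum.inl (Sum.inl a)) ∈ Set.range g} ⊕ Fin 2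
  let f : X → A ⊕ Pad R := Sum.elim (fun a => Sum.inl a.1) fun s => Sum.inr (Sum.inr s)
  let pre : X → A ⊕ Pad R := Sum.elim (fun a => a.2.choose) ![k₀, k₁]
  have hf : Function.Injective f := by
    rintro (x | x) (y | y) h <;> simp [f] at h
    · exact congr_arg Sum.inl (Subtype.ext h)
    · exact congr_arg Sum.inr h
  have hpre : ∀ x, g (pre x) = Sum.elim (fun a : {a : A // ε (Sum.inl (Sum.inl a)) ∈ Set.range g} =>
      ε (Sum.inl (Sum.inl a.1))) (fun s => ε (Sum.inr (Sum.inl (![b₀, b₁] s)))) x := by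
    rintro (x | x)
    · exact x.2.choose_spec
    · fin_cases x
      · exact hk₀
      · exact hk₁
  have hpi : Function.Injective pre := by
    intro x y hxy
    have h1 := congr_arg g hxy
    rw [hpre, hpre] at h1
    rcases x with x | x <;> rcases y with y | y
    · exact congr_arg Sum.inl (Subtype.ext (by simpa using h1))
    · simp at h1
    · simp at h1
    · fin_cases x <;> fin_cases y <;> simp [hb, hb.symm] at h1 ⊢
  obtain ⟨σ, hσ⟩ := exists_perm_comp_eq hf hpi
  suffices h : (fun ω => coord (fun i => g (σ i)) (a ω)) ∈ C by
    have h1 : (fun ω => coord g (a ω)) =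
        ((Equiv.Perm.sign σ : ℤ) : K)⁻¹ • fun ω => coord (fun i => g (σ i)) (a ω) := by
      ext ω
      rw [Pi.smul_apply, coord_comp_perm, smul_eq_mul, ← mul_assoc,
        inv_mul_cancel₀ (sign_cast_ne_zero σ), one_mul]
    rw [h1]
    exact C.smul_mem h _
  let g' : (A ⊕ (Fin R ⊕ Fin R)) ⊕ Fin 2 → I := fun k => g (σ (Equiv.sumAssoc _ _ _ k))
  have hg' : Function.Injective g' :=
    hg.comp (σ.injective.comp (Equiv.injective _))
  have hrange : Set.range g' = Set.range g := by
    rw [show g' = g ∘ ((Equiv.sumAssoc _ _ _).trans σ) from rfl, EquivLike.range_comp]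
  have hgA : ∀ a : A, ε (Sum.inl (Sum.inl a)) ∈ Set.range g →
      g' (Sum.inl (Sum.inl a)) = ε (Sum.inl (Sum.inl a)) := fun a ha =>
    (congr_arg g (hσ (Sum.inl ⟨a, ha⟩))).trans (hpre (Sum.inl ⟨a, ha⟩))
  have hg0 : g' (Sum.inr 0) = ε (Sum.inr (Sum.inl b₀)) :=
    (congr_arg g (hσ (Sum.inr 0))).trans (hpre (Sum.inr 0))
  have hg1 : g' (Sum.inr 1) = ε (Sum.inr (Sum.inl b₁)) :=
    (congr_arg g (hσ (Sum.inr 1))).trans (hpre (Sum.inr 1))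
  have main : ∀ (w : A ⊕ (Fin R ⊕ Fin R) → I) (p q : I),
      (∀ k, w k = ε (Sum.inl (Sum.map id Sum.inl k)) ∨ w k = g' (Sum.inl k)) →
      ((∀ b, ε (Sum.inr (Sum.inl b)) ≠ p) ∨ p = g' (Sum.inr 0)) →
      ((∀ b, ε (Sum.inr (Sum.inl b)) ≠ q) ∨ q = g' (Sum.inr 1)) →
      ((∀ b, ε (Sum.inr (Sum.inl b)) ≠ p) ∨ (∀ b, ε (Sum.inr (Sum.inl b)) ≠ q)) →
      (fun ω => coord (Sum.elim w ![p, q]) (splitPair (a ω))) ∈ C := by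
    -- Nonstandard indices in w can only come from g', since the alternative choices are standard or
    -- reserved.
    intro w p q hw hp hq hpq
    have hwB : ∀ k b, ε (Sum.inr (Sum.inl b)) = w k → w k = g' (Sum.inl k) := fun k b hb => by
      refine (hw k).resolve_left fun h => ?_
      rw [h] at hb
      simpa using ε.injective hb
    have hcoord : ∀ ω, coord (Sum.elim w ![p, q]) (splitPair (a ω)) =
        coord (fun k => Sum.elim w ![p, q] ((Equiv.sumAssoc _ _ _).symm k)) (a ω) := fun ω => rfl
    have hr' : Set.range (fun k => Sum.elim w ![p, q] ((Equiv.sumAssoc _ _ _).symm k)) =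
        Set.range w ∪ {p, q} := by
      have := EquivLike.range_comp (Sum.elim w ![p, q])
        (Equiv.sumAssoc A (Fin R ⊕ Fin R) (Fin 2)).symm
      rw [Function.comp_def] at this
      rw [this, Set.Sum.elim_range]
      congr 1
      simp [Set.pair_comm]
    simp only [hcoord]
    refine ih _ (Set.ncard_le_ncard (fun a ha' hmem => ha' ?_) (Set.toFinite _))
      (Set.ncard_lt_ncard ⟨fun b hb' => ?_, fun hsub => ?_⟩ (Set.toFinite _))
    · rw [hr']
      refine Or.inl ⟨Sum.inl a, ?_⟩
      rcases hw (Sum.inl a) with h | h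
      · exact h
      · rw [h, hgA a hmem]
    · rw [Set.mem_ofPred_eq, hr'] at hb'
      rw [Set.mem_ofPred_eq, ← hrange]
      rcases hb' with ⟨k, hk⟩ | h | h
      · rw [← hk, hwB k b hk.symm]
        exact ⟨_, rfl⟩
      · rw [h, hp.resolve_left fun h' => h' b h]
        exact ⟨_, rfl⟩
      · rw [Set.mem_singleton_iff.1 h, hq.resolve_left fun h' => h' b h]
        exact ⟨_, rfl⟩
    · rcases hpq with hp' | hq'
      · have h1 := hsub (a := b₀) ⟨k₀, hk₀⟩
        rw [Set.mem_ofPred_eq, hr'] at h1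
        rcases h1 with ⟨k, hk⟩ | h | h
        · have h2 := hwB k b₀ hk.symm
          rw [hk, ← hg0] at h2
          simpa using hg' h2
        · exact hp' _ h
        · have h2 := hq.resolve_left fun h' => h' b₀ h
          rw [← (Set.mem_singleton_iff.1 h), ← hg0] at h2
          simpa using hg' h2
      · have h1 := hsub (a := b₁) ⟨k₁, hk₁⟩
        rw [Set.mem_ofPred_eq, hr'] at h1
        rcases h1 with ⟨k, hk⟩ | h | h
        · have h2 := hwB k b₁ hk.symm
          rw [hk, ← hg1] at h2
          simpa using hg' h2
        · have h2 := hp.resolve_left fun h' => h' b₁ h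
          rw [← h, ← hg1] at h2
          simpa using hg' h2
        · exact hq' _ h
  have hx : ∀ (e : Pad R) b, ε (Sum.inr (Sum.inl b)) ≠ ε (Sum.inr (Sum.inr e)) :=
    fun e b h => by simpa using ε.injective h
  have := coord_mem_of_pivot ha hinv h0 (g := g') fun w hw =>
    ⟨fun i j => main w _ _ hw (Or.inl (hx _)) (Or.inl (hx _)) (Or.inl (hx _)),
      fun i => main w _ _ hw (Or.inl (hx _)) (Or.inr rfl) (Or.inl (hx _)),
      fun j => main w _ _ hw (Or.inr rfl) (Or.inl (hx _)) (Or.inr (hx _))⟩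
  have hcoord : ∀ ω, coord g' (splitPair (a ω)) = coord (fun i => g (σ i)) (a ω) := fun ω => by
    change coord (fun k => g' ((Equiv.sumAssoc _ _ _).symm k)) (a ω) = _
    congr 1
    ext1 k
    simp [g']
  simpa only [hcoord] using this

end Padded

/-! ### Using the Hodge dual to reach the coordinates near the standard position -/

section TwoSided

variable {K : Type u} [Field K] {A B : Type} {R : ℕ} [Fintype A] [Fintype B] [DecidableEq A]
  [DecidableEq B]

/-- The index set of the coordinate space of a chart. -/
abbrev ChartIndex (A B : Type) (R : ℕ) : Type := (A ⊕ Pad R) ⊕ (B ⊕ Pad R)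

theorem coord_hodge {ι κ : Type} [Fintype ι] [Fintype κ] [DecidableEq ι] [DecidableEq κ]
    (α : Alt K ι (ι ⊕ κ)) (σ : Equiv.Perm (ι ⊕ κ)) :
    coord (fun j => σ (Sum.inr j)) (hodge K (Equiv.refl (ι ⊕ κ)) α) =
      (Equiv.Perm.sign σ : ℤ) * coord (fun i => σ (Sum.inl i)) α := by
  have h := (hodgeRel_hodge (Equiv.refl (ι ⊕ κ)) α).coord_eq σ
  simp only [Equiv.refl_apply, one_mul] at h
  rw [h, ← mul_assoc]
  have : ((Equiv.Perm.sign σ : ℤ) : K) * (Equiv.Perm.sign σ : ℤ) = 1 := by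
    rw [← Int.cast_mul, ← Units.val_mul, Int.units_mul_self]
    simp
  rw [this, one_mul]

theorem mem_range_inr_iff {ι κ : Type} (σ : Equiv.Perm (ι ⊕ κ)) (x : ι ⊕ κ) :
    x ∈ Set.range (fun j : κ => σ (Sum.inr j)) ↔ x ∉ Set.range fun i : ι => σ (Sum.inl i) := by
  obtain ⟨y, rfl⟩ := σ.surjective x
  rcases y with y | y <;> simp

/-- If the ranks of a form and of its Hodge dual are bounded, then all coordinates are expressed
through those close to the standard position. -/
theorem coord_mem_of_near [Infinite K] {Ω : Type*} {a : Ω → Alt K (A ⊕ Pad R) (ChartIndex A B R)}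
    {C : Subalgebra K (Ω → K)} {r s : ℕ} (hr : r ≤ R) (hs : s ≤ R)
    (ha : ∀ ω, RankLT (r + 1) (splitPair (a ω)))
    (h0 : ∀ ω, padPivot hr (Equiv.refl _) (a ω) ≠ 0)
    (hinv : (fun ω => (padPivot hr (Equiv.refl _) (a ω))⁻¹) ∈ C)
    (ha' : ∀ ω, RankLT (s + 1) (splitPair (hodge K (Equiv.refl (ChartIndex A B R)) (a ω))))
    (h0' : ∀ ω, padPivot hs (Equiv.sumComm _ _)
      (hodge K (Equiv.refl (ChartIndex A B R)) (a ω)) ≠ 0)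
    (hinv' : (fun ω => (padPivot hs (Equiv.sumComm _ _)
      (hodge K (Equiv.refl (ChartIndex A B R)) (a ω)))⁻¹) ∈ C)
    (hnear : ∀ g : A ⊕ Pad R → ChartIndex A B R, Function.Injective g →
      miss (Equiv.refl (ChartIndex A B R)) g ≤ 1 → extra (Equiv.refl (ChartIndex A B R)) g ≤ 1 →
      (fun ω => coord g (a ω)) ∈ C) (g : A ⊕ Pad R → ChartIndex A B R) :
    (fun ω => coord g (a ω)) ∈ C := by
  have hzero : ∀ {g : A ⊕ Pad R → ChartIndex A B R}, ¬ Function.Injective g →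
      (fun ω => coord g (a ω)) ∈ C := fun hg => by
    simp only [coord_eq_zero hg]
    exact C.zero_mem
  have hmiss : ∀ σ : Equiv.Perm (ChartIndex A B R),
      miss (Equiv.sumComm _ _) (fun j => σ (Sum.inr j)) =
        extra (Equiv.refl _) fun i => σ (Sum.inl i) := fun σ => by
    simp only [miss, extra, mem_range_inr_iff, not_not]
    rfl
  have hextra : ∀ σ : Equiv.Perm (ChartIndex A B R),
      extra (Equiv.sumComm _ _) (fun j => σ (Sum.inr j)) =
        miss (Equiv.refl _) fun i => σ (Sum.inl i) := fun σ => by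
    simp only [miss, extra, mem_range_inr_iff]
    rfl
  have hdual : ∀ σ : Equiv.Perm (ChartIndex A B R),
      (fun ω => coord (fun j => σ (Sum.inr j)) (hodge K (Equiv.refl _) (a ω))) ∈ C ↔
        (fun ω => coord (fun j => σ (Sum.inl j)) (a ω)) ∈ C := fun σ => by
    have h1 : (fun ω => coord (fun j => σ (Sum.inr j)) (hodge K (Equiv.refl _) (a ω))) =
        ((Equiv.Perm.sign σ : ℤ) : K) • fun ω => coord (fun j => σ (Sum.inl j)) (a ω) := by
      ext1 ω
      exact coord_hodge (a ω) σ
    rw [h1]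
    refine ⟨fun h => ?_, fun h => C.smul_mem h _⟩
    have h2 := C.smul_mem h ((Equiv.Perm.sign σ : ℤ) : K)⁻¹
    rwa [smul_smul, inv_mul_cancel₀ (sign_cast_ne_zero σ), one_smul] at h2
  suffices h : ∀ n (g : A ⊕ Pad R → ChartIndex A B R),
      miss (Equiv.refl (ChartIndex A B R)) g + extra (Equiv.refl (ChartIndex A B R)) g = n →
      (fun ω => coord g (a ω)) ∈ C from h _ g rfl
  intro n
  -- Induction on the number of missing plus nonstandard indices. Duality passes to the
  -- complementary index set and exchanges the two numbers, so the reduction is applied to the form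
  -- or to its dual according to which number is at least two.
  induction n using Nat.strong_induction_on with
  | _ n ih =>
  rintro g rfl
  by_cases hg : Function.Injective g
  · rcases le_or_gt 2 (extra (Equiv.refl (ChartIndex A B R)) g) with h2 | h2
    · exact coord_mem_of_two_le_extra hr ha h0 hinv hg h2 fun g' h3 h4 =>
        ih _ (add_lt_add_of_le_of_lt h3 h4) g' rfl
    rcases le_or_gt 2 (miss (Equiv.refl (ChartIndex A B R)) g) with h3 | h3
    · obtain ⟨σ, hσ⟩ := exists_perm_comp_eq (f := Sum.inl) Sum.inl_injective hg
      have hgσ : g = fun i => σ (Sum.inl i) := funext fun i => (hσ i).symm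
      rw [hgσ, ← hdual]
      refine coord_mem_of_two_le_extra hs ha' h0' hinv' (σ.injective.comp Sum.inr_injective)
        (by rwa [hextra, ← hgσ]) fun h' h4 h5 => ?_
      by_cases hh : Function.Injective h'
      · obtain ⟨τ, hτ⟩ := exists_perm_comp_eq (f := Sum.inr) Sum.inr_injective hh
        have hhτ : h' = fun i => τ (Sum.inr i) := funext fun i => (hτ i).symm
        rw [hhτ, hmiss, hmiss, ← hgσ] at h4
        rw [hhτ, hextra, hextra, ← hgσ] at h5
        rw [hhτ, hdual]
        exact ih _ (add_lt_add_of_lt_of_le h5 h4) _ rfl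
      · simp only [coord_eq_zero hh]
        exact C.zero_mem
    · exact hnear g hg (by omega) (by omega)
  · exact hzero hg

end TwoSided

end

end Plucker

namespace Plucker

open Module

noncomputable section

/-! ### Coordinates near the standard position, parametrised by permutations -/

section Near

variable {K : Type u} [Field K] {A B : Type} {R : ℕ}

/-- The inclusion of the reserved positions. -/
def padIncl (A B : Type) {R : ℕ} : Pad R ⊕ Pad R → ChartIndex A B R := Sum.map Sum.inr Sum.inr

/-- Permuting only the reserved positions. -/
def padPerm (A B : Type) {R : ℕ} (π : Equiv.Perm (Pad R ⊕ Pad R)) :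
    Equiv.Perm (ChartIndex A B R) :=
  (Equiv.sumSumSumComm A B (Pad R) (Pad R)).permCongr (Equiv.Perm.sumCongr 1 π)

@[simp]
theorem padPerm_inl_inl (π : Equiv.Perm (Pad R ⊕ Pad R)) (a : A) :
    padPerm A B π (Sum.inl (Sum.inl a)) = Sum.inl (Sum.inl a) := rfl

@[simp]
theorem padPerm_inr_inl (π : Equiv.Perm (Pad R ⊕ Pad R)) (b : B) :
    padPerm A B π (Sum.inr (Sum.inl b)) = Sum.inr (Sum.inl b) := rfl

theorem padPerm_padIncl (π : Equiv.Perm (Pad R ⊕ Pad R)) (y : Pad R ⊕ Pad R) :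
    padPerm A B π (padIncl A B y) = padIncl A B (π y) := by
  rcases y with y | y <;> simp only [padPerm, padIncl, Equiv.permCongr_apply, Sum.map_inl,
    Sum.map_inr, Equiv.sumSumSumComm_symm, Equiv.sumSumSumComm_apply] <;>
    rcases h : π _ with z | z <;> simp [h]

@[simp]
theorem padPerm_inl_inr (π : Equiv.Perm (Pad R ⊕ Pad R)) (e : Pad R) :
    padPerm A B π (Sum.inl (Sum.inr e)) = padIncl A B (π (Sum.inl e)) :=
  padPerm_padIncl π (Sum.inl e)

@[simp]
theorem padPerm_inr_inr (π : Equiv.Perm (Pad R ⊕ Pad R)) (e : Pad R) :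
    padPerm A B π (Sum.inr (Sum.inr e)) = padIncl A B (π (Sum.inr e)) :=
  padPerm_padIncl π (Sum.inr e)

theorem sign_padPerm [Fintype A] [Fintype B] [DecidableEq A] [DecidableEq B]
    (π : Equiv.Perm (Pad R ⊕ Pad R)) :
    Equiv.Perm.sign (padPerm A B π) = Equiv.Perm.sign π := by
  rw [padPerm, Equiv.Perm.sign_permCongr, Equiv.Perm.sign_sumCongr]
  simp

theorem inl_inl_ne_padIncl (a : A) (y : Pad R ⊕ Pad R) :
    (Sum.inl (Sum.inl a) : ChartIndex A B R) ≠ padIncl A B y := by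
  rcases y with y | y <;> simp [padIncl]

theorem inr_inl_ne_padIncl (b : B) (y : Pad R ⊕ Pad R) :
    (Sum.inr (Sum.inl b) : ChartIndex A B R) ≠ padIncl A B y := by
  rcases y with y | y <;> simp [padIncl]

theorem chartIndex_cases (x : ChartIndex A B R) : (∃ a, x = Sum.inl (Sum.inl a)) ∨
    (∃ b, x = Sum.inr (Sum.inl b)) ∨ ∃ y, x = padIncl A B y := by
  rcases x with (a | e) | (b | e)
  · exact Or.inl ⟨a, rfl⟩
  · exact Or.inr (Or.inr ⟨Sum.inl e, rfl⟩)
  · exact Or.inr (Or.inl ⟨b, rfl⟩)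
  · exact Or.inr (Or.inr ⟨Sum.inr e, rfl⟩)

/-- Two tuples with the same unreserved entries in the same slots differ only by a permutation of
the reserved positions. -/
theorem exists_padPerm_eq {ι : Type} {s z : ι → ChartIndex A B R} (hs : Function.Injective s)
    (hz : Function.Injective z) (h : ∀ x, (∃ y y', s x = padIncl A B y ∧ z x = padIncl A B y') ∨
      s x = z x ∧ ∀ y, s x ≠ padIncl A B y) : ∃ π, ∀ x, z x = padPerm A B π (s x) := by
  have h' : ∀ x : {x // ∃ y, s x = padIncl A B y}, ∃ y y', s x = padIncl A B y ∧
      z x = padIncl A B y' := fun x =>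
    (h x.1).resolve_right fun h' => h'.2 _ x.2.choose_spec
  choose f f' hf hf' using h'
  obtain ⟨π, hπ⟩ := exists_perm_comp_eq (f := f) (g := f')
    (fun x y hxy => Subtype.ext (hs (by rw [hf, hf, hxy])))
    (fun x y hxy => Subtype.ext (hz (by rw [hf', hf', hxy])))
  refine ⟨π, fun x => ?_⟩
  by_cases hx : ∃ y, s x = padIncl A B y
  · rw [hf ⟨x, hx⟩, hf' ⟨x, hx⟩, padPerm_padIncl, hπ]
  · have h1 := (h x).resolve_left fun ⟨y, y', h1, _⟩ => hx ⟨y, h1⟩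
    rw [← h1.1]
    rcases chartIndex_cases (s x) with ⟨a, ha⟩ | ⟨b, hb⟩ | h2
    · rw [ha, padPerm_inl_inl]
    · rw [hb, padPerm_inr_inl]
    · exact absurd h2 hx

theorem exists_perm_prescribed {ι X I : Type} [Finite ι] {g : ι → I} {pos : X → ι} {val : X → I}
    (hpos : Function.Injective pos) (hval : Function.Injective val)
    (h : ∀ x, val x ∈ Set.range g) : ∃ τ : Equiv.Perm ι, ∀ x, g (τ (pos x)) = val x := by
  choose k hk using h
  obtain ⟨τ, hτ⟩ := exists_perm_comp_eq (g := k) hpos fun x y hxy => hval (by rw [← hk, ← hk, hxy])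
  exact ⟨τ, fun x => by rw [hτ, hk]⟩

/-- The distinguished reserved position. -/
def padBase (R : ℕ) : Pad R := Sum.inr 0

variable [DecidableEq A] [DecidableEq B]

/-- The permutations producing the coordinates of bidegree `(1, 1)`. -/
def permAB (π : Equiv.Perm (Pad R ⊕ Pad R)) (a : A) (b : B) : Equiv.Perm (ChartIndex A B R) :=
  padPerm A B π * Equiv.swap (Sum.inl (Sum.inl a)) (Sum.inr (Sum.inl b))

variable (B) in
/-- The permutations producing the coordinates of bidegree `(1, 0)`. -/
def permA (π : Equiv.Perm (Pad R ⊕ Pad R)) (a : A) : Equiv.Perm (ChartIndex A B R) :=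
  padPerm A B π * Equiv.swap (Sum.inl (Sum.inl a)) (Sum.inr (Sum.inr (padBase R)))

variable (A) in
/-- The permutations producing the coordinates of bidegree `(0, 1)`. -/
def permB (π : Equiv.Perm (Pad R ⊕ Pad R)) (b : B) : Equiv.Perm (ChartIndex A B R) :=
  padPerm A B π * Equiv.swap (Sum.inr (Sum.inl b)) (Sum.inl (Sum.inr (padBase R)))

/-- The coordinate attached to a permutation of the index set. -/
def permCoord {ι κ : Type} [DecidableEq ι] [DecidableEq κ] (σ : Equiv.Perm (ι ⊕ κ))
    (α : Alt K ι (ι ⊕ κ)) : K :=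
  coord (fun x => σ (Sum.inl x)) α

variable [Fintype A] [Fintype B]

/-- Up to the order of the arguments, such an index tuple is determined by its missing standard
index, its nonstandard index, and the reserved positions filling the other slots. The permutations π
form a finite set depending only on R, so the near coordinates are boundedly many matrices, vectors
and scalars. -/
theorem near_normalForm {g : A ⊕ Pad R → ChartIndex A B R} (hg : Function.Injective g)
    (h1 : miss (Equiv.refl (ChartIndex A B R)) g ≤ 1)
    (h2 : extra (Equiv.refl (ChartIndex A B R)) g ≤ 1) :
    ∃ (τ : Equiv.Perm (A ⊕ Pad R)) (σ : Equiv.Perm (ChartIndex A B R)),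
      (∀ x, g (τ x) = σ (Sum.inl x)) ∧ ∃ π, σ = padPerm A B π ∨ (∃ a, σ = permA B π a) ∨
        (∃ b, σ = permB A π b) ∨ ∃ a b, σ = permAB π a b := by
  have hA : ∀ a a' : A, Sum.inl (Sum.inl a) ∉ Set.range g → Sum.inl (Sum.inl a') ∉ Set.range g →
      a = a' := fun a a' h h' => (Set.ncard_le_one (Set.toFinite _)).1 h1 a h a' h'
  have hB : ∀ b b' : B, Sum.inr (Sum.inl b) ∈ Set.range g → Sum.inr (Sum.inl b') ∈ Set.range g →
      b = b' := fun a a' h h' => (Set.ncard_le_one (Set.toFinite _)).1 h2 a h a' h'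
  have hiA : Function.Injective fun a : A => (Sum.inl (Sum.inl a) : ChartIndex A B R) :=
    Sum.inl_injective.comp Sum.inl_injective
  have hmem : ∀ (τ : Equiv.Perm (A ⊕ Pad R)) x, g (τ x) ∈ Set.range g := fun τ x => ⟨_, rfl⟩
  have hinj : ∀ τ : Equiv.Perm (A ⊕ Pad R), Function.Injective fun x => g (τ x) :=
    fun τ => hg.comp τ.injective
  have fin : ∀ (τ : Equiv.Perm (A ⊕ Pad R)) (s : Equiv.Perm (ChartIndex A B R)),
      (∀ x, (∃ y y', s (Sum.inl x) = padIncl A B y ∧ g (τ x) = padIncl A B y') ∨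
        s (Sum.inl x) = g (τ x) ∧ ∀ y, s (Sum.inl x) ≠ padIncl A B y) →
      ∃ π, ∀ x, g (τ x) = (padPerm A B π * s : Equiv.Perm (ChartIndex A B R)) (Sum.inl x) := fun τ s h =>
    exists_padPerm_eq (s.injective.comp Sum.inl_injective) (hinj τ) h
  by_cases ha : ∃ a₀ : A, Sum.inl (Sum.inl a₀) ∉ Set.range g
  · obtain ⟨a₀, ha₀⟩ := ha
    have hother : ∀ a, a ≠ a₀ → Sum.inl (Sum.inl a) ∈ Set.range g := fun a hne => by
      by_contra h
      exact hne (hA a a₀ h ha₀)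
    have build : ∀ w : ChartIndex A B R, w ∈ Set.range g → (∀ a, w ≠ Sum.inl (Sum.inl a)) →
        ∃ τ : Equiv.Perm (A ⊕ Pad R), g (τ (Sum.inl a₀)) = w ∧
          (∀ a, a ≠ a₀ → g (τ (Sum.inl a)) = Sum.inl (Sum.inl a)) ∧
          ∀ e a, g (τ (Sum.inr e)) ≠ Sum.inl (Sum.inl a) := by
      intro w hw hwA
      obtain ⟨τ, hτ⟩ := exists_perm_prescribed (g := g) (pos := fun a : A => Sum.inl a)
        (val := fun a => if a = a₀ then w else Sum.inl (Sum.inl a)) Sum.inl_injective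
        (fun a a' h => by
          dsimp only at h
          split_ifs at h with h1 h2 h2
          · rw [h1, h2]
          · exact absurd h (hwA a')
          · exact absurd h.symm (hwA a)
          · exact hiA h)
        (fun a => by
          split_ifs with h1
          · exact hw
          · exact hother a h1)
      have hτ' : ∀ a, a ≠ a₀ → g (τ (Sum.inl a)) = Sum.inl (Sum.inl a) := fun a hne => by
        rw [hτ, if_neg hne]
      refine ⟨τ, by rw [hτ, if_pos rfl], hτ', fun e a h => ?_⟩
      have hne : a ≠ a₀ := fun h' => ha₀ (by rw [← h', ← h]; exact hmem τ _)
      have := hinj τ (h.trans (hτ' a hne).symm)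
      simp at this
    by_cases hb : ∃ b₀ : B, Sum.inr (Sum.inl b₀) ∈ Set.range g
    · obtain ⟨b₀, hb₀⟩ := hb
      obtain ⟨τ, hτ1, hτ2, hτ3⟩ := build _ hb₀ (by simp)
      obtain ⟨π, hπ⟩ := fin τ (Equiv.swap (Sum.inl (Sum.inl a₀)) (Sum.inr (Sum.inl b₀))) (by
        rintro (a | e)
        · right
          by_cases h : a = a₀
          · subst h
            rw [Equiv.swap_apply_left, hτ1]
            exact ⟨rfl, inr_inl_ne_padIncl _⟩
          · rw [Equiv.swap_apply_of_ne_of_ne (by simpa using h) (by simp), hτ2 a h]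
            exact ⟨rfl, inl_inl_ne_padIncl _⟩
        · left
          refine ⟨Sum.inl e, ?_⟩
          rw [Equiv.swap_apply_of_ne_of_ne (by simp) (by simp)]
          rcases chartIndex_cases (g (τ (Sum.inr e))) with ⟨a, h⟩ | ⟨b, h⟩ | ⟨y, hy⟩
          · exact absurd h (hτ3 e a)
          · obtain rfl := hB b b₀ (by rw [← h]; exact hmem τ _) hb₀
            have := hinj τ (h.trans hτ1.symm)
            simp at this
          · exact ⟨y, rfl, hy⟩)
      exact ⟨τ, _, hπ, π, Or.inr (Or.inr (Or.inr ⟨a₀, b₀, rfl⟩))⟩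
    · push Not at hb
      -- There are more slots than standard indices in A, so some slot holds another index, here
      -- necessarily a reserved one; it takes the place of a₀.
      obtain ⟨k, hk⟩ : ∃ k, ∀ a, g k ≠ Sum.inl (Sum.inl a) := by
        by_contra! hcon
        choose f hf using hcon
        have hfi : Function.Injective f := fun x y hxy => hg (by rw [hf, hf, hxy])
        have := Fintype.card_le_of_injective f hfi
        rw [Fintype.card_sum, Fintype.card_sum, Fintype.card_fin 2] at this
        omega
      obtain ⟨τ, hτ1, hτ2, hτ3⟩ := build (g k) ⟨k, rfl⟩ hk
      have hpad : ∀ x, (∀ a, g x ≠ Sum.inl (Sum.inl a)) → ∃ y, g x = padIncl A B y := fun x hx => by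
        rcases chartIndex_cases (g x) with ⟨a, h⟩ | ⟨b, h⟩ | h
        · exact absurd h (hx a)
        · exact absurd ⟨x, h⟩ (hb b)
        · exact h
      obtain ⟨π, hπ⟩ := fin τ
        (Equiv.swap (Sum.inl (Sum.inl a₀)) (Sum.inr (Sum.inr (padBase R)))) (by
        rintro (a | e)
        · by_cases h : a = a₀
          · left
            subst h
            rw [Equiv.swap_apply_left, hτ1]
            obtain ⟨y, hy⟩ := hpad k hk
            exact ⟨Sum.inr (padBase R), y, rfl, hy⟩
          · right
            rw [Equiv.swap_apply_of_ne_of_ne (by simpa using h) (by simp), hτ2 a h]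
            exact ⟨rfl, inl_inl_ne_padIncl _⟩
        · left
          refine ⟨Sum.inl e, ?_⟩
          rw [Equiv.swap_apply_of_ne_of_ne (by simp) (by simp)]
          obtain ⟨y, hy⟩ := hpad _ (hτ3 e)
          exact ⟨y, rfl, hy⟩)
      exact ⟨τ, _, hπ, π, Or.inr (Or.inl ⟨a₀, rfl⟩)⟩
  · push Not at ha
    by_cases hb : ∃ b₀ : B, Sum.inr (Sum.inl b₀) ∈ Set.range g
    · obtain ⟨b₀, hb₀⟩ := hb
      obtain ⟨τ, hτ⟩ := exists_perm_prescribed (g := g)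
        (pos := Sum.elim (fun a : A => Sum.inl a) fun _ : Unit => Sum.inr (padBase R))
        (val := Sum.elim (fun a : A => Sum.inl (Sum.inl a)) fun _ : Unit => Sum.inr (Sum.inl b₀))
        (by rintro (x | x) (y | y) <;> simp) (by rintro (x | x) (y | y) <;> simp)
        (by rintro (x | x); exacts [ha x, hb₀])
      have hτ1 : ∀ a, g (τ (Sum.inl a)) = Sum.inl (Sum.inl a) := fun a => hτ (Sum.inl a)
      have hτ2 : g (τ (Sum.inr (padBase R))) = Sum.inr (Sum.inl b₀) := hτ (Sum.inr ())
      obtain ⟨π, hπ⟩ := fin τ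
        (Equiv.swap (Sum.inr (Sum.inl b₀)) (Sum.inl (Sum.inr (padBase R)))) (by
        rintro (a | e)
        · right
          rw [Equiv.swap_apply_of_ne_of_ne (by simp) (by simp), hτ1]
          exact ⟨rfl, inl_inl_ne_padIncl _⟩
        · by_cases h : e = padBase R
          · right
            subst h
            rw [Equiv.swap_apply_right, hτ2]
            exact ⟨rfl, inr_inl_ne_padIncl _⟩
          · left
            refine ⟨Sum.inl e, ?_⟩
            rw [Equiv.swap_apply_of_ne_of_ne (by simp) (by simpa using h)]
            rcases chartIndex_cases (g (τ (Sum.inr e))) with ⟨a, h'⟩ | ⟨b, h'⟩ | ⟨y, hy⟩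
            · have := hinj τ (h'.trans (hτ1 a).symm)
              simp at this
            · obtain rfl := hB b b₀ (by rw [← h']; exact hmem τ _) hb₀
              have := hinj τ (h'.trans hτ2.symm)
              exact absurd (by simpa using this) h
            · exact ⟨y, rfl, hy⟩)
      exact ⟨τ, _, hπ, π, Or.inr (Or.inr (Or.inl ⟨b₀, rfl⟩))⟩
    · push Not at hb
      obtain ⟨τ, hτ⟩ := exists_perm_prescribed (g := g) (pos := fun a : A => Sum.inl a)
        (val := fun a => Sum.inl (Sum.inl a)) Sum.inl_injective hiA ha
      obtain ⟨π, hπ⟩ := fin τ 1 (by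
        rintro (a | e)
        · right
          rw [hτ]
          exact ⟨rfl, inl_inl_ne_padIncl _⟩
        · left
          refine ⟨Sum.inl e, ?_⟩
          rcases chartIndex_cases (g (τ (Sum.inr e))) with ⟨a, h⟩ | ⟨b, h⟩ | ⟨y, hy⟩
          · have := hinj τ (h.trans (hτ a).symm)
            simp at this
          · exact absurd ⟨_, h⟩ (hb b)
          · exact ⟨y, rfl, hy⟩)
      exact ⟨τ, _, hπ, π, Or.inl (mul_one _)⟩

theorem coord_mem_of_permCoord {Ω : Type*} {a : Ω → Alt K (A ⊕ Pad R) (ChartIndex A B R)}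
    {C : Subalgebra K (Ω → K)}
    (h0 : ∀ π, (fun ω => permCoord (padPerm A B π) (a ω)) ∈ C)
    (hA : ∀ π i, (fun ω => permCoord (permA B π i) (a ω)) ∈ C)
    (hB : ∀ π j, (fun ω => permCoord (permB A π j) (a ω)) ∈ C)
    (hAB : ∀ π i j, (fun ω => permCoord (permAB π i j) (a ω)) ∈ C)
    {g : A ⊕ Pad R → ChartIndex A B R} (hg : Function.Injective g)
    (h1 : miss (Equiv.refl (ChartIndex A B R)) g ≤ 1)
    (h2 : extra (Equiv.refl (ChartIndex A B R)) g ≤ 1) : (fun ω => coord g (a ω)) ∈ C := by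
  obtain ⟨τ, σ, hσ, h⟩ := near_normalForm hg h1 h2
  have h3 : (fun ω => coord g (a ω)) =
      ((Equiv.Perm.sign τ : ℤ) : K)⁻¹ • fun ω => permCoord σ (a ω) := by
    ext ω
    rw [Pi.smul_apply, permCoord, ← funext hσ, coord_comp_perm, smul_eq_mul, ← mul_assoc,
      inv_mul_cancel₀ (sign_cast_ne_zero τ), one_mul]
  rw [h3]
  refine C.smul_mem ?_ _
  obtain ⟨π, rfl | ⟨i, rfl⟩ | ⟨j, rfl⟩ | ⟨i, j, rfl⟩⟩ := h
  · exact h0 π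
  · exact hA π i
  · exact hB π j
  · exact hAB π i j

end Near

end

end Plucker

namespace Plucker

open Module

noncomputable section

/-! ### Row and column operations: pullback changes B, pullback of the Hodge dual changes A and with
it the number of arguments -/

section Transport

variable {K : Type u} [Field K]

theorem coord_compLinearMap_of_single {ι I J : Type} [Fintype J] [DecidableEq I] [DecidableEq J]
    {y : J → I → K} {α : Alt K ι I} {g' : ι → J} {g : ι → I}
    (h : ∀ x, y (g' x) = Pi.single (g x) 1) :
    coord g' (α.compLinearMap (Fintype.linearCombination K y)) = coord g α := by
  rw [coord, AlternatingMap.compLinearMap_apply, coord]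
  congr 1
  ext1 x
  rw [Fintype.linearCombination_apply_single, one_smul, h]

theorem coord_compLinearMap_of_sum {ι I J m : Type} [Fintype J] [DecidableEq I] [DecidableEq J]
    [Fintype m] {y : J → I → K} {α : Alt K ι I} {g' : ι → J} {g : m → ι → I} {c : m → K} (x₀ : ι)
    (h0 : y (g' x₀) = ∑ k, c k • Pi.single (g k x₀) 1)
    (h : ∀ k x, x ≠ x₀ → y (g' x) = Pi.single (g k x) 1) :
    coord g' (α.compLinearMap (Fintype.linearCombination K y)) = ∑ k, c k * coord (g k) α := by
  classical
  have h1 : (fun x => Fintype.linearCombination K y (Pi.single (g' x) 1)) =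
      Function.update (fun x => y (g' x)) x₀ (∑ k, c k • Pi.single (g k x₀) 1) := by
    ext1 x
    rw [Fintype.linearCombination_apply_single, one_smul]
    by_cases hx : x = x₀
    · subst hx
      rw [Function.update_self, h0]
    · rw [Function.update_of_ne hx]
  rw [coord, AlternatingMap.compLinearMap_apply, h1, ← AlternatingMap.coe_multilinearMap,
    MultilinearMap.map_update_sum]
  refine Finset.sum_congr rfl fun k _ => ?_
  have h2 : Function.update (fun x => y (g' x)) x₀ (Pi.single (g k x₀) 1) =
      fun x => Pi.single (g k x) 1 := by
    ext1 x
    by_cases hx : x = x₀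
    · subst hx
      rw [Function.update_self]
    · rw [Function.update_of_ne hx, h k x hx]
  rw [MultilinearMap.map_update_smul, smul_eq_mul, h2]
  rfl

variable {A A' B B' : Type} {R : ℕ} [DecidableEq A] [DecidableEq B]
  [DecidableEq A'] [DecidableEq B'] {π : Equiv.Perm (Pad R ⊕ Pad R)}

/-- The values of the permutations producing the coordinates. -/
theorem permAB_apply (a : A) (b : B) :
    permAB π a b (Sum.inl (Sum.inl a)) = Sum.inr (Sum.inl b) ∧
    (∀ a', a' ≠ a → permAB π a b (Sum.inl (Sum.inl a')) = Sum.inl (Sum.inl a')) ∧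
    (∀ e, permAB π a b (Sum.inl (Sum.inr e)) = padIncl A B (π (Sum.inl e))) ∧
    permAB π a b (Sum.inr (Sum.inl b)) = Sum.inl (Sum.inl a) ∧
    (∀ b', b' ≠ b → permAB π a b (Sum.inr (Sum.inl b')) = Sum.inr (Sum.inl b')) ∧
    ∀ e, permAB π a b (Sum.inr (Sum.inr e)) = padIncl A B (π (Sum.inr e)) := by
  refine ⟨?_, fun a' h => ?_, fun e => ?_, ?_, fun b' h => ?_, fun e => ?_⟩ <;>
    rw [permAB, Equiv.Perm.mul_apply]
  · rw [Equiv.swap_apply_left, padPerm_inr_inl]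
  · rw [Equiv.swap_apply_of_ne_of_ne (by simpa using h) (by simp), padPerm_inl_inl]
  · rw [Equiv.swap_apply_of_ne_of_ne (by simp) (by simp), padPerm_inl_inr]
  · rw [Equiv.swap_apply_right, padPerm_inl_inl]
  · rw [Equiv.swap_apply_of_ne_of_ne (by simp) (by simpa using h), padPerm_inr_inl]
  · rw [Equiv.swap_apply_of_ne_of_ne (by simp) (by simp), padPerm_inr_inr]

theorem permA_apply (a : A) :
    permA B π a (Sum.inl (Sum.inl a)) = padIncl A B (π (Sum.inr (padBase R))) ∧
    (∀ a', a' ≠ a → permA B π a (Sum.inl (Sum.inl a')) = Sum.inl (Sum.inl a')) ∧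
    (∀ e, permA B π a (Sum.inl (Sum.inr e)) = padIncl A B (π (Sum.inl e))) ∧
    (∀ b, permA B π a (Sum.inr (Sum.inl b)) = Sum.inr (Sum.inl b)) ∧
    permA B π a (Sum.inr (Sum.inr (padBase R))) = Sum.inl (Sum.inl a) ∧
    ∀ e, e ≠ padBase R →
      permA B π a (Sum.inr (Sum.inr e)) = padIncl A B (π (Sum.inr e)) := by
  refine ⟨?_, fun a' h => ?_, fun e => ?_, fun b => ?_, ?_, fun e h => ?_⟩ <;>
    rw [permA, Equiv.Perm.mul_apply]
  · rw [Equiv.swap_apply_left, padPerm_inr_inr]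
  · rw [Equiv.swap_apply_of_ne_of_ne (by simpa using h) (by simp), padPerm_inl_inl]
  · rw [Equiv.swap_apply_of_ne_of_ne (by simp) (by simp), padPerm_inl_inr]
  · rw [Equiv.swap_apply_of_ne_of_ne (by simp) (by simp), padPerm_inr_inl]
  · rw [Equiv.swap_apply_right, padPerm_inl_inl]
  · rw [Equiv.swap_apply_of_ne_of_ne (by simp) (by simpa using h), padPerm_inr_inr]

theorem permB_apply (b : B) :
    permB A π b (Sum.inr (Sum.inl b)) = padIncl A B (π (Sum.inl (padBase R))) ∧
    (∀ b', b' ≠ b → permB A π b (Sum.inr (Sum.inl b')) = Sum.inr (Sum.inl b')) ∧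
    (∀ e, permB A π b (Sum.inr (Sum.inr e)) = padIncl A B (π (Sum.inr e))) ∧
    (∀ a, permB A π b (Sum.inl (Sum.inl a)) = Sum.inl (Sum.inl a)) ∧
    permB A π b (Sum.inl (Sum.inr (padBase R))) = Sum.inr (Sum.inl b) ∧
    ∀ e, e ≠ padBase R →
      permB A π b (Sum.inl (Sum.inr e)) = padIncl A B (π (Sum.inl e)) := by
  refine ⟨?_, fun a' h => ?_, fun e => ?_, fun b => ?_, ?_, fun e h => ?_⟩ <;>
    rw [permB, Equiv.Perm.mul_apply]
  · rw [Equiv.swap_apply_left, padPerm_inl_inr]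
  · rw [Equiv.swap_apply_of_ne_of_ne (by simpa using h) (by simp), padPerm_inr_inl]
  · rw [Equiv.swap_apply_of_ne_of_ne (by simp) (by simp), padPerm_inr_inr]
  · rw [Equiv.swap_apply_of_ne_of_ne (by simp) (by simp), padPerm_inl_inl]
  · rw [Equiv.swap_apply_right, padPerm_inr_inl]
  · rw [Equiv.swap_apply_of_ne_of_ne (by simp) (by simpa using h), padPerm_inl_inr]

variable [Fintype A] [Fintype B] [Fintype A'] [Fintype B']

/-- A linear combination of the nonstandard basis vectors. -/
def pullB (A : Type) (R : ℕ) [Fintype A] [DecidableEq A] (ψ : Matrix B B' K) :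
    (ChartIndex A B' R → K) →ₗ[K] (ChartIndex A B R → K) :=
  Fintype.linearCombination K (Sum.elim (fun x => Pi.single (Sum.inl x) 1)
    (Sum.elim (fun j' => ∑ j, ψ j j' • Pi.single (Sum.inr (Sum.inl j)) 1)
      fun e => Pi.single (Sum.inr (Sum.inr e)) 1))

/-- A linear combination of the standard basis vectors. -/
def pullA (B : Type) (R : ℕ) [Fintype B] [DecidableEq B] (φ : Matrix A' A K) :
    (ChartIndex A' B R → K) →ₗ[K] (ChartIndex A B R → K) :=
  Fintype.linearCombination K (Sum.elim
    (Sum.elim (fun i' => ∑ i, φ i' i • Pi.single (Sum.inl (Sum.inl i)) 1)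
      fun e => Pi.single (Sum.inl (Sum.inr e)) 1) fun x => Pi.single (Sum.inr x) 1)

/-- At most one argument of a near coordinate is an index of B, so multilinearity in that single
slot gives a linear transformation by ψ. -/
theorem permCoord_pullB (ψ : Matrix B B' K) (α : Alt K (A ⊕ Pad R) (ChartIndex A B R)) :
    permCoord (padPerm A B' π) (α.compLinearMap (pullB A R ψ)) = permCoord (padPerm A B π) α ∧
    (∀ i, permCoord (permA B' π i) (α.compLinearMap (pullB A R ψ)) = permCoord (permA B π i) α) ∧
    (∀ j', permCoord (permB A π j') (α.compLinearMap (pullB A R ψ)) =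
      ∑ j, ψ j j' * permCoord (permB A π j) α) ∧
    ∀ i j', permCoord (permAB π i j') (α.compLinearMap (pullB A R ψ)) =
      ∑ j, ψ j j' * permCoord (permAB π i j) α := by
  have hpad : ∀ y, Sum.elim (fun x => (Pi.single (Sum.inl x) 1 : ChartIndex A B R → K))
      (Sum.elim (fun j' => ∑ j, ψ j j' • Pi.single (Sum.inr (Sum.inl j)) 1)
      fun e => Pi.single (Sum.inr (Sum.inr e)) 1) (padIncl A B' y) =
      Pi.single (padIncl A B y) 1 := by
    rintro (y | y) <;> rfl
  refine ⟨coord_compLinearMap_of_single ?_, fun i => coord_compLinearMap_of_single ?_,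
    fun j' => coord_compLinearMap_of_sum (Sum.inr (padBase R)) ?_ ?_,
    fun i j' => coord_compLinearMap_of_sum (Sum.inl i) ?_ ?_⟩
  · rintro (a | e)
    · rfl
    · rw [padPerm_inl_inr, padPerm_inl_inr, hpad]
  · obtain ⟨h1, h2, h3, -⟩ := permA_apply (B := B) (π := π) i
    obtain ⟨h1', h2', h3', -⟩ := permA_apply (B := B') (π := π) i
    rintro (a | e)
    · by_cases h : a = i
      · rw [h, h1, h1', hpad]
      · rw [h2 a h, h2' a h]
        rfl
    · rw [h3, h3', hpad]
  · rw [(permB_apply j').2.2.2.2.1]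
    simp only [(permB_apply _).2.2.2.2.1]
    rfl
  · rintro j (a | e) hx
    · rw [(permB_apply j).2.2.2.1, (permB_apply j').2.2.2.1]
      rfl
    · have he : e ≠ padBase R := fun h => hx (by rw [h])
      rw [(permB_apply j).2.2.2.2.2 e he, (permB_apply j').2.2.2.2.2 e he, hpad]
  · rw [(permAB_apply i j').1]
    simp only [(permAB_apply i _).1]
    rfl
  · rintro j (a | e) hx
    · have ha : a ≠ i := fun h => hx (by rw [h])
      rw [(permAB_apply i j).2.1 a ha, (permAB_apply i j').2.1 a ha]
      rfl
    · rw [(permAB_apply i j).2.2.1, (permAB_apply i j').2.2.1, hpad]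

/-- The coordinate of a dual form attached to a permutation of the index set. -/
def dualCoord {ι κ : Type} [DecidableEq ι] [DecidableEq κ] (σ : Equiv.Perm (ι ⊕ κ))
    (β : Alt K κ (ι ⊕ κ)) : K :=
  coord (fun x => σ (Sum.inr x)) β

theorem dualCoord_pullA (φ : Matrix A' A K) (β : Alt K (B ⊕ Pad R) (ChartIndex A B R)) :
    dualCoord (padPerm A' B π) (β.compLinearMap (pullA B R φ)) = dualCoord (padPerm A B π) β ∧
    (∀ j, dualCoord (permB A' π j) (β.compLinearMap (pullA B R φ)) = dualCoord (permB A π j) β) ∧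
    (∀ i', dualCoord (permA B π i') (β.compLinearMap (pullA B R φ)) =
      ∑ i, φ i' i * dualCoord (permA B π i) β) ∧
    ∀ i' j, dualCoord (permAB π i' j) (β.compLinearMap (pullA B R φ)) =
      ∑ i, φ i' i * dualCoord (permAB π i j) β := by
  have hpad : ∀ y, Sum.elim
      (Sum.elim (fun i' => ∑ i, φ i' i • (Pi.single (Sum.inl (Sum.inl i)) 1 : ChartIndex A B R → K))
      fun e => Pi.single (Sum.inl (Sum.inr e)) 1) (fun x => Pi.single (Sum.inr x) 1)
      (padIncl A' B y) = Pi.single (padIncl A B y) 1 := by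
    rintro (y | y) <;> rfl
  refine ⟨coord_compLinearMap_of_single ?_, fun i => coord_compLinearMap_of_single ?_,
    fun i' => coord_compLinearMap_of_sum (Sum.inr (padBase R)) ?_ ?_,
    fun i' j => coord_compLinearMap_of_sum (Sum.inl j) ?_ ?_⟩
  · rintro (a | e)
    · rfl
    · rw [padPerm_inr_inr, padPerm_inr_inr, hpad]
  · obtain ⟨h1, h2, h3, -⟩ := permB_apply (A := A) (π := π) i
    obtain ⟨h1', h2', h3', -⟩ := permB_apply (A := A') (π := π) i
    rintro (a | e)
    · by_cases h : a = i
      · rw [h, h1, h1', hpad]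
      · rw [h2 a h, h2' a h]
        rfl
    · rw [h3, h3', hpad]
  · rw [(permA_apply i').2.2.2.2.1]
    simp only [(permA_apply _).2.2.2.2.1]
    rfl
  · rintro i (b | e) hx
    · rw [(permA_apply i).2.2.2.1, (permA_apply i').2.2.2.1]
      rfl
    · have he : e ≠ padBase R := fun h => hx (by rw [h])
      rw [(permA_apply i).2.2.2.2.2 e he, (permA_apply i').2.2.2.2.2 e he, hpad]
  · rw [(permAB_apply i' j).2.2.2.1]
    simp only [(permAB_apply _ j).2.2.2.1]
    rfl
  · rintro i (b | e) hx
    · have hb : b ≠ j := fun h => hx (by rw [h])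
      rw [(permAB_apply i j).2.2.2.2.1 b hb, (permAB_apply i' j).2.2.2.2.1 b hb]
      rfl
    · rw [(permAB_apply i j).2.2.2.2.2, (permAB_apply i' j).2.2.2.2.2, hpad]

theorem hodge_sumComm_hodge {ι κ : Type} [Fintype ι] [Fintype κ] [DecidableEq ι] [DecidableEq κ]
    (α : Alt K ι (ι ⊕ κ)) : hodge K (Equiv.sumComm κ ι) (hodge K (Equiv.refl (ι ⊕ κ)) α) = α :=
  hodge_hodge (Equiv.refl (ι ⊕ κ)) α

theorem hodge_hodge_sumComm {ι κ : Type} [Fintype ι] [Fintype κ] [DecidableEq ι] [DecidableEq κ]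
    (β : Alt K κ (ι ⊕ κ)) : hodge K (Equiv.refl (ι ⊕ κ)) (hodge K (Equiv.sumComm κ ι) β) = β :=
  hodge_hodge' (Equiv.refl (ι ⊕ κ)) β

theorem dualCoord_hodge {ι κ : Type} [Fintype ι] [Fintype κ] [DecidableEq ι] [DecidableEq κ]
    (α : Alt K ι (ι ⊕ κ)) (σ : Equiv.Perm (ι ⊕ κ)) :
    dualCoord σ (hodge K (Equiv.refl (ι ⊕ κ)) α) = (Equiv.Perm.sign σ : ℤ) * permCoord σ α :=
  coord_hodge α σ

/-- Dual coordinates are coordinates of the form up to the sign of the permutation; here the signs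
agree and cancel. -/
theorem permCoord_eq_of_dualCoord_eq {ι κ ι' κ' m : Type} [Fintype ι] [Fintype κ]
    [DecidableEq ι] [DecidableEq κ] [Fintype ι'] [Fintype κ'] [DecidableEq ι'] [DecidableEq κ']
    [Fintype m] {α : Alt K ι (ι ⊕ κ)} {α' : Alt K ι' (ι' ⊕ κ')} {σ' : Equiv.Perm (ι' ⊕ κ')}
    {σ : m → Equiv.Perm (ι ⊕ κ)} {c : m → K}
    (hs : ∀ k, Equiv.Perm.sign (σ k) = Equiv.Perm.sign σ')
    (h : dualCoord σ' (hodge K (Equiv.refl _) α') =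
      ∑ k, c k * dualCoord (σ k) (hodge K (Equiv.refl _) α)) :
    permCoord σ' α' = ∑ k, c k * permCoord (σ k) α := by
  simp only [dualCoord_hodge, hs] at h
  refine mul_left_cancel₀ (sign_cast_ne_zero (K := K) σ') (h.trans ?_)
  rw [Finset.mul_sum]
  exact Finset.sum_congr rfl fun k _ => by ring

/-- The row and column operations on charts. -/
def chartMap (φ : Matrix A' A K) (ψ : Matrix B B' K)
    (α : Alt K (A ⊕ Pad R) (ChartIndex A B R)) : Alt K (A' ⊕ Pad R) (ChartIndex A' B' R) :=
  hodge K (Equiv.sumComm _ _)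
    ((hodge K (Equiv.refl (ChartIndex A B' R)) (α.compLinearMap (pullB A R ψ))).compLinearMap
      (pullA B' R φ))

theorem hodge_chartMap (φ : Matrix A' A K) (ψ : Matrix B B' K)
    (α : Alt K (A ⊕ Pad R) (ChartIndex A B R)) :
    hodge K (Equiv.refl (ChartIndex A' B' R)) (chartMap φ ψ α) =
      (hodge K (Equiv.refl (ChartIndex A B' R)) (α.compLinearMap (pullB A R ψ))).compLinearMap
        (pullA B' R φ) :=
  hodge_hodge_sumComm _

theorem sign_permAB (a : A) (b : B) :
    Equiv.Perm.sign (permAB π a b) = -Equiv.Perm.sign π := by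
  rw [permAB, Equiv.Perm.sign_mul, sign_padPerm, Equiv.Perm.sign_swap (by simp), mul_neg_one]

theorem sign_permA (a : A) : Equiv.Perm.sign (permA B π a) = -Equiv.Perm.sign π := by
  rw [permA, Equiv.Perm.sign_mul, sign_padPerm, Equiv.Perm.sign_swap (by simp), mul_neg_one]

theorem sign_permB (b : B) : Equiv.Perm.sign (permB A π b) = -Equiv.Perm.sign π := by
  rw [permB, Equiv.Perm.sign_mul, sign_padPerm, Equiv.Perm.sign_swap (by simp), mul_neg_one]

theorem permCoord_padPerm_chartMap (φ : Matrix A' A K) (ψ : Matrix B B' K)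
    (α : Alt K (A ⊕ Pad R) (ChartIndex A B R)) :
    permCoord (padPerm A' B' π) (chartMap φ ψ α) = permCoord (padPerm A B π) α := by
  rw [← (permCoord_pullB ψ α).1]
  have := permCoord_eq_of_dualCoord_eq (m := Unit) (c := fun _ => 1) (α' := chartMap φ ψ α)
    (σ' := padPerm A' B' π) (σ := fun _ => padPerm A B' π)
    (α := α.compLinearMap (pullB A R ψ)) (fun _ => by simp [sign_padPerm])
    (by rw [hodge_chartMap, (dualCoord_pullA φ _).1]; simp)
  simpa using this

theorem permCoord_permB_chartMap (φ : Matrix A' A K) (ψ : Matrix B B' K)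
    (α : Alt K (A ⊕ Pad R) (ChartIndex A B R)) (j' : B') :
    permCoord (permB A' π j') (chartMap φ ψ α) = ∑ j, ψ j j' * permCoord (permB A π j) α := by
  rw [← (permCoord_pullB ψ α).2.2.1]
  have := permCoord_eq_of_dualCoord_eq (m := Unit) (c := fun _ => 1) (α' := chartMap φ ψ α)
    (σ' := permB A' π j') (σ := fun _ => permB A π j')
    (α := α.compLinearMap (pullB A R ψ)) (fun _ => by simp [sign_permB])
    (by rw [hodge_chartMap, (dualCoord_pullA φ _).2.1]; simp)
  simpa using this

theorem permCoord_permA_chartMap (φ : Matrix A' A K) (ψ : Matrix B B' K)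
    (α : Alt K (A ⊕ Pad R) (ChartIndex A B R)) (i' : A') :
    permCoord (permA B' π i') (chartMap φ ψ α) = ∑ i, φ i' i * permCoord (permA B π i) α := by
  simp only [← (permCoord_pullB ψ α).2.1]
  exact permCoord_eq_of_dualCoord_eq (fun _ => by simp [sign_permA])
    (by rw [hodge_chartMap, (dualCoord_pullA φ _).2.2.1])

theorem permCoord_permAB_chartMap (φ : Matrix A' A K) (ψ : Matrix B B' K)
    (α : Alt K (A ⊕ Pad R) (ChartIndex A B R)) (i' : A') (j' : B') :
    permCoord (permAB π i' j') (chartMap φ ψ α) =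
      ∑ i, φ i' i * ∑ j, ψ j j' * permCoord (permAB π i j) α := by
  simp only [← (permCoord_pullB ψ α).2.2.2]
  exact permCoord_eq_of_dualCoord_eq (fun _ => by simp [sign_permAB])
    (by rw [hodge_chartMap, (dualCoord_pullA φ _).2.2.2])

end Transport

end

end Plucker

namespace Plucker

open Module

noncomputable section

/-! ### Charts: bounded ranks and nonvanishing pivots -/

section Chart

variable {K : Type u} [Field K] {P : PluckerVariety K}

theorem HasSmallMinor.of_card_le {N : ℕ} {ι I : Type} [Fintype ι] [Fintype I] {α : Alt K ι I}
    (h : α ∉ P.forms ι I) (hι : Fintype.card ι ≤ N) (hI : Fintype.card I ≤ N) :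
    HasSmallMinor P N α := by
  refine .intro (Equiv.emptySum Empty ι).symm hι hI (fun x => x.elim) LinearMap.id fun hmem => h ?_
  convert hmem
  ext v
  simp only [AlternatingMap.compLinearMap_apply, fixLeft_apply, AlternatingMap.domDomCongr_apply]
  rfl

theorem HasSmallMinor.mono {N N' : ℕ} {ι I : Type} [Fintype ι] [Fintype I] {α : Alt K ι I}
    (h : HasSmallMinor P N α) (hN : N ≤ N') : HasSmallMinor P N' α := by
  obtain ⟨c, p, hp, e, z, L, h⟩ := h
  exact .intro e (by simpa using hp.trans hN) (by simpa using hN) z L h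

theorem exists_pivotPerm (R : ℕ) : ∃ p : Fin R → Fin R → Equiv.Perm (Pad R ⊕ Pad R),
    ∀ i j, (∀ q, p i j (Sum.inl (Sum.inl q)) = Sum.inl (Sum.inl q)) ∧
      p i j (Sum.inl (Sum.inr 0)) = Sum.inr (Sum.inl (Sum.inl i)) ∧
      p i j (Sum.inl (Sum.inr 1)) = Sum.inr (Sum.inl (Sum.inr j)) := by
  have h : ∀ i j : Fin R, ∃ p : Equiv.Perm (Pad R ⊕ Pad R),
    (∀ q, p (Sum.inl (Sum.inl q)) = Sum.inl (Sum.inl q)) ∧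
      p (Sum.inl (Sum.inr 0)) = Sum.inr (Sum.inl (Sum.inl i)) ∧
      p (Sum.inl (Sum.inr 1)) = Sum.inr (Sum.inl (Sum.inr j)) := fun i j => by
    let g : Pad R → Pad R ⊕ Pad R := Sum.elim (fun q => Sum.inl (Sum.inl q))
      ![Sum.inr (Sum.inl (Sum.inl i)), Sum.inr (Sum.inl (Sum.inr j))]
    have hg : Function.Injective g := by
      rintro (x | x) (y | y) h
      · simpa [g] using h
      · fin_cases y <;> simp [g] at h
      · fin_cases x <;> simp [g] at h
      · fin_cases x <;> fin_cases y <;> simp [g] at h ⊢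
    obtain ⟨p, hp⟩ := exists_perm_comp_eq (f := Sum.inl) Sum.inl_injective hg
    exact ⟨p, fun q => hp _, hp _, hp _⟩
  choose p hp using h
  exact ⟨p, hp⟩

/-- The pivot involves only coordinates that permute reserved positions, by permutations independent
of A and B. Hence row and column operations leave it unchanged. -/
theorem padPivot_eq {r R : ℕ} (hr : r ≤ R) : ∃ p : Fin r → Fin r → Equiv.Perm (Pad R ⊕ Pad R),
    ∀ (A B : Type) [Fintype A] [Fintype B] [DecidableEq A] [DecidableEq B]
      (α : Alt K (A ⊕ Pad R) (ChartIndex A B R)),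
      padPivot hr (Equiv.refl (ChartIndex A B R)) α =
        (Matrix.of fun i j => permCoord (padPerm A B (p i j)) α).det := by
  obtain ⟨p, hp⟩ := exists_pivotPerm R
  refine ⟨fun i j => p (Fin.castLE hr i) (Fin.castLE hr j), fun A B _ _ _ _ α => ?_⟩
  rw [padPivot, pivot]
  congr 1
  ext i j
  obtain ⟨h1, h2, h3⟩ := hp (Fin.castLE hr i) (Fin.castLE hr j)
  change α _ = α _
  congr 1
  ext1 x
  rcases x with a | q | s
  · rfl
  · simp only [padPerm_inl_inr, h1]
    rfl
  · fin_cases s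
    · simp only [padPerm_inl_inr]
      erw [h2]
      rfl
    · simp only [padPerm_inl_inr]
      erw [h3]
      rfl

theorem padPivot_sumComm_eq {r R : ℕ} (hr : r ≤ R) :
    ∃ p : Fin r → Fin r → Equiv.Perm (Pad R ⊕ Pad R),
    ∀ (A B : Type) [Fintype A] [Fintype B] [DecidableEq A] [DecidableEq B]
      (β : Alt K (B ⊕ Pad R) (ChartIndex A B R)),
      padPivot hr (Equiv.sumComm (B ⊕ Pad R) (A ⊕ Pad R)) β =
        (Matrix.of fun i j => dualCoord (padPerm A B (p i j)) β).det := by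
  obtain ⟨p, hp⟩ := exists_pivotPerm R
  let c := Equiv.sumComm (Pad R) (Pad R)
  refine ⟨fun i j => c.permCongr (p (Fin.castLE hr i) (Fin.castLE hr j)), fun A B _ _ _ _ α => ?_⟩
  rw [padPivot, pivot]
  congr 1
  ext i j
  obtain ⟨h1, h2, h3⟩ := hp (Fin.castLE hr i) (Fin.castLE hr j)
  have hc : ∀ e, c.permCongr (p (Fin.castLE hr i) (Fin.castLE hr j)) (Sum.inr e) =
      c (p (Fin.castLE hr i) (Fin.castLE hr j) (Sum.inl e)) := fun e => rfl
  change α _ = α _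
  congr 1
  ext1 x
  rcases x with a | q | s
  · rfl
  · simp only [padPerm_inr_inr, hc, h1]
    rfl
  · fin_cases s
    · simp only [padPerm_inr_inr, hc]
      erw [h2]
      rfl
    · simp only [padPerm_inr_inr, hc]
      erw [h3]
      rfl

section Structure

variable {A A' B B' : Type} {R r s : ℕ} [Fintype A] [Fintype B] [DecidableEq A] [DecidableEq B]
  [Fintype A'] [Fintype B'] [DecidableEq A'] [DecidableEq B']

/-- The forms for which the rank of all contractions is at most `r`, that of the contractions of
the Hodge dual is at most `s`, and the standard pivots do not vanish. -/
structure IsChart (hr : r ≤ R) (hs : s ≤ R) (α : Alt K (A ⊕ Pad R) (ChartIndex A B R)) :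
    Prop where
  rank : RankLT (r + 1) (splitPair α)
  rank_hodge : RankLT (s + 1) (splitPair (hodge K (Equiv.refl (ChartIndex A B R)) α))
  pivot_ne : padPivot hr (Equiv.refl (ChartIndex A B R)) α ≠ 0
  pivot_hodge_ne : padPivot hs (Equiv.sumComm (B ⊕ Pad R) (A ⊕ Pad R))
    (hodge K (Equiv.refl (ChartIndex A B R)) α) ≠ 0

/-- The rank of the Hodge dual does not grow under pullback. -/
theorem RankLT.hodge_compLinearMap [Infinite K] {m : ℕ} {ι I J : Type} [Fintype ι] [DecidableEq ι]
    [Fintype I] [DecidableEq I] [Fintype J] [DecidableEq J] {ε : ι ⊕ (B ⊕ Pad R) ≃ I}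
    {ε' : ι ⊕ (B' ⊕ Pad R) ≃ J} {α : Alt K ι I} (h : RankLT (m + 1) (splitPair (hodge K ε α)))
    (L : (J → K) →ₗ[K] (I → K)) :
    RankLT (m + 1) (splitPair (hodge K ε' (α.compLinearMap L))) := by
  have h1 := (hodgeRel_hodge ε α).congr (Equiv.refl ι)
    (Equiv.sumAssoc B (Fin R ⊕ Fin R) (Fin 2))
  -- The dual rank condition refers to α itself, hence passes to its pullback; afterwards it is
  -- translated back.
  have h2 := RankLT.dualRankLT one_ne_zero h1 h
  have h3 := (hodgeRel_hodge ε' (α.compLinearMap L)).congr (Equiv.refl ι)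
    (Equiv.sumAssoc B' (Fin R ⊕ Fin R) (Fin 2))
  exact DualRankLT.rankLT one_ne_zero h3 (h2.compLinearMap L)

theorem padPivot_chartMap (hr : r ≤ R) (φ : Matrix A' A K) (ψ : Matrix B B' K)
    (α : Alt K (A ⊕ Pad R) (ChartIndex A B R)) :
    padPivot hr (Equiv.refl (ChartIndex A' B' R)) (chartMap φ ψ α) =
      padPivot hr (Equiv.refl (ChartIndex A B R)) α := by
  obtain ⟨p, hp⟩ := padPivot_eq (K := K) hr
  simp only [hp, permCoord_padPerm_chartMap]

theorem padPivot_hodge_chartMap (hs : s ≤ R) (φ : Matrix A' A K) (ψ : Matrix B B' K)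
    (α : Alt K (A ⊕ Pad R) (ChartIndex A B R)) :
    padPivot hs (Equiv.sumComm (B' ⊕ Pad R) (A' ⊕ Pad R))
      (hodge K (Equiv.refl (ChartIndex A' B' R)) (chartMap φ ψ α)) =
    padPivot hs (Equiv.sumComm (B ⊕ Pad R) (A ⊕ Pad R))
      (hodge K (Equiv.refl (ChartIndex A B R)) α) := by
  obtain ⟨p, hp⟩ := padPivot_sumComm_eq (K := K) hs
  simp only [hp, dualCoord_hodge, permCoord_padPerm_chartMap, sign_padPerm]

theorem IsChart.chartMap [Infinite K] {hr : r ≤ R} {hs : s ≤ R}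
    {α : Alt K (A ⊕ Pad R) (ChartIndex A B R)} (h : IsChart hr hs α) (φ : Matrix A' A K)
    (ψ : Matrix B B' K) : IsChart hr hs (chartMap φ ψ α) where
  rank := by
    have h1 : RankLT (r + 1) (splitPair (α.compLinearMap (pullB A R ψ))) :=
      RankLT.compLinearMap h.rank (pullB A R ψ)
    -- The pulled-back form is the dual of its dual, and `chartMap` pulls back that inner dual, so
    -- the preceding lemma applies with the roles exchanged.
    rw [← hodge_sumComm_hodge (α.compLinearMap (pullB A R ψ))] at h1
    exact h1.hodge_compLinearMap _
  rank_hodge := by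
    rw [hodge_chartMap]
    have h1 := h.rank_hodge.hodge_compLinearMap (ε' := Equiv.refl (ChartIndex A B' R))
      (pullB A R ψ)
    exact RankLT.compLinearMap h1 (pullA B' R φ)
  pivot_ne := by
    rw [padPivot_chartMap]
    exact h.pivot_ne
  pivot_hodge_ne := by
    rw [padPivot_hodge_chartMap]
    exact h.pivot_hodge_ne

theorem chartMap_mem_forms {α : Alt K (A ⊕ Pad R) (ChartIndex A B R)}
    (h : α ∈ P.forms (A ⊕ Pad R) (ChartIndex A B R)) (φ : Matrix A' A K) (ψ : Matrix B B' K) :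
    chartMap φ ψ α ∈ P.forms (A' ⊕ Pad R) (ChartIndex A' B' R) :=
  hodge_mem_forms_iff.2 (PluckerVariety.compLinearMap_mem_forms
    (hodge_mem_forms_iff.2 (PluckerVariety.compLinearMap_mem_forms h _)) _)

theorem HasSmallMinor.of_chartMap [Infinite K] {N : ℕ} {α : Alt K (A ⊕ Pad R) (ChartIndex A B R)}
    {φ : Matrix A' A K} {ψ : Matrix B B' K} (h : HasSmallMinor P N (chartMap φ ψ α)) :
    HasSmallMinor P N α :=
  ((h.of_hodgeRel one_ne_zero (hodgeRel_hodge _ _)).of_compLinearMap.of_hodgeRel one_ne_zero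
    (hodgeRel_hodge _ _)).of_compLinearMap

end Structure

/-! ### Charts as matrix data, and their bounded minors -/

section Data

variable {a b a' b' R r s : ℕ}

/-- The coordinates of a chart as matrices, vectors and scalars. -/
def chartData (hr : r ≤ R) (hs : s ≤ R)
    (α : Alt K (Fin a ⊕ Pad R) (ChartIndex (Fin a) (Fin b) R)) :
    MatData K (Fintype.card (Equiv.Perm (Pad R ⊕ Pad R))) (Equiv.Perm (Pad R ⊕ Pad R))
      (Equiv.Perm (Pad R ⊕ Pad R)) (Equiv.Perm (Pad R ⊕ Pad R) ⊕ Fin 2) a b :=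
  (fun l => Matrix.of fun i j => permCoord (permAB ((Fintype.equivFin _).symm l) i j) α,
    Matrix.of fun i π => permCoord (permA (Fin b) π i) α,
    Matrix.of fun π j => permCoord (permB (Fin a) π j) α,
    Sum.elim (fun π => permCoord (padPerm (Fin a) (Fin b) π) α)
      ![(padPivot hr (Equiv.refl (ChartIndex (Fin a) (Fin b) R)) α)⁻¹,
        (padPivot hs (Equiv.sumComm (Fin b ⊕ Pad R) (Fin a ⊕ Pad R))
          (hodge K (Equiv.refl (ChartIndex (Fin a) (Fin b) R)) α))⁻¹])

theorem chartData_chartMap (hr : r ≤ R) (hs : s ≤ R)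
    (α : Alt K (Fin a ⊕ Pad R) (ChartIndex (Fin a) (Fin b) R))
    (φ : Matrix (Fin a') (Fin a) K) (ψ : Matrix (Fin b) (Fin b') K) :
    chartData hr hs (chartMap φ ψ α) = (chartData hr hs α).minor φ ψ := by
  refine Prod.ext (funext fun l => ?_) (Prod.ext ?_ (Prod.ext ?_ ?_))
  · ext i j
    simp only [chartData, MatData.minor, Matrix.of_apply, permCoord_permAB_chartMap,
      Matrix.mul_apply, Finset.mul_sum, Finset.sum_mul]
    rw [Finset.sum_comm]
    exact Finset.sum_congr rfl fun _ _ => Finset.sum_congr rfl fun _ _ => by ring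
  · ext i π
    simp only [chartData, MatData.minor, Matrix.of_apply, permCoord_permA_chartMap,
      Matrix.mul_apply]
  · ext π j
    simp only [chartData, MatData.minor, Matrix.of_apply, permCoord_permB_chartMap,
      Matrix.mul_apply]
    exact Finset.sum_congr rfl fun _ _ => by ring
  · simp only [chartData, MatData.minor, permCoord_padPerm_chartMap, padPivot_chartMap,
      padPivot_hodge_chartMap]

theorem exists_dual_eq_sum {ι I : Type} [Fintype ι] [DecidableEq ι] [Fintype I] [DecidableEq I]
    (l : Dual K (Alt K ι I)) :
    ∃ c : (ι → I) → K, ∀ α, l α = ∑ g, c g * coord g α := by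
  let T : Alt K ι I →ₗ[K] ((ι → I) → K) :=
    { toFun := fun α g => coord g α, map_add' := fun _ _ => rfl, map_smul' := fun _ _ => rfl }
  have hT : LinearMap.ker T = ⊥ := by
    refine LinearMap.ker_eq_bot'.2 fun α hα => Basis.ext_alternating (Pi.basisFun K I)
      fun g _ => ?_
    have h1 : coord g α = 0 := congr_fun hα g
    simpa [coord] using h1
  obtain ⟨S, hS⟩ := T.exists_leftInverse_of_injective hT
  refine ⟨fun g => l (S (Pi.single g 1)), fun α => ?_⟩
  have h1 : S (T α) = α := LinearMap.congr_fun hS α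
  conv_lhs => rw [← h1, ← Finset.univ_sum_single (T α), map_sum, map_sum]
  refine Finset.sum_congr rfl fun g _ => ?_
  have h2 : (Pi.single g (T α g) : (ι → I) → K) = (T α g) • Pi.single g 1 := by
    rw [← Pi.single_smul, smul_eq_mul, mul_one]
  rw [h2, map_smul, map_smul, smul_eq_mul, mul_comm]
  rfl

theorem polyFun_comp_mem {Ω : Type*} {ι I : Type} [Fintype ι] [DecidableEq ι] [Fintype I]
    [DecidableEq I] {C : Subalgebra K (Ω → K)} {α : Ω → Alt K ι I}
    (h : ∀ g, (fun ω => coord g (α ω)) ∈ C) {f : Alt K ι I → K} (hf : f ∈ polyFun K (Alt K ι I)) :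
    (fun ω => f (α ω)) ∈ C := by
  induction hf using Algebra.adjoin_induction with
  | mem x hx =>
    obtain ⟨l, rfl⟩ := hx
    obtain ⟨c, hc⟩ := exists_dual_eq_sum l
    have : (fun ω => l (α ω)) = ∑ g, c g • fun ω => coord g (α ω) := by
      ext ω
      simp [hc]
    rw [this]
    exact C.sum_mem fun g _ => C.smul_mem (h g) _
  | algebraMap c => exact C.algebraMap_mem c
  | add x y _ _ hx hy => exact C.add_mem hx hy
  | mul x y _ _ hx hy => exact C.mul_mem hx hy

/-- The closures of the sets of coordinates of charts in a Plücker variety. -/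
def chartFamily (P : PluckerVariety K) (hr : r ≤ R) (hs : s ≤ R) (a b : ℕ) :
    Set (MatData K (Fintype.card (Equiv.Perm (Pad R ⊕ Pad R))) (Equiv.Perm (Pad R ⊕ Pad R))
      (Equiv.Perm (Pad R ⊕ Pad R)) (Equiv.Perm (Pad R ⊕ Pad R) ⊕ Fin 2) a b) :=
  zClosure (K := K) (chartData hr hs '' {α | IsChart hr hs α ∧
    α ∈ P.forms (Fin a ⊕ Pad R) (ChartIndex (Fin a) (Fin b) R)})

theorem isClosedFamily_chartFamily [Infinite K] (hr : r ≤ R) (hs : s ≤ R) :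
    IsClosedFamily (chartFamily P hr hs) where
  closed _ _ := zClosed_zClosure _
  minor_mem φ ψ d hd f hf h0 := hd _ ((MatData.isPolyMap_minor φ ψ).comp_mem hf) <| by
    rintro _ ⟨α, ⟨h1, h2⟩, rfl⟩
    exact h0 _ ⟨_, ⟨h1.chartMap φ ψ, chartMap_mem_forms h2 φ ψ⟩, chartData_chartMap hr hs α φ ψ⟩

/-- All coordinates of a chart are fixed polynomials in its data, which include the inverse pivots.
A polynomial separating α from the variety therefore becomes a polynomial in the data, vanishing on
the data of charts in the variety but not on that of α. -/
theorem IsChart.chartData_notMem [Infinite K] {hr : r ≤ R} {hs : s ≤ R}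
    {α : Alt K (Fin a ⊕ Pad R) (ChartIndex (Fin a) (Fin b) R)} (h : IsChart hr hs α)
    (hα : α ∉ P.forms (Fin a ⊕ Pad R) (ChartIndex (Fin a) (Fin b) R)) :
    chartData hr hs α ∉ chartFamily P hr hs a b := fun hmem => by
  let Ω := {α : Alt K (Fin a ⊕ Pad R) (ChartIndex (Fin a) (Fin b) R) // IsChart hr hs α}
  let D := MatData K (Fintype.card (Equiv.Perm (Pad R ⊕ Pad R))) (Equiv.Perm (Pad R ⊕ Pad R))
      (Equiv.Perm (Pad R ⊕ Pad R)) (Equiv.Perm (Pad R ⊕ Pad R) ⊕ Fin 2) a b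
  let T : (D → K) →ₐ[K] (Ω → K) := AlgHom.pi fun ω =>
    Pi.evalAlgHom K (fun _ : D => K) (chartData hr hs ω.1)
  -- The functions on charts that factor polynomially through their data.
  let C : Subalgebra K (Ω → K) := (polyFun K D).map T
  have lin : ∀ f : D → K, IsLinearMap K f → (fun ω : Ω => f (chartData hr hs ω.1)) ∈ C :=
    fun f hf => ⟨f, isLinearMap_mem_polyFun hf, rfl⟩
  have hcoord := coord_mem_of_near (Ω := Ω) (a := fun ω => ω.1) (C := C) hr hs
    (fun ω => ω.2.rank) (fun ω => ω.2.pivot_ne)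
    (lin (fun d => d.2.2.2 (Sum.inr 0)) ⟨fun _ _ => rfl, fun _ _ => rfl⟩)
    (fun ω => ω.2.rank_hodge) (fun ω => ω.2.pivot_hodge_ne)
    (lin (fun d => d.2.2.2 (Sum.inr 1)) ⟨fun _ _ => rfl, fun _ _ => rfl⟩)
    (fun g hg h1 h2 => coord_mem_of_permCoord
      (fun π => lin (fun d => d.2.2.2 (Sum.inl π)) ⟨fun _ _ => rfl, fun _ _ => rfl⟩)
      (fun π i => lin (fun d => d.2.1 i π) ⟨fun _ _ => rfl, fun _ _ => rfl⟩)
      (fun π j => lin (fun d => d.2.2.1 π j) ⟨fun _ _ => rfl, fun _ _ => rfl⟩)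
      (fun π i j => by
        have := lin (fun d => d.1 (Fintype.equivFin _ π) i j) ⟨fun _ _ => rfl, fun _ _ => rfl⟩
        simpa [chartData] using this) hg h1 h2)
  obtain ⟨f, hf, hf0, hf1⟩ := P.zClosed_forms α hα
  obtain ⟨q, hq, hqf⟩ := polyFun_comp_mem hcoord hf
  have hq' : ∀ ω : Ω, q (chartData hr hs ω.1) = f ω.1 := fun ω => congr_fun hqf ω
  refine hf1 ?_
  rw [← hq' ⟨α, h⟩]
  refine hmem q hq ?_
  rintro _ ⟨α', ⟨h1, h2⟩, rfl⟩
  rw [hq' ⟨α', h1⟩]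
  exact hf0 _ h2

/-- Charts outside a Plücker variety have a minor of bounded size outside the variety. -/
theorem IsChart.exists_hasSmallMinor [Infinite K] (P : PluckerVariety K) (hr : r ≤ R)
    (hs : s ≤ R) : ∃ N, ∀ (a b : ℕ) (α : Alt K (Fin a ⊕ Pad R) (ChartIndex (Fin a) (Fin b) R)),
      IsChart hr hs α → α ∉ P.forms (Fin a ⊕ Pad R) (ChartIndex (Fin a) (Fin b) R) →
        HasSmallMinor P N α := by
  obtain ⟨m, hm⟩ := (isClosedFamily_chartFamily (P := P) hr hs).exists_bound
  -- The dimension of the space carrying a chart whose matrices have size at most m.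
  refine ⟨2 * (m + Fintype.card (Pad R)), fun a b α h hα => ?_⟩
  obtain ⟨a', b', ha', hb', φ, ψ, hnot⟩ := hm a b _ (h.chartData_notMem hα)
  refine HasSmallMinor.of_chartMap (φ := φ) (ψ := ψ) (.of_card_le (fun hmem => hnot ?_) ?_ ?_)
  · rw [← chartData_chartMap]
    exact subset_zClosure _ ⟨_, ⟨h.chartMap φ ψ, hmem⟩, rfl⟩
  · rw [Fintype.card_sum (α := Fin a') (β := Pad R), Fintype.card_fin]
    omega
  · rw [Fintype.card_sum (α := Fin a' ⊕ Pad R) (β := Fin b' ⊕ Pad R),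
      Fintype.card_sum (α := Fin a') (β := Pad R), Fintype.card_sum (α := Fin b') (β := Pad R),
      Fintype.card_fin, Fintype.card_fin]
    omega

end Data

end Chart

end

end Plucker

namespace Plucker

open Module

noncomputable section

/-! ### Generic pullbacks to charts, and the uniform bound on minors -/

section GenericChart

variable {K : Type u} [Field K] {P : PluckerVariety K} {A B I : Type} {R r s : ℕ}

theorem HasSmallMinor.of_domDomCongr {N : ℕ} {ι ι' : Type} [Fintype ι] [Fintype ι']
    {α : Alt K ι I} (e : ι ≃ ι') (h : HasSmallMinor P N (α.domDomCongr e)) :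
    HasSmallMinor P N α := by
  obtain ⟨c, p, hp, e', z, L, h⟩ := h
  exact ⟨c, p, hp, e.trans e', z, L, h⟩

theorem HasSmallMinor.domDomCongr {N : ℕ} {ι ι' : Type} [Fintype ι] [Fintype ι']
    {α : Alt K ι I} (h : HasSmallMinor P N α) (e : ι ≃ ι') :
    HasSmallMinor P N (α.domDomCongr e) := by
  refine HasSmallMinor.of_domDomCongr e.symm ?_
  convert h
  ext v
  simp [Function.comp_def]

/-- The minimal bound is positive because the empty minor equals 1, so r is the largest rank
attained. -/
theorem exists_rankLT_succ {γ : Type} {m : ℕ} {α : Alt K (γ ⊕ Fin 2) I} (h : RankLT m α) :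
    ∃ r ≤ m, ¬ RankLT r α ∧ RankLT (r + 1) α := by
  classical
  have hex : ∃ k, RankLT k α := ⟨m, h⟩
  obtain ⟨r, hr⟩ : ∃ r, Nat.find hex = r + 1 := Nat.exists_eq_succ_of_ne_zero fun h0 => by
    have := Nat.find_spec hex
    rw [h0] at this
    have := this 0 0 0
    simp at this
  refine ⟨r, ?_, Nat.find_min hex (by omega), hr ▸ Nat.find_spec hex⟩
  have := Nat.find_min' hex h
  omega

variable [DecidableEq I]

theorem padPivot_mem_polyFun (hr : r ≤ R) (ε : (A ⊕ Pad R) ⊕ (B ⊕ Pad R) ≃ I) :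
    padPivot (K := K) hr ε ∈ polyFun K (Alt K (A ⊕ Pad R) I) :=
  det_mem_polyFun fun _ _ => isLinearMap_mem_polyFun ⟨fun _ _ => rfl, fun _ _ => rfl⟩

theorem padPivot_smul (hr : r ≤ R) (ε : (A ⊕ Pad R) ⊕ (B ⊕ Pad R) ≃ I) (c : K)
    (α : Alt K (A ⊕ Pad R) I) : padPivot hr ε (c • α) = c ^ r * padPivot hr ε α := by
  rw [padPivot, padPivot, pivot, pivot]
  rw [show splitPair (c • α) = c • splitPair α from rfl]
  have := Matrix.det_smul (Matrix.of fun i j : Fin r => coord (Sum.elim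
    (fun k => ε (Sum.inl (Sum.map id Sum.inl k)))
    ![ε (Sum.inr (Sum.inr (Sum.inl (Sum.inl (Fin.castLE hr i))))),
      ε (Sum.inr (Sum.inr (Sum.inl (Sum.inr (Fin.castLE hr j)))))]) (splitPair α)) c
  rw [Fintype.card_fin] at this
  rw [← this]
  rfl

variable [Fintype I]

/-- Map the standard basis vectors to the contracting vectors and to the rows and columns of a
nonvanishing minor; unused positions go to zero. -/
theorem exists_padPivot_ne_zero (hr : r ≤ R) (ε : (A ⊕ Pad R) ⊕ (B ⊕ Pad R) ≃ I)
    {α : Alt K (A ⊕ Pad R) I} (h : ¬ RankLT r (splitPair α)) :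
    ∃ y : I → I → K, padPivot hr ε (α.compLinearMap (Fintype.linearCombination K y)) ≠ 0 := by
  simp only [RankLT, PairLT, not_forall] at h
  obtain ⟨z, X, Y, h⟩ := h
  let ext (X : Fin r → I → K) (i : Fin R) : I → K := if h : i < r then X ⟨i, h⟩ else 0
  have hext : ∀ X i, ext X (Fin.castLE hr i) = X i := fun X i => by simp [ext]
  let w : (A ⊕ Pad R) ⊕ (B ⊕ Pad R) → I → K :=
    Sum.elim (Sum.elim (fun a => z (Sum.inl a)) (Sum.elim (fun q => z (Sum.inr q)) 0))
      (Sum.elim 0 (Sum.elim (Sum.elim (ext X) (ext Y)) 0))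
  refine ⟨fun i => w (ε.symm i), ?_⟩
  convert h using 1
  rw [padPivot, pivot]
  congr 1
  ext i j
  change α _ = α _
  congr 1
  ext1 k
  rcases k with a | q | t
  · simp [w, Fintype.linearCombination_apply_single, Equiv.sumAssoc]
  · simp [w, Fintype.linearCombination_apply_single, Equiv.sumAssoc]
  · fin_cases t <;> simp [w, Fintype.linearCombination_apply_single, Equiv.sumAssoc, hext]

theorem HodgeRel.comp_dual {ι κ : Type} {c : K} {ε : ι ⊕ κ ≃ I} {α : Alt K ι I} {β : Alt K κ I}
    (h : HodgeRel c ε α β) {G H : Matrix I I K} (hGH : G * H.transpose = 1) :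
    HodgeRel (c * G.det) ε (α.compLinearMap (Fintype.linearCombination K G))
      (β.compLinearMap (Fintype.linearCombination K H)) := fun G' H' hGH' => by
  have key := h (G' * G) (H' * H) (by
    rw [Matrix.transpose_mul, Matrix.mul_assoc, ← Matrix.mul_assoc G, hGH, Matrix.one_mul, hGH'])
  have hrow : ∀ (A M : Matrix I I K) x, (A * M) x = Fintype.linearCombination K M (A x) :=
    fun A M x => by
      ext i
      have h1 : Fintype.linearCombination K M (A x) = ∑ j, A x j • (fun k => M j k : I → K) := rfl
      refine Matrix.mul_apply.trans (Eq.trans ?_ (congr_fun h1 i).symm)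
      rw [Finset.sum_apply]
      rfl
  simp only [hrow, Matrix.det_mul] at key
  rw [mul_comm G'.det, ← mul_assoc] at key
  exact key

variable [Fintype A] [Fintype B] [DecidableEq A] [DecidableEq B] [Infinite K]

/-- A generic pullback of a form outside a Plücker variety with given ranks is a chart. -/
theorem exists_isChart_compLinearMap (hr : r ≤ R) (hs : s ≤ R)
    {α : Alt K (A ⊕ Pad R) (ChartIndex A B R)}
    (hα : α ∉ P.forms (A ⊕ Pad R) (ChartIndex A B R)) (hr1 : ¬ RankLT r (splitPair α))
    (hr2 : RankLT (r + 1) (splitPair α))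
    (hs1 : ¬ RankLT s (splitPair (hodge K (Equiv.refl (ChartIndex A B R)) α)))
    (hs2 : RankLT (s + 1) (splitPair (hodge K (Equiv.refl (ChartIndex A B R)) α))) :
    ∃ L : (ChartIndex A B R → K) →ₗ[K] (ChartIndex A B R → K), IsChart hr hs (α.compLinearMap L) ∧
      α.compLinearMap L ∉ P.forms (A ⊕ Pad R) (ChartIndex A B R) := by
  have hpoly := isPolyMap_compLinearMap (J := ChartIndex A B R) α
  have hp1 := hpoly.comp_mem (padPivot_mem_polyFun hr (Equiv.refl (ChartIndex A B R)))
  have hp2 := (hpoly.linear_comp (hodge K (Equiv.refl (ChartIndex A B R)))).comp_mem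
    (padPivot_mem_polyFun hs (Equiv.sumComm (B ⊕ Pad R) (A ⊕ Pad R)))
  have h1 := exists_padPivot_ne_zero hr (Equiv.refl (ChartIndex A B R)) hr1
  have h2 : ∃ y : ChartIndex A B R → ChartIndex A B R → K,
      padPivot hs (Equiv.sumComm (B ⊕ Pad R) (A ⊕ Pad R))
        (hodge K (Equiv.refl (ChartIndex A B R))
          (α.compLinearMap (Fintype.linearCombination K y))) ≠ 0 := by
    -- A generic H makes the pivot of the pulled-back dual nonzero and is also invertible. This
    -- pullback is then, up to a nonzero scalar, the dual of the pullback of α along the inverse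
    -- transpose of H.
    obtain ⟨H, hH1, hH2⟩ := polyFun_exists_ne_zero_and
      ((isPolyMap_compLinearMap (J := ChartIndex A B R)
        (hodge K (Equiv.refl (ChartIndex A B R)) α)).comp_mem
        (padPivot_mem_polyFun hs (Equiv.sumComm (B ⊕ Pad R) (A ⊕ Pad R))))
      (g := fun H : ChartIndex A B R → ChartIndex A B R → K => Matrix.det (Matrix.of H))
      (det_mem_polyFun fun i j => isLinearMap_mem_polyFun ⟨fun _ _ => rfl, fun _ _ => rfl⟩)
      (exists_padPivot_ne_zero hs (Equiv.sumComm (B ⊕ Pad R) (A ⊕ Pad R)) hs1)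
      ⟨(1 : Matrix (ChartIndex A B R) (ChartIndex A B R) K), by
        change Matrix.det (1 : Matrix (ChartIndex A B R) (ChartIndex A B R) K) ≠ 0
        simp⟩
    obtain ⟨H, rfl⟩ : ∃ H' : Matrix (ChartIndex A B R) (ChartIndex A B R) K, H' = H := ⟨_, rfl⟩
    have hGH : (H⁻¹).transpose * H.transpose = 1 := by
      rw [← Matrix.transpose_mul, Matrix.mul_nonsing_inv H (isUnit_iff_ne_zero.2 hH2),
        Matrix.transpose_one]
    have h3 := ((hodgeRel_hodge (Equiv.refl (ChartIndex A B R)) α).comp_dual hGH).hodge_eq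
    refine ⟨(H⁻¹).transpose, ?_⟩
    rw [h3, padPivot_smul]
    exact mul_ne_zero (pow_ne_zero _ (mul_ne_zero one_ne_zero (det_ne_zero_of_mul_transpose hGH)))
      hH1
  obtain ⟨g, hg, hg1, hg2⟩ := (P.zClosed_forms.preimage hpoly) (fun j => Pi.single j 1) fun hmem => hα (by
    have h4 : Fintype.linearCombination K (fun j => (Pi.single j 1 : ChartIndex A B R → K)) =
      LinearMap.id := eq_linearCombination LinearMap.id
    have h5 : α.compLinearMap (Fintype.linearCombination K fun j : ChartIndex A B R =>
      (Pi.single j 1 : ChartIndex A B R → K)) ∈ P.forms _ _ := hmem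
    rwa [h4] at h5)
  -- Two nonvanishing pivots and nonmembership are nonempty open conditions on the linear map; over
  -- an infinite field they hold simultaneously.
  obtain ⟨y₁, hy₁⟩ := polyFun_exists_ne_zero_and hp1 hp2 h1 h2
  obtain ⟨y, hy1, hy2⟩ := polyFun_exists_ne_zero_and (Subalgebra.mul_mem _ hp1 hp2) hg
    ⟨y₁, mul_ne_zero hy₁.1 hy₁.2⟩ ⟨_, hg2⟩
  exact ⟨Fintype.linearCombination K y, ⟨hr2.compLinearMap _, hs2.hodge_compLinearMap _,
    left_ne_zero_of_mul hy1, right_ne_zero_of_mul hy1⟩, fun hmem => hy2 (hg1 y hmem)⟩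

/-- If the form or its dual has a contraction of rank at least R, boundedness gives a small minor.
Otherwise only finitely many pairs of ranks occur, and the bounds for the corresponding charts are
combined by a maximum. -/
theorem PluckerVariety.IsBounded.exists_hasSmallMinor_pad (hP : P.IsBounded) :
    ∃ R N : ℕ, ∀ (a b : ℕ) (α : Alt K (Fin a ⊕ Pad R) (ChartIndex (Fin a) (Fin b) R)),
      α ∉ P.forms (Fin a ⊕ Pad R) (ChartIndex (Fin a) (Fin b) R) → HasSmallMinor P N α := by
  obtain ⟨R, N₀, h₀⟩ := hP.exists_rankLT
  choose F hF using fun x : Fin (R + 1) × Fin (R + 1) =>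
    IsChart.exists_hasSmallMinor P (Nat.lt_succ_iff.1 x.1.2) (Nat.lt_succ_iff.1 x.2.2)
  refine ⟨R, max N₀ (Finset.univ.sup F), fun a b α hα => ?_⟩
  by_cases h1 : RankLT R (splitPair α)
  · by_cases h2 : RankLT R (splitPair (hodge K (Equiv.refl (ChartIndex (Fin a) (Fin b) R)) α))
    · obtain ⟨r, hr, hr1, hr2⟩ := exists_rankLT_succ h1
      obtain ⟨s, hs, hs1, hs2⟩ := exists_rankLT_succ h2
      obtain ⟨L, hL, hL'⟩ := exists_isChart_compLinearMap hr hs hα hr1 hr2 hs1 hs2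
      exact ((hF (⟨r, by omega⟩, ⟨s, by omega⟩) a b _ hL hL').mono
        ((Finset.le_sup (f := F) (Finset.mem_univ _)).trans (le_max_right _ _))).of_compLinearMap
    · exact ((((h₀ _ _ _ h2).of_domDomCongr _).of_hodgeRel one_ne_zero
        (hodgeRel_hodge _ _))).mono (le_max_left _ _)
  · exact ((h₀ _ _ _ h1).of_domDomCongr _).mono (le_max_left _ _)

/-- Forms outside a bounded Plücker variety have a minor of bounded size outside the variety. -/
theorem PluckerVariety.IsBounded.exists_hasSmallMinor (hP : P.IsBounded) :
    ∃ N : ℕ, ∀ (p n : ℕ) (I : Type) [Fintype I] (α : Alt K (Fin p) I),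
      Fintype.card I = p + n → α ∉ P.forms (Fin p) I → HasSmallMinor P N α := by
  classical
  obtain ⟨R, N, h⟩ := hP.exists_hasSmallMinor_pad
  refine ⟨N, fun p n I _ α hI hα => ?_⟩
  have notMem : ∀ {κ J J' : Type} [Fintype κ] [Fintype J] [Fintype J'] {α : Alt K κ J}
      {i : (J → K) →ₗ[K] (J' → K)} {q : (J' → K) →ₗ[K] (J → K)}, q ∘ₗ i = LinearMap.id →
      α ∉ P.forms κ J → α.compLinearMap q ∉ P.forms κ J' := fun {κ J J'} _ _ _ α i q hq hα hmem =>
    hα (by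
      have := PluckerVariety.compLinearMap_mem_forms hmem i
      rwa [compLinearMap_compLinearMap, hq] at this)
  -- Room for the reserved positions: pulling back along a retraction enlarges the dimension without
  -- adding arguments. Doing this for the form and then for its dual adds them on both sides, and
  -- nonmembership is kept throughout.
  obtain ⟨i, q, hq⟩ := exists_linearMap_leftInverse (K := K) (J := I)
    (I := Fin p ⊕ (Fin n ⊕ Pad R)) (by simp; omega)
  obtain ⟨i', q', hq'⟩ := exists_linearMap_leftInverse (K := K)
    (J := Fin p ⊕ (Fin n ⊕ Pad R)) (I := (Fin p ⊕ Pad R) ⊕ (Fin n ⊕ Pad R)) (by simp)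
  let β := hodge K (Equiv.refl (Fin p ⊕ (Fin n ⊕ Pad R))) (α.compLinearMap q)
  have hβ : β ∉ P.forms _ _ := fun hmem => notMem hq hα (hodge_mem_forms_iff.1 hmem)
  have := h p n (hodge K (Equiv.sumComm (Fin n ⊕ Pad R) (Fin p ⊕ Pad R)) (β.compLinearMap q'))
    fun hmem => notMem hq' hβ (hodge_mem_forms_iff.1 hmem)
  exact (((this.of_hodgeRel one_ne_zero (hodgeRel_hodge _ _)).of_compLinearMap).of_hodgeRel
    one_ne_zero (hodgeRel_hodge _ _)).of_compLinearMap

end GenericChart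

end

end Plucker

namespace Plucker

open Module

noncomputable section

/-! ### Contractions with an exact number of vectors -/

section Contraction

variable {K : Type u} [Field K] {P : PluckerVariety K} {N : ℕ} {γ ι κ I J : Type}

/-- The scalar is absorbed by the normalisation of a Hodge dual: dualise, and dualise back with
another constant. -/
theorem PluckerVariety.smul_mem_forms [Fintype ι] [Fintype I] {α : Alt K ι I}
    (h : α ∈ P.forms ι I) {c : K} (hc : c ≠ 0) : c • α ∈ P.forms ι I := by
  classical
  rcases lt_or_ge (Fintype.card I) (Fintype.card ι) with hlt | hle
  · rw [Alt.eq_zero_of_card_lt (α := α) hlt] at h ⊢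
    rwa [smul_zero]
  · let ε : Fin (Fintype.card I - Fintype.card ι) ⊕ ι ≃ I :=
      Fintype.equivOfCardEq (by rw [Fintype.card_sum, Fintype.card_fin]; omega)
    have h1 : HodgeRel 1 ε (hodge K ((Equiv.sumComm _ _).trans ε) α) α := by
      have := hodgeRel_hodge ε (hodge K ((Equiv.sumComm _ _).trans ε) α)
      rwa [hodge_hodge'] at this
    have h2 : HodgeRel c⁻¹ ε (hodge K ((Equiv.sumComm _ _).trans ε) α) (c • α) :=
      HodgeRel.smul_right (by rwa [inv_mul_cancel₀ hc])
    exact h2.mem_forms (inv_ne_zero hc) ((h1.mem_forms_iff one_ne_zero).2 h)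

/-- Extension by zero. -/
def extendInr (K : Type u) [Field K] (γ J : Type) [Fintype J] [DecidableEq γ] [DecidableEq J] :
    (J → K) →ₗ[K] (γ ⊕ J → K) :=
  Fintype.linearCombination K fun j => Pi.single (Sum.inr j) 1

/-- Contraction with the first standard basis vectors, restricted to the span of the others. -/
def contractInl (K : Type u) [Field K] (γ ι J : Type) [Fintype J] [DecidableEq γ]
    [DecidableEq J] : Alt K (γ ⊕ ι) (γ ⊕ J) →ₗ[K] Alt K ι J where
  toFun α := (fixLeft α fun k => Pi.single (Sum.inl k) 1).compLinearMap (extendInr K γ J)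
  map_add' _ _ := rfl
  map_smul' _ _ := rfl

variable [Fintype J] [DecidableEq γ] [DecidableEq J]

theorem contractInl_compLinearMap (α : Alt K (γ ⊕ ι) I) (M : (γ ⊕ J → K) →ₗ[K] (I → K)) :
    contractInl K γ ι J (α.compLinearMap M) =
      (fixLeft α fun k => M (Pi.single (Sum.inl k) 1)).compLinearMap (M ∘ₗ extendInr K γ J) := by
  change (fixLeft (α.compLinearMap M) _).compLinearMap _ = _
  rw [fixLeft_compLinearMap]
  rfl

variable [Fintype γ] [Fintype ι] [Fintype κ] [Fintype I]

theorem contractInl_mem_forms {α : Alt K (γ ⊕ ι) (γ ⊕ J)} (h : α ∈ P.forms (γ ⊕ ι) (γ ⊕ J)) :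
    contractInl K γ ι J α ∈ P.forms ι J :=
  PluckerVariety.compLinearMap_mem_forms (PluckerVariety.fixLeft_mem_forms h _) _

/-- A contraction with standard basis vectors is determined by its restriction to the span of the
others. -/
theorem fixLeft_single_eq (α : Alt K (γ ⊕ ι) (γ ⊕ J)) :
    (fixLeft α fun k => Pi.single (Sum.inl k) 1) =
      (contractInl K γ ι J α).compLinearMap (LinearMap.funLeft K K Sum.inr) := by
  refine Basis.ext_alternating (Pi.basisFun K (γ ⊕ J)) fun f _ => ?_
  simp only [Pi.basisFun_apply]
  change _ = (fixLeft α fun k => Pi.single (Sum.inl k) 1) fun i =>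
    extendInr K γ J (LinearMap.funLeft K K Sum.inr (Pi.single (f i) 1))
  by_cases hf : ∃ i k, f i = Sum.inl k
  · obtain ⟨i, k, hk⟩ := hf
    rw [fixLeft_apply, α.map_eq_zero_of_eq _ (i := Sum.inl k) (j := Sum.inr i) (by simp [hk])
      (by simp), AlternatingMap.map_coord_zero _ i]
    have : LinearMap.funLeft K K Sum.inr (Pi.single (f i) 1 : γ ⊕ J → K) = (0 : J → K) := by
      ext j
      simp [LinearMap.funLeft_apply, hk]
    rw [this, map_zero]
  · congr 1
    ext1 i
    obtain ⟨j, hj⟩ : ∃ j, f i = Sum.inr j := by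
      rcases hx : f i with k | j
      · exact absurd ⟨i, k, hx⟩ hf
      · exact ⟨j, rfl⟩
    have : LinearMap.funLeft K K Sum.inr (Pi.single (f i) 1 : γ ⊕ J → K) =
        (Pi.single j 1 : J → K) := by
      ext j'
      simp [LinearMap.funLeft_apply, hj, Pi.single_apply]
    rw [this, hj, extendInr, Fintype.linearCombination_apply_single, one_smul]

/-- The hypothesis on κ gives p ≤ |κ|, so the contraction can be done in two stages, the first using
exactly γ vectors. The reordering of arguments costs a sign, which is harmless by `smul_mem_forms`.
-/
theorem HasSmallMinor.exists_fixLeft {α : Alt K (γ ⊕ κ) I} (h : HasSmallMinor P N α)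
    (hκ : min (Fintype.card (γ ⊕ κ)) N ≤ Fintype.card κ) :
    ∃ (d p : ℕ) (g : κ ≃ Fin d ⊕ Fin p) (z : γ → I → K) (z' : Fin d → I → K)
      (L : (Fin N → K) →ₗ[K] (I → K)),
      (fixLeft ((fixLeft α z).domDomCongr g) z').compLinearMap L ∉ P.forms (Fin p) (Fin N) := by
  classical
  obtain ⟨c, p, hp, e, z, L, h⟩ := h
  have hc := Fintype.card_congr e
  simp only [Fintype.card_sum, Fintype.card_fin] at hc hκ
  let g : κ ≃ Fin (Fintype.card κ - p) ⊕ Fin p :=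
    Fintype.equivOfCardEq (by simp only [Fintype.card_sum, Fintype.card_fin]; omega)
  let f : γ ⊕ Fin (Fintype.card κ - p) ≃ Fin c :=
    Fintype.equivOfCardEq (by simp only [Fintype.card_sum, Fintype.card_fin]; omega)
  let e' : Fin c ⊕ Fin p ≃ γ ⊕ κ := ((Equiv.sumCongr f.symm (Equiv.refl _)).trans
    (Equiv.sumAssoc _ _ _)).trans (Equiv.sumCongr (Equiv.refl _) g.symm)
  refine ⟨_, p, g, fun k => z (f (Sum.inl k)), fun k => z (f (Sum.inr k)), L, fun hmem => h ?_⟩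
  have h1 : α.domDomCongr (e.trans e') = Equiv.Perm.sign (e.trans e') • α := by
    ext v
    exact α.map_perm v (e.trans e')
  have h2 : (fixLeft (α.domDomCongr e) z).compLinearMap L =
      ((Equiv.Perm.sign (e.trans e') : ℤ) : K) •
      (fixLeft ((fixLeft α fun k => z (f (Sum.inl k))).domDomCongr g)
        fun k => z (f (Sum.inr k))).compLinearMap L := by
    ext v
    have h3 := congr_arg (fun β => β (Sum.elim z (fun i => L (v i)) ∘ e'.symm)) h1
    simp only [AlternatingMap.domDomCongr_apply, AlternatingMap.smul_apply, Units.smul_def,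
      zsmul_eq_mul] at h3
    simp only [AlternatingMap.domDomCongr_apply, AlternatingMap.smul_apply, smul_eq_mul,
      AlternatingMap.compLinearMap_apply, fixLeft_apply]
    convert h3 using 2
    · ext1 x
      simp
    · congr 1
      ext1 x
      rcases x with k | k
      · simp [e']
      · rcases hx : g k with y | y <;> simp [e', hx]
  rw [h2]
  exact PluckerVariety.smul_mem_forms hmem (sign_cast_ne_zero _)

variable [DecidableEq I]

/-- The projections contract with basis vectors and restrict to a complementary coordinate subspace.
Nothing is lost if that subspace can accommodate the remaining contracting vectors together with
K^N, or if it is a full complement. -/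
theorem HasSmallMinor.exists_contractInl_notMem {α : Alt K (γ ⊕ κ) I} (h : HasSmallMinor P N α)
    (hκ : min (Fintype.card (γ ⊕ κ)) N ≤ Fintype.card κ)
    (hJ : N + Fintype.card κ ≤ Fintype.card J ∨ Fintype.card (γ ⊕ J) = Fintype.card I) :
    ∃ M : (γ ⊕ J → K) →ₗ[K] (I → K),
      contractInl K γ κ J (α.compLinearMap M) ∉ P.forms κ J := by
  obtain ⟨d, p, g, z, z', L, h⟩ := h.exists_fixLeft hκ
  rcases hJ with hJ | hJ
  · have hg := Fintype.card_congr g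
    simp only [Fintype.card_sum, Fintype.card_fin] at hg
    obtain ⟨i, q, hq⟩ := exists_linearMap_leftInverse (K := K) (J := Fin d ⊕ Fin N) (I := J)
      (by simp only [Fintype.card_sum, Fintype.card_fin]; omega)
    let L' : (Fin d ⊕ Fin N → K) →ₗ[K] (I → K) :=
      Fintype.linearCombination K (Sum.elim z' fun x => L (Pi.single x 1))
    let M : (γ ⊕ J → K) →ₗ[K] (I → K) :=
      Fintype.linearCombination K (Sum.elim z fun j => L' (q (Pi.single j 1)))
    have hM : M ∘ₗ extendInr K γ J = L' ∘ₗ q := by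
      refine (Pi.basisFun K J).ext fun j => ?_
      simp [M, extendInr, Fintype.linearCombination_apply_single]
    have hz : (fun k => M (Pi.single (Sum.inl k) 1)) = z := by
      ext1 k
      simp [M, Fintype.linearCombination_apply_single]
    have hL' : L' ∘ₗ extendInr K (Fin d) (Fin N) = L := by
      refine (Pi.basisFun K (Fin N)).ext fun j => ?_
      simp [L', extendInr, Fintype.linearCombination_apply_single]
    have hz' : (fun k => L' (Pi.single (Sum.inl k) 1)) = z' := by
      ext1 k
      simp [L', Fintype.linearCombination_apply_single]
    refine ⟨M, fun hmem => h ?_⟩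
    rw [contractInl_compLinearMap, hM, hz] at hmem
    have h1 := PluckerVariety.compLinearMap_mem_forms hmem i
    rw [compLinearMap_compLinearMap, LinearMap.comp_assoc, hq, LinearMap.comp_id,
      ← PluckerVariety.domDomCongr_mem_forms g] at h1
    have h2 := contractInl_mem_forms (α := ((fixLeft α z).domDomCongr g).compLinearMap L') h1
    rwa [contractInl_compLinearMap, hL', hz'] at h2
  · have h1 : fixLeft α z ∉ P.forms κ I := fun hmem => h (PluckerVariety.compLinearMap_mem_forms
      (PluckerVariety.fixLeft_mem_forms ((PluckerVariety.domDomCongr_mem_forms g).2 hmem) z') L)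
    -- Here γ ⊕ J fills the whole space. For independent z, completed to a basis, the contraction is
    -- recovered from its restriction to the other basis vectors. For dependent z it is zero, so
    -- zero is outside the variety and every map serves, in particular the zero map.
    by_cases hz : LinearIndependent K z
    · let s : γ ⊕ J ≃ I := Fintype.equivOfCardEq hJ
      obtain ⟨G, H, hG, hGH⟩ := exists_matrix_extending hz (e := fun k => s (Sum.inl k))
        (s.injective.comp Sum.inl_injective)
      let M : (γ ⊕ J → K) →ₗ[K] (I → K) := Fintype.linearCombination K fun x i => G (s x) i
      have hzM : (fun k => M (Pi.single (Sum.inl k) 1)) = z := by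
        ext k i
        simp [M, Fintype.linearCombination_apply_single, hG]
      have hM : Function.Injective M := by
        rw [← linearIndependent_iff_injective_fintypeLinearCombination]
        have h2 : LinearIndependent K fun i => G i := Matrix.linearIndependent_rows_iff_isUnit.2
          ((Matrix.isUnit_iff_isUnit_det G).2
            (isUnit_iff_ne_zero.2 (det_ne_zero_of_mul_transpose hGH)))
        exact h2.comp s s.injective
      obtain ⟨Q, hQ⟩ := M.exists_rightInverse_of_surjective (LinearMap.range_eq_top.2
        ((LinearMap.injective_iff_surjective_of_finrank_eq_finrank (by simpa using hJ)).1 hM))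
      refine ⟨M, fun hmem => h1 ?_⟩
      have h2 := PluckerVariety.compLinearMap_mem_forms hmem
        (LinearMap.funLeft K K (Sum.inr : J → γ ⊕ J))
      rw [← fixLeft_single_eq (γ := γ), fixLeft_compLinearMap, hzM] at h2
      have h3 := PluckerVariety.compLinearMap_mem_forms h2 Q
      rwa [compLinearMap_compLinearMap, hQ] at h3
    · rw [fixLeft_eq_zero hz] at h1
      exact ⟨0, fun hmem => h1 (PluckerVariety.zero_mem_forms hmem)⟩

theorem exists_linearEquiv_comp_eq {z : J → I → K} (hz : LinearIndependent K z) {e : J → I}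
    (he : Function.Injective e) : ∃ G : (I → K) ≃ₗ[K] (I → K), ∀ j, G (Pi.single (e j) 1) = z j := by
  obtain ⟨G, H, hG, hGH⟩ := exists_matrix_extending hz he
  have h2 : LinearIndependent K fun i => G i := Matrix.linearIndependent_rows_iff_isUnit.2
    ((Matrix.isUnit_iff_isUnit_det G).2 (isUnit_iff_ne_zero.2 (det_ne_zero_of_mul_transpose hGH)))
  refine ⟨LinearEquiv.ofInjectiveEndo (Fintype.linearCombination K fun i => G i)
    (linearIndependent_iff_injective_fintypeLinearCombination.1 h2), fun j => ?_⟩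
  simp [Fintype.linearCombination_apply_single, hG]

/-- Some contraction, along standard basis vectors and after a base change, of a form with a small
minor outside a Plücker variety is outside the Plücker variety. -/
theorem HasSmallMinor.exists_linearEquiv [Infinite K] {α : Alt K (γ ⊕ κ) I}
    (h : HasSmallMinor P N α) (hκ : min (Fintype.card (γ ⊕ κ)) N ≤ Fintype.card κ)
    (hJ : N + Fintype.card κ ≤ Fintype.card J ∨ Fintype.card (γ ⊕ J) = Fintype.card I)
    {e : γ ⊕ J → I} (he : Function.Injective e) :
    ∃ G : (I → K) ≃ₗ[K] (I → K), (fixLeft (α.compLinearMap G.toLinearMap) fun k =>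
      Pi.single (e (Sum.inl k)) 1).compLinearMap (Fintype.linearCombination K fun j =>
        Pi.single (e (Sum.inr j)) 1) ∉ P.forms κ J := by
  obtain ⟨M, hM⟩ := h.exists_contractInl_notMem hκ hJ
  -- Nonmembership is an open condition on the linear map, so it also holds for an injective one,
  -- which extends to a base change.
  obtain ⟨M', hM', hnot⟩ := ((P.zClosed_forms (ι := κ) (I := J)).preimage
    (isPolyMap_linear (contractInl K γ κ J))).exists_injective_notMem
      (Fintype.card_le_of_injective e he) (α := α) (L := M) hM
  have hli : LinearIndependent K fun x => M' (Pi.single x 1) := by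
    rw [linearIndependent_iff_injective_fintypeLinearCombination, eq_linearCombination]
    exact hM'
  obtain ⟨G, hG⟩ := exists_linearEquiv_comp_eq hli he
  refine ⟨G, fun hmem => hnot ?_⟩
  change contractInl K γ κ J (α.compLinearMap M') ∈ P.forms κ J
  rw [contractInl_compLinearMap]
  rw [fixLeft_compLinearMap, compLinearMap_compLinearMap] at hmem
  convert hmem using 2
  · exact congr_arg (fixLeft α) (funext fun k => (hG _).symm)
  · refine (Pi.basisFun K J).ext fun j => ?_
    simp [extendInr, Fintype.linearCombination_apply_single, hG]

end Contraction

end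

end Plucker

namespace Plucker

open Module

noncomputable section

/-! ### Projections and the group action in terms of forms -/

section Coordinates

variable {K : Type u} [Field K] {P : PluckerVariety K} {n p n₀ p₀ : ℕ}

/-- The space `V_{n,p}` as a space of functions. -/
abbrev funEquiv (K : Type u) [Field K] (n p : ℕ) : VSpace K n p ≃ₗ[K] (Fin n ⊕ Fin p → K) :=
  Finsupp.linearEquivFunOnFinite K K (Fin n ⊕ Fin p)

/-- An element of `⋀ᵖ V*_{n,p}` as an alternating form. -/
def coordForm (ω : ⋀[K]^p (Dual K (VSpace K n p))) : Alt K (Fin p) (Fin n ⊕ Fin p) :=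
  (toForm K (VSpace K n p) p ω).compLinearMap (funEquiv K n p).symm.toLinearMap

theorem coordForm_mem_forms {ω : ⋀[K]^p (Dual K (VSpace K n p))} :
    coordForm ω ∈ P.forms (Fin p) (Fin n ⊕ Fin p) ↔ ω ∈ P.inst n p := by
  rw [coordForm, ← toForm_map_dualMap, PluckerVariety.toForm_mem_forms]
  refine ⟨fun h => ?_, fun h => P.map_mem _ _ _ _ _ h⟩
  have h1 := P.map_mem _ _ _ (funEquiv K n p).toLinearMap.dualMap _ h
  rw [← LinearMap.comp_apply, ← exteriorPower.map_comp] at h1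
  have h2 : (funEquiv K n p).toLinearMap.dualMap ∘ₗ (funEquiv K n p).symm.toLinearMap.dualMap =
      LinearMap.id := LinearMap.ext fun f => LinearMap.ext fun x => by simp
  rw [h2, exteriorPower.map_id] at h1
  exact h1

theorem coordForm_act (g : VSpace K n p ≃ₗ[K] VSpace K n p)
    (ω : ⋀[K]^p (Dual K (VSpace K n p))) : coordForm (act g ω) = (coordForm ω).compLinearMap
      ((funEquiv K n p).symm.trans (g.symm.trans (funEquiv K n p))).toLinearMap := by
  rw [coordForm, act, show g.symm.dualMap.toLinearMap = g.symm.toLinearMap.dualMap from rfl,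
    toForm_map_dualMap]
  ext v
  simp [coordForm]

/-- The first `p₀` elements of `Fin p`, after the others. -/
def finSplit (hp : p₀ ≤ p) : Fin p ≃ Fin (p - p₀) ⊕ Fin p₀ :=
  ((finCongr (Nat.add_sub_of_le hp).symm).trans finSumFinEquiv.symm).trans (Equiv.sumComm _ _)

theorem vert_ιMulti (hn : n₀ ≤ n) (v : Fin p → VSpace K n₀ p) :
    vert K hn p (exteriorPower.ιMulti K p v) =
      exteriorPower.ιMulti K p fun i => incl K hn le_rfl (v i) :=
  exteriorPower.map_apply_ιMulti _ _

theorem horizStep_ιMulti (v : Fin p → VSpace K n p) :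
    horizStep K n p (exteriorPower.ιMulti K p v) = exteriorPower.ιMulti K (p + 1)
      (Fin.snoc (α := fun _ => VSpace K n (p + 1)) (fun i => incl K le_rfl (Nat.le_succ p) (v i))
        (Finsupp.single (Sum.inr (Fin.last p)) 1)) := by
  change wedge K p 1 (exteriorPower.map p _ (exteriorPower.ιMulti K p v)) _ = _
  rw [exteriorPower.map_apply_ιMulti, wedge_ιMulti_ιMulti, Fin.append_right_eq_snoc]
  rfl

theorem incl_single (hn : n₀ ≤ n) (hp : p₀ ≤ p) (x : Fin n₀ ⊕ Fin p₀) :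
    incl K hn hp (Finsupp.single x 1) =
      Finsupp.single (Sum.map (Fin.castLE hn) (Fin.castLE hp) x) 1 := by
  simp [incl]

theorem horiz_ιMulti (hp : p₀ ≤ p) (v : Fin p₀ → VSpace K n p₀) :
    horiz K n hp (exteriorPower.ιMulti K p₀ v) = exteriorPower.ιMulti K p fun i =>
      if h : (i : ℕ) < p₀ then incl K le_rfl hp (v ⟨i, h⟩) else Finsupp.single (Sum.inr i) 1 := by
  induction p, hp using Nat.le_induction with
  | base =>
    rw [horiz, Nat.leRec_self, LinearMap.id_apply]
    congr 1
    ext1 i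
    rw [dif_pos i.2]
    ext x
    simp [incl]
  | succ q hq ih =>
    rw [horiz, Nat.leRec_succ _ _ hq]
    change horizStep K n q (horiz K n hq _) = _
    rw [ih, horizStep_ιMulti]
    congr 1
    ext1 i
    refine Fin.lastCases ?_ (fun i => ?_) i
    · rw [Fin.snoc_last, dif_neg (by simp [hq])]
    · rw [Fin.snoc_castSucc]
      by_cases h : (i : ℕ) < p₀
      · rw [dif_pos h, dif_pos (by simpa using h)]
        simp only [incl, Finsupp.lmapDomain_apply]
        rw [← Finsupp.mapDomain_comp]
        congr 1
        ext1 x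
        cases x <;> rfl
      · rw [dif_neg h, dif_neg (by simpa using h), incl_single]
        rfl

/-- The positions of the contracted and of the remaining basis vectors. -/
def positions (hn : n₀ ≤ n) (hp : p₀ ≤ p) : Fin (p - p₀) ⊕ (Fin n₀ ⊕ Fin p₀) → Fin n ⊕ Fin p :=
  Sum.elim (fun k => Sum.inr ((finSplit hp).symm (Sum.inl k)))
    (Sum.map (Fin.castLE hn) (Fin.castLE hp))

theorem finSplit_symm_inr (hp : p₀ ≤ p) (i : Fin p₀) :
    (finSplit hp).symm (Sum.inr i) = Fin.castLE hp i := rfl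

theorem le_finSplit_symm_inl (hp : p₀ ≤ p) (k : Fin (p - p₀)) :
    p₀ ≤ ((finSplit hp).symm (Sum.inl k) : Fin p) := by
  simp [finSplit]

theorem positions_injective (hn : n₀ ≤ n) (hp : p₀ ≤ p) :
    Function.Injective (positions hn hp) := by
  rintro (k | i | j) (k' | i' | j') h <;> simp [positions] at h ⊢
  · exact h
  · rw [← finSplit_symm_inr] at h
    simp at h
  · exact h
  · rw [← finSplit_symm_inr] at h
    simp at h
  · exact h

theorem coordForm_proj (hn : n₀ ≤ n) (hp : p₀ ≤ p) (ω : ⋀[K]^p (Dual K (VSpace K n p))) :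
    coordForm (proj K hn hp ω) = (fixLeft ((coordForm ω).domDomCongr (finSplit hp)) fun k =>
      Pi.single (positions hn hp (Sum.inl k)) 1).compLinearMap (Fintype.linearCombination K fun j =>
        Pi.single (positions hn hp (Sum.inr j)) 1) := by
  ext v
  have h1 : ∀ w : Fin p₀ → VSpace K n₀ p₀, toForm K _ p₀ (proj K hn hp ω) w =
      dualEquiv K _ p ω (horiz K n hp (vert K hn p₀ (exteriorPower.ιMulti K p₀ w))) := fun w => by
    rw [toForm_apply]
    change dualEquiv K _ p₀ ((dualEquiv K _ p₀).symm _) _ = _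
    rw [LinearEquiv.apply_symm_apply]
    rfl
  change toForm K _ p₀ (proj K hn hp ω) (fun i => (funEquiv K n₀ p₀).symm (v i)) = _
  rw [h1, vert_ιMulti, horiz_ιMulti, ← toForm_apply]
  change _ = toForm K _ p ω fun i => (funEquiv K n p).symm (Sum.elim _ _ (finSplit hp i))
  congr 1
  ext1 i
  obtain ⟨x, rfl⟩ := (finSplit hp).symm.surjective i
  rw [Equiv.apply_symm_apply]
  rcases x with k | j
  · rw [dif_neg (not_lt.2 (le_finSplit_symm_inl hp k)), Sum.elim_inl]
    simp [positions]
  · have hj : (((finSplit hp).symm (Sum.inr j) : Fin p) : ℕ) = j := rfl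
    rw [dif_pos (by rw [hj]; exact j.2), Sum.elim_inr]
    have h2 : incl K le_rfl hp ∘ₗ incl K hn le_rfl ∘ₗ (funEquiv K n₀ p₀).symm.toLinearMap =
        (funEquiv K n p).symm.toLinearMap ∘ₗ Fintype.linearCombination K fun j =>
          Pi.single (positions hn hp (Sum.inr j)) 1 := by
      refine (Pi.basisFun K (Fin n₀ ⊕ Fin p₀)).ext fun x => ?_
      simp only [Pi.basisFun_apply, LinearMap.comp_apply, LinearEquiv.coe_coe,
        Finsupp.linearEquivFunOnFinite_symm_single, Fintype.linearCombination_apply_single,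
        one_smul, incl_single]
      congr 1
      cases x <;> rfl
    exact LinearMap.congr_fun h2 (v j)

theorem proj_act_mem_inst {hn : n₀ ≤ n} {hp : p₀ ≤ p} {ω : ⋀[K]^p (Dual K (VSpace K n p))}
    (h : ω ∈ P.inst n p) (g : VSpace K n p ≃ₗ[K] VSpace K n p) :
    proj K hn hp (act g ω) ∈ P.inst n₀ p₀ := by
  rw [← coordForm_mem_forms, coordForm_proj, coordForm_act]
  refine PluckerVariety.compLinearMap_mem_forms (PluckerVariety.fixLeft_mem_forms ?_ _) _
  rw [PluckerVariety.domDomCongr_mem_forms]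
  exact PluckerVariety.compLinearMap_mem_forms (coordForm_mem_forms.2 h) _

end Coordinates

end

end Plucker

theorem corollary7p2 {K : Type u} [Field K] [Infinite K]
    (P : Plucker.PluckerVariety K) (hP : P.IsBounded) :
    ∃ n₀ p₀ : ℕ, ∀ (n p : ℕ) (ω : ⋀[K]^p (Module.Dual K (Plucker.VSpace K n p))),
      ω ∉ P.inst n p ↔
        ∃ g : Plucker.VSpace K n p ≃ₗ[K] Plucker.VSpace K n p,
          Plucker.proj K (min_le_left n n₀) (min_le_left p p₀) (Plucker.act g ω) ∉
            P.inst (min n n₀) (min p p₀) := by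
  obtain ⟨N, hN⟩ := hP.exists_hasSmallMinor
  refine ⟨N, N, fun n p ω => ⟨fun hω => ?_, fun ⟨g, hg⟩ hω => hg (Plucker.proj_act_mem_inst hω g)⟩⟩
  have h := hN p n (Fin n ⊕ Fin p) (Plucker.coordForm ω) (by simp [add_comm])
    fun hmem => hω (Plucker.coordForm_mem_forms.1 hmem)
  -- If N ≤ n the target has room for N further dimensions beside the min p N arguments left;
  -- otherwise no dimension is dropped and contracted and remaining positions fill all n + p. These
  -- are the two cases allowed for J.
  obtain ⟨G, hG⟩ := (h.domDomCongr (Plucker.finSplit (min_le_left p N))).exists_linearEquiv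
    (J := Fin (min n N) ⊕ Fin (min p N)) (by simp) (by simp; omega)
    (Plucker.positions_injective (min_le_left n N) (min_le_left p N))
  -- The action is contragredient, so pulling back along G is the action of its inverse.
  refine ⟨((Plucker.funEquiv K n p).trans (G.trans (Plucker.funEquiv K n p).symm)).symm,
    fun hmem => hG ?_⟩
  rw [← Plucker.coordForm_mem_forms, Plucker.coordForm_proj, Plucker.coordForm_act] at hmem
  have hg : ((Plucker.funEquiv K n p).symm.trans
      (((Plucker.funEquiv K n p).trans (G.trans (Plucker.funEquiv K n p).symm)).symm.symm.trans
        (Plucker.funEquiv K n p))).toLinearMap = G.toLinearMap := by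
    ext; simp
  rw [hg] at hmem
  exact hmem
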